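/- Let $\mathbb T^2=\mathbb R^2/\mathbb Z^2$, let $\varepsilon>0$ and $a,b,c\in\mathbb R$, and consider the advective Cahn–Hilliard equation $$u_t+v\cdot\nabla u+\varepsilon\Delta^2u=\Delta(au^3+bu^2+cu)\quad\text{on }\mathbb T^2,\qquad u(0)=u_0 .$$ All functions are real valued, and $H^s=H^s(\mathbb T^2)$ carries the norm $\|f\|_{H^s}=\|(I-\Delta)^{s/2}f\|_{L^2}$. For $T>0$, a function $u\in C([0,T];H^2)\cap L^2((0,T];H^4)$ is called a mild solution on $[0,T]$ if for every $t\in[0,T]$ $$u(t)=e^{-t\varepsilon\Delta^2}u_0+\int_0^te^{-(t-s)\varepsilon\Delta^2}\Delta\bigl(au^3+bu^2+cu\bigr)(s)\,ds-\int_0^te^{-(t-s)\varepsilon\Delta^2}\bigl(v\cdot\nabla u\bigr)(s)\,ds ,\tag{1}$$ with Bochner integrals in $H^2$. Let $X_T$ be the space of all $u\in C([0,T];H^2)$ with $$\sup_{0<t\le T}\Bigl(t^{1/4}\|(-\Delta)^{3/2}u(t)\|_{L^2}+t^{1/2}\|\Delta^2u(t)\|_{L^2}\Bigr)<\infty .$$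 **Theorem 2.1.** For all $\varepsilon>0$, $a,b,c\in\mathbb R$ and $V,R\ge0$ there is a time $0<T\le1$, depending only on $\varepsilon,a,b,c,V,R$, such that the following holds for every divergence-free flow $v\in L^\infty([0,\infty);W^{1,\infty}(\mathbb T^2;\mathbb R^2))$ with $\|v\|_{L^\infty([0,\infty);W^{1,\infty})}\le V$ and every $u_0\in H^2$ with $\|u_0\|_{H^2}\le R$. There is a mild solution $u$ on $[0,T]$ with initial data $u_0$. It belongs to $X_T$, every mild solution on $[0,T]$ with initial data $u_0$ equals $u$ on $[0,T]$, and every $w\in X_T$ that satisfies (1) for all $t\in[0,T]$ equals $u$ on $[0,T]$. -/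

import Mathlib

open scoped ENNReal NNReal Topology
open MeasureTheory Filter

noncomputable section

namespace CahnHilliard

/- The circle `ℝ / ℤ` carries its Haar probability measure: the instances under which Mathlib
develops multivariate Fourier series. -/
attribute [local instance] instMeasureSpaceUnitAddCircle
attribute [local instance] instIsAddHaarMeasureUnitAddCircleVolume
attribute [local instance] instIsProbabilityMeasureUnitAddCircleVolume

/-- The two-dimensional flat torus `ℝ² / ℤ²`, with its Lebesgue (probability) measure `volume`. -/
abbrev Torus : Type := UnitAddTorus (Fin 2)

/-- The space `L²(𝕋²)`. Functions are complex valued; real-valuedness is imposed by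
`IsRealValued` wherever the functions are meant to be real. -/
abbrev L2 : Type := Lp ℂ 2 (volume : Measure Torus)

/-- `f` takes real values almost everywhere. -/
def IsRealValued (f : L2) : Prop := ∀ᵐ x, (f x).im = 0

/-- `|2πk|²`, the eigenvalue of `-Δ` on the character `x ↦ exp (2πi k·x)`. -/
def freqSq (k : Fin 2 → ℤ) : ℝ := ∑ j, (2 * Real.pi * (k j : ℝ)) ^ 2

/-- The inhomogeneous Sobolev norm `‖f‖_{H^s} = ‖(I - Δ)^{s/2} f‖_{L²}`, as an extended real
(`∞` if `f ∉ H^s`). -/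
def sobolevNorm (s : ℝ) (f : L2) : ℝ≥0∞ :=
  (∑' k : Fin 2 → ℤ,
    ENNReal.ofReal ((1 + freqSq k) ^ s * ‖UnitAddTorus.mFourierCoeff f k‖ ^ 2)) ^ (1 / 2 : ℝ)

/-- The homogeneous Sobolev norm `‖(-Δ)^{s/2} f‖_{L²}`, for `s > 0`, as an extended real. -/
def homSobolevNorm (s : ℝ) (f : L2) : ℝ≥0∞ :=
  (∑' k : Fin 2 → ℤ,
    ENNReal.ofReal (freqSq k ^ s * ‖UnitAddTorus.mFourierCoeff f k‖ ^ 2)) ^ (1 / 2 : ℝ)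

open Classical in
/-- The inverse Fourier transform `∑ₖ aₖ exp (2πi k·x)` of a square summable family
(and `0` if the family is not square summable). -/
def fourierInv (a : (Fin 2 → ℤ) → ℂ) : L2 :=
  if h : Memℓp a 2 then UnitAddTorus.mFourierBasis.repr.symm ⟨a, h⟩ else 0

/-- The semigroup `e^{-τΔ²}`: multiplication of the Fourier coefficients by `exp (-τ |2πk|⁴)`. -/
def biLaplaceSemigroup (τ : ℝ) (f : Torus → ℂ) : L2 :=
  fourierInv fun k => (Real.exp (-(τ * freqSq k ^ 2)) : ℂ) * UnitAddTorus.mFourierCoeff f k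

/-- The Laplacian of `f ∈ H²`, as an element of `L²`. -/
def laplacian (f : Torus → ℂ) : L2 :=
  fourierInv fun k => (-(freqSq k) : ℂ) * UnitAddTorus.mFourierCoeff f k

/-- The partial derivative `∂ⱼ f` of `f ∈ H¹`, as an element of `L²`. -/
def partialDeriv (j : Fin 2) (f : Torus → ℂ) : L2 :=
  fourierInv fun k =>
    (2 * Real.pi * Complex.I * (k j : ℂ)) * UnitAddTorus.mFourierCoeff f k

/-- Smooth real functions on the torus: the `ℤ²`-periodic lift to `ℝ²` is `C^∞`. -/
def IsSmooth (φ : Torus → ℝ) : Prop :=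
  ContDiff ℝ (⊤ : ℕ∞) fun y : Fin 2 → ℝ => φ fun j => (y j : UnitAddCircle)

/-- The classical partial derivative of a function on the torus. -/
def classicalDeriv (j : Fin 2) (φ : Torus → ℝ) (x : Torus) : ℝ :=
  deriv (fun h : ℝ => φ (x + Pi.single j (h : UnitAddCircle))) 0

/-- `g` is the weak partial derivative `∂ⱼ f` on the torus. -/
def IsWeakDeriv (j : Fin 2) (f g : Torus → ℝ) : Prop :=
  Integrable f ∧ Integrable g ∧
    ∀ φ : Torus → ℝ, IsSmooth φ → ∫ x, f x * classicalDeriv j φ x = -∫ x, g x * φ x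

/-- The norm of the Sobolev space `W^{1,∞}(𝕋²)`, as an extended real: it is `∞` if `f` is not
essentially bounded or lacks an essentially bounded weak gradient (an infimum over the empty set
is `∞`; weak derivatives are unique almost everywhere, so that the infima merely evaluate the norm
of the weak derivative). -/
def w1InfNorm (f : Torus → ℝ) : ℝ≥0∞ :=
  eLpNorm f ∞ volume +
    ∑ j : Fin 2, ⨅ (g : Torus → ℝ) (_ : IsWeakDeriv j f g), eLpNorm g ∞ volume

/-- The norm of `L^∞([0,∞); W^{1,∞}(𝕋²; ℝ²))`. -/
def flowNorm (v : ℝ → Torus → Fin 2 → ℝ) : ℝ≥0∞ :=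
  essSup (fun t : ℝ => ⨆ i : Fin 2, w1InfNorm fun x => v t x i) (volume.restrict (Set.Ici 0))

/-- `v` is a divergence-free flow in `L^∞([0,∞); W^{1,∞})`. -/
structure IsDivFreeFlow (v : ℝ → Torus → Fin 2 → ℝ) : Prop where
  aestronglyMeasurable : AEStronglyMeasurable (fun p : ℝ × Torus => v p.1 p.2)
    ((volume.restrict (Set.Ici 0)).prod volume)
  flowNorm_lt_top : flowNorm v < ∞
  /-- The divergence vanishes in the weak sense. -/
  divFree : ∀ᵐ t ∂(volume.restrict (Set.Ici (0 : ℝ))), ∀ φ : Torus → ℝ, IsSmooth φ →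
    ∫ x, ∑ i : Fin 2, v t x i * classicalDeriv i φ x = 0

/-- The Duhamel integrand `e^{-(t-s)εΔ²} Δ(a u³ + b u² + c u)` at time `s`. -/
def nonlinearIntegrand (ε a b c : ℝ) (u : ℝ → L2) (t s : ℝ) : L2 :=
  biLaplaceSemigroup ((t - s) * ε) (laplacian fun x =>
    (a : ℂ) * u s x ^ 3 + (b : ℂ) * u s x ^ 2 + (c : ℂ) * u s x)

/-- The Duhamel integrand `e^{-(t-s)εΔ²} (v·∇u)` at time `s`. -/
def advectionIntegrand (ε : ℝ) (v : ℝ → Torus → Fin 2 → ℝ) (u : ℝ → L2) (t s : ℝ) : L2 :=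
  biLaplaceSemigroup ((t - s) * ε) fun x =>
    ∑ i : Fin 2, (v s x i : ℂ) * partialDeriv i (u s) x

/-- Bochner integrability on `(0,t]` as a function with values in `H²`. (A strongly measurable
`L²`-valued function that takes values in `H²` is strongly measurable into `H²`, because `H²` is
separable and embeds continuously into `L²`; and its integral in `H²` is its integral in `L²`.) -/
def H2Integrable (t : ℝ) (G : ℝ → L2) : Prop :=
  AEStronglyMeasurable G (volume.restrict (Set.Ioc 0 t)) ∧
    ∫⁻ s in Set.Ioc 0 t, sobolevNorm 2 (G s) < ∞

/-- `u` solves, at every time `t ∈ [0,T]`, the integral equation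
`u(t) = e^{-tεΔ²}u₀ + ∫₀ᵗ e^{-(t-s)εΔ²} Δ(a u³ + b u² + c u) ds - ∫₀ᵗ e^{-(t-s)εΔ²} (v·∇u) ds`
with Bochner integrals in `H²`. -/
def SolvesDuhamel (ε a b c : ℝ) (v : ℝ → Torus → Fin 2 → ℝ) (u₀ : L2) (T : ℝ) (u : ℝ → L2) :
    Prop :=
  ∀ t ∈ Set.Icc 0 T,
    H2Integrable t (nonlinearIntegrand ε a b c u t) ∧
    H2Integrable t (advectionIntegrand ε v u t) ∧
    u t = biLaplaceSemigroup (t * ε) u₀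
      + (∫ s in Set.Ioc 0 t, nonlinearIntegrand ε a b c u t s)
      - ∫ s in Set.Ioc 0 t, advectionIntegrand ε v u t s

/-- `u ∈ C([0,T]; H²)`, real valued. -/
def InCH2 (T : ℝ) (u : ℝ → L2) : Prop :=
  ∀ t ∈ Set.Icc 0 T, IsRealValued (u t) ∧ sobolevNorm 2 (u t) < ∞ ∧
    Tendsto (fun s => sobolevNorm 2 (u s - u t)) (𝓝[Set.Icc 0 T] t) (𝓝 0)

/-- `u ∈ L²((0,T]; H⁴)`. -/
def InL2H4 (T : ℝ) (u : ℝ → L2) : Prop :=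
  AEStronglyMeasurable u (volume.restrict (Set.Ioc 0 T)) ∧
    ∫⁻ t in Set.Ioc 0 T, sobolevNorm 4 (u t) ^ 2 < ∞

/-- `u` is a mild solution on `[0,T]` with initial data `u₀`. -/
structure IsMildSolution (ε a b c : ℝ) (v : ℝ → Torus → Fin 2 → ℝ) (u₀ : L2) (T : ℝ)
    (u : ℝ → L2) : Prop where
  continuous_H2 : InCH2 T u
  sqIntegrable_H4 : InL2H4 T u
  duhamel : SolvesDuhamel ε a b c v u₀ T u

/-- Membership in the weighted space `X_T`: continuity into `H²` and finiteness of
`sup_{0<t≤T} (t^{1/4} ‖Δ^{3/2}u(t)‖_{L²} + t^{1/2} ‖Δ²u(t)‖_{L²})`. -/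
def InXT (T : ℝ) (u : ℝ → L2) : Prop :=
  InCH2 T u ∧
    (⨆ t ∈ Set.Ioc 0 T,
      (ENNReal.ofReal (t ^ (1 / 4 : ℝ)) * homSobolevNorm 3 (u t)
        + ENNReal.ofReal (t ^ (1 / 2 : ℝ)) * homSobolevNorm 4 (u t))) < ∞

end CahnHilliard

end

noncomputable section

namespace CahnHilliard

open UnitAddTorus
open scoped ComplexConjugate

attribute [local instance] instMeasureSpaceUnitAddCircle
attribute [local instance] instIsAddHaarMeasureUnitAddCircleVolume
attribute [local instance] instIsProbabilityMeasureUnitAddCircleVolume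

/-! Write the equation as `u_t + εΔ²u = F(u)` with `F(u) = Δ(au³+bu²+cu) - v·∇u`. Two facts make it
well posed in `H²` for a short time.

First, `F` is locally Lipschitz from `H²` to `L²`. In dimension two `∑ (1+|2πk|²)⁻²` converges, so
`H²` embeds in the Wiener algebra and is itself an algebra; the cubic term is then Lipschitz on
bounded sets of `H²`, and `Δ` lands in `L²`. The advective term is linear in `u` and is bounded by
`‖v‖_∞` (`exists_forceSeq_lipschitz`).

Second, the Duhamel integral maps `L²(0,T;L²)` to `C([0,T];H²)` and to `L²(0,T;H⁴)`. Both follow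
from one multiplier bound, `(1+|2πk|²)² ∫₀¹ e^{-τε|2πk|⁴} dτ ≤ 2 + 2/ε` (`wt_two_mul_heatMass_le`).
A forcing bounded in `L²` has `L²(0,T;L²)` norm at most a multiple of `T^{1/2}`, so for small `T`
the mild map contracts a ball of `C([0,T];H²)` (`exists_local_solution`). The length of `T` is
dictated only by the Lipschitz constant and the bound of `F` on that ball.

Uniqueness needs nothing beyond continuity into `H²`: the energy estimate gives `‖u-w‖²_{H²}(t) ≤ K
∫₀ᵗ ‖u-w‖²_{H²}`, and Gronwall concludes (`solvesDuhamel_unique`). Both uniqueness claims are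
instances.

Membership in `X_T` is a two-step bootstrap (`InCH2.regularity`). The free evolution of `u₀` has the
rates `t^{-1/4}` in `H³` and `t^{-1/2}` in `H⁴`. The Duhamel integral gains three derivatives
pointwise in time, so `F(u) ∈ L²` gives `H³` with rate `t^{-1/4}`. The tame estimate and the
Lipschitz bound on `v` carry this rate to `F(u)` in `H¹`, and three further derivatives reach `H⁴`.

All of this is done on Fourier coefficients. Physical space enters for multiplication by bounded
functions, for weak derivatives, and to identify products with convolutions. -/

/-- Frequencies on the two-dimensional torus. -/
abbrev Freq : Type := Fin 2 → ℤ

/-! ### Frequencies and Fourier weights. -/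

theorem freqSq_nonneg (k : Freq) : 0 ≤ freqSq k := Finset.sum_nonneg fun _ _ => sq_nonneg _

theorem freqSq_neg (k : Freq) : freqSq (-k) = freqSq k := by simp [freqSq]

theorem freqSq_add_le (k l : Freq) : freqSq (k + l) ≤ 2 * freqSq k + 2 * freqSq l := by
  simp only [freqSq, Finset.mul_sum, ← Finset.sum_add_distrib]
  refine Finset.sum_le_sum fun j _ => ?_
  push_cast [Pi.add_apply]
  nlinarith [sq_nonneg (2 * Real.pi * (k j : ℝ) - 2 * Real.pi * (l j : ℝ))]

/-- The Fourier weight `(1 + |2πk|²)^s`. -/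
def wt (s : ℝ) (k : Freq) : ℝ≥0∞ := ENNReal.ofReal ((1 + freqSq k) ^ s)

theorem one_le_weight (k : Freq) : 1 ≤ 1 + freqSq k := le_add_of_nonneg_right (freqSq_nonneg k)

theorem weight_pos (k : Freq) : 0 < 1 + freqSq k := zero_lt_one.trans_le (one_le_weight k)

theorem wt_ne_top (s : ℝ) (k : Freq) : wt s k ≠ ∞ := ENNReal.ofReal_ne_top

theorem wt_zero (k : Freq) : wt 0 k = 1 := by simp [wt]

theorem wt_add (s t : ℝ) (k : Freq) : wt (s + t) k = wt s k * wt t k := by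
  rw [wt, Real.rpow_add (weight_pos k), ENNReal.ofReal_mul (Real.rpow_nonneg (weight_pos k).le _)]
  rfl

theorem wt_mono {s t : ℝ} (h : s ≤ t) (k : Freq) : wt s k ≤ wt t k :=
  ENNReal.ofReal_le_ofReal (Real.rpow_le_rpow_of_exponent_le (one_le_weight k) h)

theorem wt_half_sq (s : ℝ) (k : Freq) : wt (s / 2) k ^ 2 = wt s k := by
  rw [sq, ← wt_add, add_halves]

/-- Since `1+|k+l|² ≤ 4 max(1+|k|², 1+|l|²)` and a power of a maximum is at most the sum of the
powers, the weight of a convolution can be moved onto one of its two factors. -/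
theorem wt_add_freq_le {s : ℝ} (hs : 0 ≤ s) (k l : Freq) :
    wt s (k + l) ≤ ENNReal.ofReal (4 ^ s) * (wt s k + wt s l) := by
  have hk := (weight_pos k).le
  have hl := (weight_pos l).le
  rw [wt, wt, wt, ← ENNReal.ofReal_add (by positivity) (by positivity),
    ← ENNReal.ofReal_mul (by positivity)]
  refine ENNReal.ofReal_le_ofReal ?_
  have h1 : 1 + freqSq (k + l) ≤ 4 * max (1 + freqSq k) (1 + freqSq l) := by
    have := freqSq_add_le k l
    have := le_max_left (1 + freqSq k) (1 + freqSq l)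
    have := le_max_right (1 + freqSq k) (1 + freqSq l)
    linarith
  calc (1 + freqSq (k + l)) ^ s ≤ (4 * max (1 + freqSq k) (1 + freqSq l)) ^ s :=
        Real.rpow_le_rpow (weight_pos _).le h1 hs
    _ = 4 ^ s * (max (1 + freqSq k) (1 + freqSq l)) ^ s :=
        Real.mul_rpow (by norm_num) (hk.trans (le_max_left _ _))
    _ ≤ _ := by
        gcongr
        rcases max_choice (1 + freqSq k) (1 + freqSq l) with h | h <;> rw [h]
        · exact le_add_of_nonneg_right (Real.rpow_nonneg hl _)
        · exact le_add_of_nonneg_left (Real.rpow_nonneg hk _)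

/-! ### Cauchy–Schwarz and Young inequalities -/

section CauchySchwarz

variable {α : Type*} [MeasurableSpace α] (μ : Measure α)

theorem sq_lintegral_mul_le {f g : α → ℝ≥0∞} (hf : AEMeasurable f μ) (hg : AEMeasurable g μ) :
    (∫⁻ x, f x * g x ∂μ) ^ 2 ≤ (∫⁻ x, f x ^ 2 ∂μ) * ∫⁻ x, g x ^ 2 ∂μ := by
  have h := ENNReal.lintegral_mul_le_Lp_mul_Lq μ Real.HolderConjugate.two_two hf hg
  calc (∫⁻ x, f x * g x ∂μ) ^ 2
      ≤ ((∫⁻ a, f a ^ (2 : ℝ) ∂μ) ^ (1 / 2 : ℝ) * (∫⁻ a, g a ^ (2 : ℝ) ∂μ) ^ (1 / 2 : ℝ)) ^ 2 := by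
        gcongr
        exact h
    _ = _ := by
        rw [mul_pow, ← ENNReal.rpow_natCast, ← ENNReal.rpow_natCast, ← ENNReal.rpow_mul,
          ← ENNReal.rpow_mul]
        norm_num

/-- Cauchy–Schwarz after writing `κ = κ^{1/2} κ^{1/2}`. This form serves for every kernel below: one
mass of the kernel comes out and the kernel stays under the integral. -/
theorem sq_lintegral_weight_mul_le {κ g : α → ℝ≥0∞} (hκ : AEMeasurable κ μ)
    (hg : AEMeasurable g μ) :
    (∫⁻ x, κ x * g x ∂μ) ^ 2 ≤ (∫⁻ x, κ x ∂μ) * ∫⁻ x, κ x * g x ^ 2 ∂μ := by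
  have hs : ∀ x, (κ x ^ (1 / 2 : ℝ)) ^ 2 = κ x := fun x => by
    rw [← ENNReal.rpow_natCast, ← ENNReal.rpow_mul]; norm_num
  have h := sq_lintegral_mul_le μ (f := fun x => κ x ^ (1 / 2 : ℝ))
    (g := fun x => κ x ^ (1 / 2 : ℝ) * g x) (hκ.pow_const _) ((hκ.pow_const _).mul hg)
  simpa only [← mul_assoc, mul_pow, ← sq, hs] using h

end CauchySchwarz

/-- Sums are integrals for the counting measure; with the σ-algebra `⊤` measurability is free. -/
theorem sq_tsum_weight_mul_le {ι : Type*} (κ g : ι → ℝ≥0∞) :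
    (∑' i, κ i * g i) ^ 2 ≤ (∑' i, κ i) * ∑' i, κ i * g i ^ 2 := by
  let _ : MeasurableSpace ι := ⊤
  have := sq_lintegral_weight_mul_le (Measure.count : Measure ι) (κ := κ) (g := g)
    measurable_from_top.aemeasurable measurable_from_top.aemeasurable
  simpa only [lintegral_count] using this

theorem sq_tsum_mul_le {ι : Type*} (f g : ι → ℝ≥0∞) :
    (∑' i, f i * g i) ^ 2 ≤ (∑' i, f i ^ 2) * ∑' i, g i ^ 2 := by
  let _ : MeasurableSpace ι := ⊤
  have := sq_lintegral_mul_le (Measure.count : Measure ι) (f := f) (g := g)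
    measurable_from_top.aemeasurable measurable_from_top.aemeasurable
  simpa only [lintegral_count] using this

theorem tsum_sub_left {G : Type*} [AddCommGroup G] (f : G → ℝ≥0∞) (k : G) :
    ∑' l, f (k - l) = ∑' l, f l :=
  (Equiv.subLeft k).tsum_eq f

theorem tsum_sub_right {G : Type*} [AddCommGroup G] (f : G → ℝ≥0∞) (l : G) :
    ∑' k, f (k - l) = ∑' k, f k :=
  (Equiv.subRight l).tsum_eq f

/-- Young's convolution inequality `ℓ¹ * ℓ² → ℓ²`. -/
theorem tsum_sq_conv_le {G : Type*} [AddCommGroup G] (α β : G → ℝ≥0∞) :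
    ∑' k, (∑' l, α (k - l) * β l) ^ 2 ≤ (∑' k, α k) ^ 2 * ∑' k, β k ^ 2 := by
  -- Schur's test: Cauchy–Schwarz with weight `α (k - l)`, whose sums over `l` and over `k` both
  -- equal the `ℓ¹` norm of `α`.
  calc ∑' k, (∑' l, α (k - l) * β l) ^ 2
      ≤ ∑' k, (∑' l, α (k - l)) * ∑' l, α (k - l) * β l ^ 2 :=
        ENNReal.tsum_le_tsum fun k => sq_tsum_weight_mul_le _ _
    _ = (∑' k, α k) * ∑' l, ∑' k, α (k - l) * β l ^ 2 := by
        simp_rw [tsum_sub_left, ENNReal.tsum_mul_left]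
        rw [ENNReal.tsum_comm]
    _ = _ := by
        simp_rw [ENNReal.tsum_mul_right, tsum_sub_right, ENNReal.tsum_mul_left]
        rw [sq, mul_assoc]

theorem conv_comm_ennreal {G : Type*} [AddCommGroup G] (α β : G → ℝ≥0∞) (k : G) :
    ∑' l, α (k - l) * β l = ∑' l, β (k - l) * α l := by
  rw [← tsum_sub_left (fun l => α (k - l) * β l) k]
  simp only [sub_sub_cancel, mul_comm]

/-! ### Weighted `ℓ²` norms of families of Fourier coefficients -/

/-- The square of the `H^s` norm of the function with Fourier coefficients `a`. -/
def sqNorm (s : ℝ) (a : Freq → ℂ) : ℝ≥0∞ := ∑' k, wt s k * ‖a k‖ₑ ^ 2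

/-- The Wiener norm of the function with Fourier coefficients `a`. -/
def wienerNorm (a : Freq → ℂ) : ℝ≥0∞ := ∑' k, ‖a k‖ₑ

theorem ofReal_weight_mul_norm_sq (s : ℝ) (k : Freq) (z : ℂ) :
    ENNReal.ofReal ((1 + freqSq k) ^ s * ‖z‖ ^ 2) = wt s k * ‖z‖ₑ ^ 2 := by
  rw [ENNReal.ofReal_mul (Real.rpow_nonneg (weight_pos k).le _), ENNReal.ofReal_pow (norm_nonneg _),
    ofReal_norm]
  rfl

theorem sobolevNorm_sq (s : ℝ) (f : L2) :
    sobolevNorm s f ^ 2 = sqNorm s (UnitAddTorus.mFourierCoeff f) := by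
  simp_rw [sobolevNorm, ofReal_weight_mul_norm_sq]
  rw [← ENNReal.rpow_natCast, ← ENNReal.rpow_mul]
  norm_num
  rfl

theorem sobolevNorm_eq (s : ℝ) (f : L2) :
    sobolevNorm s f = sqNorm s (UnitAddTorus.mFourierCoeff f) ^ (1 / 2 : ℝ) := by
  simp_rw [sobolevNorm, ofReal_weight_mul_norm_sq]
  rfl

theorem sobolevNorm_lt_top_iff {s : ℝ} {f : L2} :
    sobolevNorm s f < ∞ ↔ sqNorm s (UnitAddTorus.mFourierCoeff f) < ∞ := by
  rw [← sobolevNorm_sq]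
  simp [lt_top_iff_ne_top]

theorem sobolevNorm_le_iff {s : ℝ} {f : L2} {B : ℝ≥0∞} :
    sobolevNorm s f ≤ B ↔ sqNorm s (UnitAddTorus.mFourierCoeff f) ≤ B ^ 2 := by
  rw [← sobolevNorm_sq]
  exact (ENNReal.pow_le_pow_left_iff two_ne_zero).symm

theorem homSobolevNorm_le {s : ℝ} (hs : 0 ≤ s) (f : L2) : homSobolevNorm s f ≤ sobolevNorm s f := by
  refine ENNReal.rpow_le_rpow (ENNReal.tsum_le_tsum fun k => ENNReal.ofReal_le_ofReal ?_)
    (by norm_num)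
  gcongr
  · exact freqSq_nonneg k
  · linarith

theorem sqNorm_mono {s t : ℝ} (h : s ≤ t) (a : Freq → ℂ) : sqNorm s a ≤ sqNorm t a :=
  ENNReal.tsum_le_tsum fun k => mul_le_mul_left (wt_mono h k) _

theorem sqNorm_le_of_norm_le {s t : ℝ} {a b : Freq → ℂ} {C : ℝ≥0∞}
    (h : ∀ k, wt s k * ‖a k‖ₑ ^ 2 ≤ C * (wt t k * ‖b k‖ₑ ^ 2)) : sqNorm s a ≤ C * sqNorm t b := by
  rw [sqNorm, sqNorm, ← ENNReal.tsum_mul_left]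
  exact ENNReal.tsum_le_tsum h

theorem ennreal_add_sq_le (a b : ℝ≥0∞) : (a + b) ^ 2 ≤ 2 * (a ^ 2 + b ^ 2) := by
  have := ENNReal.rpow_add_le_mul_rpow_add_rpow a b (p := 2) (by norm_num)
  norm_num at this
  exact_mod_cast this

/-- Squared norms cost a factor 2 in the triangle inequality, but every estimate then becomes an
inequality between the terms of two series. -/
theorem sqNorm_add_le (s : ℝ) (a b : Freq → ℂ) :
    sqNorm s (a + b) ≤ 2 * (sqNorm s a + sqNorm s b) := by
  rw [sqNorm, sqNorm, sqNorm, ← ENNReal.tsum_add, ← ENNReal.tsum_mul_left]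
  refine ENNReal.tsum_le_tsum fun k => ?_
  calc wt s k * ‖(a + b) k‖ₑ ^ 2 ≤ wt s k * (‖a k‖ₑ + ‖b k‖ₑ) ^ 2 := by
        gcongr; exact enorm_add_le _ _
    _ ≤ wt s k * (2 * (‖a k‖ₑ ^ 2 + ‖b k‖ₑ ^ 2)) := by
        gcongr; exact ennreal_add_sq_le _ _
    _ = _ := by ring

theorem sqNorm_neg (s : ℝ) (a : Freq → ℂ) : sqNorm s (-a) = sqNorm s a := by
  simp [sqNorm]

theorem sqNorm_sub_le (s : ℝ) (a b : Freq → ℂ) :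
    sqNorm s (a - b) ≤ 2 * (sqNorm s a + sqNorm s b) := by
  rw [sub_eq_add_neg, ← sqNorm_neg s b]
  exact sqNorm_add_le s a (-b)

theorem sqNorm_smul (s : ℝ) (c : ℂ) (a : Freq → ℂ) : sqNorm s (c • a) = ‖c‖ₑ ^ 2 * sqNorm s a := by
  rw [sqNorm, sqNorm, ← ENNReal.tsum_mul_left]
  refine tsum_congr fun k => ?_
  rw [Pi.smul_apply, smul_eq_mul, enorm_mul]
  ring

theorem sqNorm_zero (s : ℝ) : sqNorm s 0 = 0 := by simp [sqNorm]

theorem eq_zero_of_sqNorm_eq_zero {s : ℝ} {a : Freq → ℂ} (h : sqNorm s a = 0) : a = 0 := by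
  ext k
  have := ENNReal.tsum_eq_zero.mp h k
  have hw : wt s k ≠ 0 := by
    simpa [wt] using Real.rpow_pos_of_pos (weight_pos k) s
  simpa [hw] using this

theorem sqNorm_zero_eq (a : Freq → ℂ) : sqNorm 0 a = ∑' k, ‖a k‖ₑ ^ 2 := by
  simp [sqNorm, wt_zero]

/-- Here the dimension enters: off the origin the terms are at most `‖k‖⁻⁴` in the sup norm, and the
exponent 4 exceeds the dimension 2. That series is the one which bounds Eisenstein series. -/
theorem tsum_wt_neg_two_lt_top : ∑' k, wt (-2) k < ∞ := by
  have hsum : Summable fun k : Freq => (1 + freqSq k) ^ (-2 : ℝ) := by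
    have h := EisensteinSeries.summable_one_div_norm_rpow (k := 4) (by norm_num)
    refine h.of_norm_bounded_eventually ?_
    have : ∀ᶠ k : Freq in cofinite, k ≠ 0 := by simp
    filter_upwards [this] with k hk
    have hpos : 0 < ‖k‖ := norm_pos_iff.mpr hk
    have hle : ‖k‖ ^ 2 ≤ 1 + freqSq k := by
      obtain ⟨j, hj⟩ : ∃ j, ‖k‖ = ‖k j‖ := by
        obtain ⟨j, -, hj⟩ := Finset.exists_mem_eq_sup' (s := Finset.univ) Finset.univ_nonempty
          (fun i => ‖k i‖₊)
        refine ⟨j, ?_⟩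
        rw [Pi.norm_def, ← coe_nnnorm, ← hj, Finset.sup'_eq_sup]
      rw [hj, Int.norm_eq_abs, sq_abs]
      have h1 : (2 * Real.pi * (k j : ℝ)) ^ 2 ≤ freqSq k :=
        Finset.single_le_sum (f := fun j => (2 * Real.pi * (k j : ℝ)) ^ 2)
          (fun _ _ => sq_nonneg _) (Finset.mem_univ j)
      have h2 : (1 : ℝ) ≤ (2 * Real.pi) ^ 2 := by nlinarith [Real.pi_gt_three]
      nlinarith [sq_nonneg (k j : ℝ)]
    rw [Real.norm_of_nonneg (Real.rpow_nonneg (weight_pos k).le _),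
      Real.rpow_neg (weight_pos k).le, Real.rpow_neg hpos.le]
    refine inv_anti₀ (Real.rpow_pos_of_pos hpos _) ?_
    calc ‖k‖ ^ (4 : ℝ) = (‖k‖ ^ 2) ^ (2 : ℝ) := by
          rw [← Real.rpow_natCast, ← Real.rpow_mul hpos.le]; norm_num
      _ ≤ _ := Real.rpow_le_rpow (by positivity) hle (by norm_num)
  have := hsum.tsum_ofReal_lt_top
  exact this

/-- The constant of the embedding of `H²` into the Wiener algebra. -/
def wienerConst : ℝ≥0∞ := ∑' k, wt (-2) k

/-- Cauchy–Schwarz for `‖a k‖ = (1+|2πk|²)⁻¹ · (1+|2πk|²)‖a k‖`. -/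
theorem wienerNorm_sq_le (a : Freq → ℂ) : wienerNorm a ^ 2 ≤ wienerConst * sqNorm 2 a := by
  have h := sq_tsum_mul_le (fun k : Freq => wt (-1) k) (fun k => wt 1 k * ‖a k‖ₑ)
  have h1 : ∀ k, wt (-1) k * (wt 1 k * ‖a k‖ₑ) = ‖a k‖ₑ := fun k => by
    rw [← mul_assoc, ← wt_add]; norm_num [wt_zero]
  have h2 : ∀ (s : ℝ) k, wt s k ^ 2 = wt (s + s) k := fun s k => by rw [wt_add, sq]
  simp only [h1, mul_pow, h2] at h
  norm_num at h
  exact h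

/-- The convolution of two families of Fourier coefficients. -/
def conv (a b : Freq → ℂ) (k : Freq) : ℂ := ∑' l, a (k - l) * b l

/-- No summability is needed, since a divergent series has the value 0. -/
theorem enorm_conv_le (a b : Freq → ℂ) (k : Freq) : ‖conv a b k‖ₑ ≤ ∑' l, ‖a (k - l)‖ₑ * ‖b l‖ₑ := by
  simpa only [conv, enorm_mul] using enorm_tsum_le_tsum_enorm (f := fun l => a (k - l) * b l)

/-- The constant of the tame product estimate in `H^s`. -/
def tameConst (s : ℝ) : ℝ≥0∞ := ENNReal.ofReal (4 ^ (s / 2)) ^ 2 * 2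

theorem tameConst_ne_top (s : ℝ) : tameConst s ≠ ∞ := by
  simp only [tameConst]
  finiteness

/-- The tame product estimate. -/
theorem sqNorm_conv_le {s : ℝ} (hs : 0 ≤ s) (a b : Freq → ℂ) :
    sqNorm s (conv a b) ≤
      tameConst s * (wienerNorm a ^ 2 * sqNorm s b + sqNorm s a * wienerNorm b ^ 2) := by
  set D : ℝ≥0∞ := ENNReal.ofReal (4 ^ (s / 2))
  have hs2 : 0 ≤ s / 2 := by positivity
  set α : Freq → ℝ≥0∞ := fun k => ‖a k‖ₑ
  set β : Freq → ℝ≥0∞ := fun k => ‖b k‖ₑ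
  set α' : Freq → ℝ≥0∞ := fun k => wt (s / 2) k * ‖a k‖ₑ
  set β' : Freq → ℝ≥0∞ := fun k => wt (s / 2) k * ‖b k‖ₑ
  have hα' : ∑' k, α' k ^ 2 = sqNorm s a := by
    simp only [α', mul_pow, wt_half_sq]; rfl
  have hβ' : ∑' k, β' k ^ 2 = sqNorm s b := by
    simp only [β', mul_pow, wt_half_sq]; rfl
  -- Half of the weight `wt s` falls on `a` or on `b`; the other factor stays unweighted, and
  -- Young's inequality measures it in `ℓ¹`, that is, in the Wiener norm.
  have key : ∀ k, wt s k * ‖conv a b k‖ₑ ^ 2 ≤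
      D ^ 2 * 2 * ((∑' l, α (k - l) * β' l) ^ 2 + (∑' l, β (k - l) * α' l) ^ 2) := fun k => by
    have h1 : wt (s / 2) k * ‖conv a b k‖ₑ ≤
        D * ((∑' l, α (k - l) * β' l) + ∑' l, β (k - l) * α' l) := by
      rw [conv_comm_ennreal β α' k, ← ENNReal.tsum_add, ← ENNReal.tsum_mul_left]
      refine (mul_le_mul_right (enorm_conv_le a b k) _).trans ?_
      rw [← ENNReal.tsum_mul_left]
      refine ENNReal.tsum_le_tsum fun l => ?_
      have hw : wt (s / 2) k ≤ D * (wt (s / 2) (k - l) + wt (s / 2) l) := by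
        simpa using wt_add_freq_le hs2 (k - l) l
      calc wt (s / 2) k * (‖a (k - l)‖ₑ * ‖b l‖ₑ)
          ≤ D * (wt (s / 2) (k - l) + wt (s / 2) l) * (‖a (k - l)‖ₑ * ‖b l‖ₑ) := by gcongr
        _ = _ := by simp only [α, β, α', β']; ring
    calc wt s k * ‖conv a b k‖ₑ ^ 2 = (wt (s / 2) k * ‖conv a b k‖ₑ) ^ 2 := by
          rw [mul_pow, wt_half_sq]
      _ ≤ (D * ((∑' l, α (k - l) * β' l) + ∑' l, β (k - l) * α' l)) ^ 2 := by gcongr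
      _ ≤ D ^ 2 * (2 * ((∑' l, α (k - l) * β' l) ^ 2 + (∑' l, β (k - l) * α' l) ^ 2)) := by
          rw [mul_pow]
          gcongr
          exact ennreal_add_sq_le _ _
      _ = _ := by ring
  calc sqNorm s (conv a b)
      ≤ ∑' k, D ^ 2 * 2 * ((∑' l, α (k - l) * β' l) ^ 2 + (∑' l, β (k - l) * α' l) ^ 2) :=
        ENNReal.tsum_le_tsum key
    _ = D ^ 2 * 2 * ((∑' k, (∑' l, α (k - l) * β' l) ^ 2) +
          ∑' k, (∑' l, β (k - l) * α' l) ^ 2) := by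
        rw [ENNReal.tsum_mul_left, ENNReal.tsum_add]
    _ ≤ D ^ 2 * 2 * ((∑' k, α k) ^ 2 * (∑' k, β' k ^ 2) + (∑' k, β k) ^ 2 * ∑' k, α' k ^ 2) := by
        gcongr <;> exact tsum_sq_conv_le _ _
    _ = _ := by
        rw [hα', hβ', mul_comm (sqNorm s a)]
        rfl

/-- The constant of the product estimates in `H^s`, `s ≥ 2`. -/
def prodConst (s : ℝ) : ℝ≥0∞ := tameConst s * wienerConst

theorem prodConst_ne_top (s : ℝ) : prodConst s ≠ ∞ :=
  ENNReal.mul_ne_top (tameConst_ne_top s) tsum_wt_neg_two_lt_top.ne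

/-- Each term is linear in the top norm. The bootstrap depends on this, because there only the `H²`
norm is bounded uniformly in time. -/
theorem sqNorm_conv_le_tame {s : ℝ} (hs : 0 ≤ s) (a b : Freq → ℂ) :
    sqNorm s (conv a b) ≤ prodConst s * (sqNorm 2 a * sqNorm s b + sqNorm s a * sqNorm 2 b) := by
  refine (sqNorm_conv_le hs a b).trans ?_
  calc tameConst s * (wienerNorm a ^ 2 * sqNorm s b + sqNorm s a * wienerNorm b ^ 2)
      ≤ tameConst s * (wienerConst * sqNorm 2 a * sqNorm s b +
          sqNorm s a * (wienerConst * sqNorm 2 b)) := by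
        gcongr <;> exact wienerNorm_sq_le _
    _ = _ := by rw [prodConst]; ring

theorem sqNorm_two_conv_le (a b : Freq → ℂ) :
    sqNorm 2 (conv a b) ≤ 2 * prodConst 2 * (sqNorm 2 a * sqNorm 2 b) := by
  refine (sqNorm_conv_le_tame (by norm_num) a b).trans_eq ?_
  ring

/-! ### Fourier coefficients of square integrable functions -/

theorem memℓp_two_iff {a : Freq → ℂ} : Memℓp a 2 ↔ sqNorm 0 a < ∞ := by
  rw [memℓp_gen_iff (by norm_num), sqNorm_zero_eq]
  simp only [ENNReal.toReal_ofNat, Real.rpow_ofNat]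
  rw [lt_top_iff_ne_top]
  constructor
  · intro h
    have := h.tsum_ofReal_ne_top
    simpa only [ENNReal.ofReal_pow (norm_nonneg _), ofReal_norm] using this
  · intro h
    have := ENNReal.summable_toReal h
    simpa using this

theorem memℓp_mFourierCoeff (f : L2) : Memℓp (mFourierCoeff f) 2 := by
  have h := lp.memℓp (mFourierBasis.repr f)
  rwa [funext (mFourierBasis_repr f)] at h

theorem sqNorm_mFourierCoeff_lt_top (f : L2) : sqNorm 0 (mFourierCoeff f) < ∞ :=
  memℓp_two_iff.mp (memℓp_mFourierCoeff f)

/-- Square summability selects the nontrivial branch of `fourierInv`. Each formula for the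
semigroup, the Laplacian or a derivative has to check it first, the default being 0. -/
theorem mFourierCoeff_fourierInv {a : Freq → ℂ} (h : sqNorm 0 a < ∞) :
    mFourierCoeff (fourierInv a) = a := by
  ext k
  rw [← mFourierBasis_repr, fourierInv, dif_pos (memℓp_two_iff.mpr h),
    LinearIsometryEquiv.apply_symm_apply]

theorem L2_ext {f g : L2} (h : mFourierCoeff f = mFourierCoeff g) : f = g := by
  apply mFourierBasis.repr.injective
  ext k
  rw [mFourierBasis_repr, mFourierBasis_repr, h]

theorem sqNorm_zero_mFourierCoeff (f : L2) : sqNorm 0 (mFourierCoeff f) = ‖f‖ₑ ^ 2 := by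
  have h := lp.norm_rpow_eq_tsum (p := 2) (by norm_num) (mFourierBasis.repr f)
  simp only [ENNReal.toReal_ofNat, Real.rpow_ofNat, LinearIsometryEquiv.norm_map,
    mFourierBasis_repr] at h
  have hs : Summable fun k => ‖mFourierCoeff f k‖ ^ 2 := by
    simpa using (memℓp_gen_iff (by norm_num)).mp (memℓp_mFourierCoeff f)
  rw [sqNorm_zero_eq, ← ofReal_norm f, ← ENNReal.ofReal_pow (norm_nonneg _), h,
    ENNReal.ofReal_tsum_of_nonneg (fun _ => by positivity) hs]
  simp only [ENNReal.ofReal_pow (norm_nonneg _), ofReal_norm]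

theorem mFourierCoeff_congr {f g : Torus → ℂ} (h : f =ᵐ[volume] g) :
    mFourierCoeff f = mFourierCoeff g := by
  ext k
  refine integral_congr_ae ?_
  filter_upwards [h] with x hx
  rw [hx]

theorem mFourierCoeff_toLp {f : Torus → ℂ} (hf : MemLp f 2 volume) :
    mFourierCoeff (hf.toLp f) = mFourierCoeff f :=
  mFourierCoeff_congr hf.coeFn_toLp

theorem sqNorm_mFourierCoeff_lt_top_of_memLp {f : Torus → ℂ} (hf : MemLp f 2 volume) :
    sqNorm 0 (mFourierCoeff f) < ∞ :=
  mFourierCoeff_toLp hf ▸ sqNorm_mFourierCoeff_lt_top _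

theorem sqNorm_zero_mFourierCoeff_of_memLp {f : Torus → ℂ} (hf : MemLp f 2 volume) :
    sqNorm 0 (mFourierCoeff f) = eLpNorm f 2 volume ^ 2 := by
  rw [← mFourierCoeff_toLp hf, sqNorm_zero_mFourierCoeff, Lp.enorm_toLp]

theorem mFourierCoeff_L2_sub (f g : L2) :
    mFourierCoeff (f - g : L2) = mFourierCoeff f - mFourierCoeff g := by
  ext k
  rw [← mFourierBasis_repr, map_sub, lp.coeFn_sub, Pi.sub_apply, mFourierBasis_repr,
    mFourierBasis_repr, Pi.sub_apply]

theorem mFourierCoeff_L2_add (f g : L2) :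
    mFourierCoeff (f + g : L2) = mFourierCoeff f + mFourierCoeff g := by
  ext k
  rw [← mFourierBasis_repr, map_add, lp.coeFn_add, Pi.add_apply, mFourierBasis_repr,
    mFourierBasis_repr, Pi.add_apply]

theorem mFourierCoeff_L2_zero : mFourierCoeff (0 : L2) = 0 := by
  ext k
  rw [← mFourierBasis_repr, map_zero, lp.coeFn_zero]

theorem integrable_mFourier_mul {f : Torus → ℂ} (hf : Integrable f) (k : Freq) :
    Integrable fun x => mFourier k x * f x := by
  refine hf.bdd_mul (c := 1) (mFourier k).continuous.aestronglyMeasurable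
    (Eventually.of_forall fun x => ?_)
  exact ((mFourier k).norm_coe_le_norm x).trans mFourier_norm.le

theorem mFourierCoeff_add {f g : Torus → ℂ} (hf : Integrable f) (hg : Integrable g) :
    mFourierCoeff (fun x => f x + g x) = mFourierCoeff f + mFourierCoeff g := by
  ext k
  simp only [mFourierCoeff, smul_eq_mul, mul_add, Pi.add_apply]
  exact integral_add (integrable_mFourier_mul hf _) (integrable_mFourier_mul hg _)

theorem mFourierCoeff_const_mul (c : ℂ) (f : Torus → ℂ) :
    mFourierCoeff (fun x => c * f x) = c • mFourierCoeff f := by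
  ext k
  simp only [mFourierCoeff, smul_eq_mul, Pi.smul_apply, mul_left_comm _ c]
  exact integral_const_mul _ _

theorem mFourierCoeff_conj (f : Torus → ℂ) (k : Freq) :
    mFourierCoeff (fun x => conj (f x)) k = conj (mFourierCoeff f (-k)) := by
  rw [mFourierCoeff, mFourierCoeff, ← integral_conj]
  simp only [smul_eq_mul, map_mul, neg_neg, mFourier_neg]

theorem mFourierCoeff_mFourier_mul (f : Torus → ℂ) (k l : Freq) :
    mFourierCoeff (fun x => mFourier k x * f x) l = mFourierCoeff f (l - k) := by
  simp only [mFourierCoeff, smul_eq_mul, ← mul_assoc, ← mFourier_add, neg_sub']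
  simp only [sub_eq_add_neg, neg_neg]

/-- The Fourier coefficients of a product of square integrable functions are the convolution. -/
theorem hasSum_mFourierCoeff_mul {f g : Torus → ℂ} (hf : MemLp f 2 volume)
    (hg : MemLp g 2 volume) (k : Freq) :
    HasSum (fun l => mFourierCoeff f (k - l) * mFourierCoeff g l)
      (mFourierCoeff (fun x => f x * g x) k) := by
  -- Parseval for the pair `e_k · conj f` and `g`: the integral is the `k`-th coefficient of `f g`,
  -- and the series is the convolution at `k`.
  have hF : MemLp (fun x => mFourier k x * conj (f x)) 2 volume := by
    refine MemLp.mul' (p := ∞) (q := 2) hf.star ?_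
    exact MemLp.of_bound (mFourier k).continuous.aestronglyMeasurable 1
      (Eventually.of_forall fun x => ((mFourier k).norm_coe_le_norm x).trans mFourier_norm.le)
  have h := hasSum_prod_mFourierCoeff (hF.toLp _) (hg.toLp g)
  rw [mFourierCoeff_toLp, mFourierCoeff_toLp] at h
  convert! h using 1
  · ext l
    rw [mFourierCoeff_mFourier_mul, mFourierCoeff_conj, Complex.conj_conj, neg_sub]
  · refine integral_congr_ae ?_
    filter_upwards [hF.coeFn_toLp, hg.coeFn_toLp] with x h1 h2
    rw [h1, h2, map_mul, Complex.conj_conj, mFourier_neg, smul_eq_mul, mul_assoc]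

theorem mFourierCoeff_mul {f g : Torus → ℂ} (hf : MemLp f 2 volume) (hg : MemLp g 2 volume) :
    mFourierCoeff (fun x => f x * g x) = conv (mFourierCoeff f) (mFourierCoeff g) :=
  funext fun k => (hasSum_mFourierCoeff_mul hf hg k).tsum_eq.symm

/-- Square summable families are coefficients of `L²` functions, so Parseval supplies the
summability. -/
theorem summable_conv {a b : Freq → ℂ} (ha : sqNorm 0 a < ∞) (hb : sqNorm 0 b < ∞) (k : Freq) :
    Summable fun l => a (k - l) * b l := by
  have := (hasSum_mFourierCoeff_mul (Lp.memLp (fourierInv a)) (Lp.memLp (fourierInv b)) k).summable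
  rwa [mFourierCoeff_fourierInv ha, mFourierCoeff_fourierInv hb] at this

theorem conv_sub_left {a a' b : Freq → ℂ} (ha : sqNorm 0 a < ∞) (ha' : sqNorm 0 a' < ∞)
    (hb : sqNorm 0 b < ∞) : conv (a - a') b = conv a b - conv a' b := by
  ext k
  simp only [conv, Pi.sub_apply, sub_mul]
  exact (summable_conv ha hb k).tsum_sub (summable_conv ha' hb k)

theorem conv_sub_right {a b b' : Freq → ℂ} (ha : sqNorm 0 a < ∞) (hb : sqNorm 0 b < ∞)
    (hb' : sqNorm 0 b' < ∞) : conv a (b - b') = conv a b - conv a b' := by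
  ext k
  simp only [conv, Pi.sub_apply, mul_sub]
  exact (summable_conv ha hb k).tsum_sub (summable_conv ha hb' k)

/-- Functions in `H²` are bounded. -/
theorem memLp_top_of_sqNorm_two_lt_top {f : L2} (hf : sqNorm 2 (mFourierCoeff f) < ∞) :
    MemLp f ∞ volume := by
  have hw : wienerNorm (mFourierCoeff f) ≠ ∞ := by
    have := (wienerNorm_sq_le (mFourierCoeff f)).trans_lt
      (ENNReal.mul_lt_top tsum_wt_neg_two_lt_top hf)
    simpa [lt_top_iff_ne_top] using this
  -- A finite Wiener norm makes the Fourier series converge uniformly; its continuous sum agrees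
  -- with `f` almost everywhere because both are its `L²` limit.
  have hs : Summable fun k => mFourierCoeff f k • (mFourier k : C(Torus, ℂ)) := by
    refine Summable.of_norm ?_
    simp only [norm_smul, mFourier_norm, mul_one]
    simpa using ENNReal.summable_toReal hw
  obtain ⟨F, hF⟩ := hs
  have h1 := (ContinuousMap.toLp (E := ℂ) 2 (volume : Measure Torus) ℂ).hasSum hF
  simp only [map_smul] at h1
  have h2 : ContinuousMap.toLp (E := ℂ) 2 (volume : Measure Torus) ℂ F = f :=
    h1.unique (hasSum_mFourier_series_L2 f)
  have h3 : F =ᵐ[volume] f := by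
    rw [← h2]
    exact (ContinuousMap.coeFn_toLp volume F).symm
  exact (memLp_congr_ae h3).mp (MemLp.of_bound F.continuous.aestronglyMeasurable ‖F‖
    (Eventually.of_forall F.norm_coe_le_norm))

/-! ### Real-valued functions -/

/-- The symmetry of the Fourier coefficients of real-valued functions. -/
def IsHermitianSeq (a : Freq → ℂ) : Prop := ∀ k, a (-k) = conj (a k)

theorem isHermitianSeq_of_real {f : Torus → ℂ} (hf : ∀ᵐ x, (f x).im = 0) :
    IsHermitianSeq (mFourierCoeff f) := fun k => by
  have : (fun x => conj (f x)) =ᵐ[volume] f := by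
    filter_upwards [hf] with x hx
    exact Complex.conj_eq_iff_im.mpr hx
  rw [← congrFun (mFourierCoeff_congr this) (-k), mFourierCoeff_conj, neg_neg]

/-- Conjugating `f` conjugates and reflects its coefficients, and coefficients determine `f`.
Real-valuedness thus becomes a condition stable under convolution, differentiation and real even
multipliers. -/
theorem isRealValued_iff {f : L2} : IsRealValued f ↔ IsHermitianSeq (mFourierCoeff f) := by
  refine ⟨isHermitianSeq_of_real, fun h => ?_⟩
  have hg : MemLp (fun x => conj (f x)) 2 volume := (Lp.memLp f).star
  have : hg.toLp _ = f := by
    apply L2_ext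
    rw [mFourierCoeff_toLp]
    ext k
    rw [mFourierCoeff_conj, h, Complex.conj_conj]
  have h2 := hg.coeFn_toLp
  rw [this] at h2
  filter_upwards [h2] with x hx
  exact Complex.conj_eq_iff_im.mp hx.symm

/-! ### Measurability -/

theorem continuous_mFourierCoeff (k : Freq) : Continuous fun f : L2 => mFourierCoeff f k := by
  simp_rw [← mFourierBasis_repr, HilbertBasis.repr_apply_apply]
  fun_prop

/-- An `L²`-valued function with measurable Fourier coefficients is strongly measurable. -/
theorem aestronglyMeasurable_of_mFourierCoeff {μ : Measure ℝ} {G : ℝ → L2}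
    (h : ∀ k, AEStronglyMeasurable (fun s => mFourierCoeff (G s) k) μ) :
    AEStronglyMeasurable G μ := by
  refine aestronglyMeasurable_of_tendsto_ae (atTop : Filter (Finset Freq))
    (f := fun S s => ∑ k ∈ S, mFourierCoeff (G s) k • mFourierLp 2 k) (fun S => ?_)
    (Eventually.of_forall fun s => hasSum_mFourier_series_L2 (G s))
  refine Finset.aestronglyMeasurable_fun_sum S fun k _ => (h k).smul_const _

theorem aestronglyMeasurable_mFourierCoeff {μ : Measure ℝ} {G : ℝ → L2}
    (h : AEStronglyMeasurable G μ) (k : Freq) :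
    AEStronglyMeasurable (fun s => mFourierCoeff (G s) k) μ :=
  (continuous_mFourierCoeff k).comp_aestronglyMeasurable h

theorem mFourierCoeff_integral {μ : Measure ℝ} {G : ℝ → L2} (hG : Integrable G μ) (k : Freq) :
    mFourierCoeff (∫ s, G s ∂μ : L2) k = ∫ s, mFourierCoeff (G s) k ∂μ := by
  simp_rw [← mFourierBasis_repr, HilbertBasis.repr_apply_apply]
  exact ((innerSL ℂ (mFourierBasis k)).integral_comp_comm hG).symm

theorem enorm_le_sobolevNorm {s : ℝ} (hs : 0 ≤ s) (f : L2) : ‖f‖ₑ ≤ sobolevNorm s f := by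
  rw [← ENNReal.pow_le_pow_left_iff two_ne_zero, sobolevNorm_sq, ← sqNorm_zero_mFourierCoeff]
  exact sqNorm_mono hs _

theorem H2Integrable.integrable {t : ℝ} {G : ℝ → L2} (h : H2Integrable t G) :
    Integrable G (volume.restrict (Set.Ioc 0 t)) :=
  ⟨h.1, (lintegral_mono fun s => enorm_le_sobolevNorm (by norm_num) (G s)).trans_lt h.2⟩

/-! ### The cubic nonlinearity -/

/-- The Fourier coefficients of `a u³ + b u² + c u` in terms of those of `u`. -/
def cubicSeq (a b c : ℝ) (α : Freq → ℂ) : Freq → ℂ :=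
  (a : ℂ) • conv α (conv α α) + (b : ℂ) • conv α α + (c : ℂ) • α

theorem sqNorm_lt_top_of_le {s t : ℝ} (h : s ≤ t) {a : Freq → ℂ} (ha : sqNorm t a < ∞) :
    sqNorm s a < ∞ :=
  (sqNorm_mono h a).trans_lt ha

theorem sqNorm_two_conv_lt_top {a b : Freq → ℂ} (ha : sqNorm 2 a < ∞) (hb : sqNorm 2 b < ∞) :
    sqNorm 2 (conv a b) < ∞ := by
  refine (sqNorm_two_conv_le a b).trans_lt ?_
  have := prodConst_ne_top 2
  finiteness

theorem sqNorm_combination_le (s : ℝ) (a b c : ℂ) (x y z : Freq → ℂ) :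
    sqNorm s (a • x + b • y + c • z) ≤
      2 * (2 * (‖a‖ₑ ^ 2 * sqNorm s x + ‖b‖ₑ ^ 2 * sqNorm s y) + ‖c‖ₑ ^ 2 * sqNorm s z) := by
  refine (sqNorm_add_le _ _ _).trans ?_
  gcongr
  · refine (sqNorm_add_le _ _ _).trans_eq ?_
    rw [sqNorm_smul, sqNorm_smul]
  · exact (sqNorm_smul _ _ _).le

theorem exists_cubicSeq_lipschitz (a b c : ℝ) {M : ℝ≥0∞} (hM : M ≠ ∞) :
    ∃ L : ℝ≥0∞, L ≠ ∞ ∧ ∀ α β : Freq → ℂ, sqNorm 2 α ≤ M → sqNorm 2 β ≤ M →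
      sqNorm 2 (cubicSeq a b c α - cubicSeq a b c β) ≤ L * sqNorm 2 (α - β) := by
  set P : ℝ≥0∞ := 2 * prodConst 2
  have hP : P ≠ ∞ := ENNReal.mul_ne_top (by norm_num) (prodConst_ne_top 2)
  -- The numbers come from the factor 2 per squared triangle inequality: `10 = 2(2(1+1)+1)` for the
  -- three cubic terms, `4 = 2(1+1)` for the two quadratic ones.
  refine ⟨2 * (2 * (‖(a : ℂ)‖ₑ ^ 2 * (10 * (P ^ 2 * M ^ 2)) + ‖(b : ℂ)‖ₑ ^ 2 * (4 * (P * M))) +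
    ‖(c : ℂ)‖ₑ ^ 2), by finiteness, fun α β hα hβ => ?_⟩
  have fα : sqNorm 2 α < ∞ := hα.trans_lt hM.lt_top
  have fβ : sqNorm 2 β < ∞ := hβ.trans_lt hM.lt_top
  have low : ∀ {x : Freq → ℂ}, sqNorm 2 x < ∞ → sqNorm 0 x < ∞ := fun h =>
    sqNorm_lt_top_of_le (by norm_num) h
  set δ := α - β with hδ
  have fδ : sqNorm 2 δ < ∞ :=
    (sqNorm_sub_le 2 α β).trans_lt (by finiteness)
  have quad : conv α α - conv β β = conv δ α + conv β δ := by
    rw [hδ, conv_sub_left (low fα) (low fβ) (low fα), conv_sub_right (low fβ) (low fα) (low fβ)]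
    abel
  have fαα := sqNorm_two_conv_lt_top fα fα
  have fβα := sqNorm_two_conv_lt_top fβ fα
  have fββ := sqNorm_two_conv_lt_top fβ fβ
  -- Telescoping, one factor at a time. Distributing a convolution over a difference needs
  -- convergent series, hence the finiteness facts above.
  have cube : conv α (conv α α) - conv β (conv β β) =
      conv δ (conv α α) + conv β (conv δ α) + conv β (conv β δ) := by
    have h1 : conv δ (conv α α) = conv α (conv α α) - conv β (conv α α) :=
      conv_sub_left (low fα) (low fβ) (low fαα)
    have h2 : conv β (conv δ α) = conv β (conv α α) - conv β (conv β α) := by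
      rw [hδ, conv_sub_left (low fα) (low fβ) (low fα),
        conv_sub_right (low fβ) (low fαα) (low fβα)]
    have h3 : conv β (conv β δ) = conv β (conv β α) - conv β (conv β β) := by
      rw [hδ, conv_sub_right (low fβ) (low fα) (low fβ),
        conv_sub_right (low fβ) (low fβα) (low fββ)]
    rw [h1, h2, h3]
    abel
  have bd : ∀ x y : Freq → ℂ, sqNorm 2 (conv x y) ≤ P * (sqNorm 2 x * sqNorm 2 y) :=
    sqNorm_two_conv_le
  have e1 : sqNorm 2 (conv δ (conv α α)) ≤ P ^ 2 * M ^ 2 * sqNorm 2 δ := by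
    calc sqNorm 2 (conv δ (conv α α)) ≤ P * (sqNorm 2 δ * (P * (M * M))) := by
          refine (bd _ _).trans ?_
          gcongr
          refine (bd _ _).trans ?_
          gcongr
      _ = _ := by ring
  have e2 : sqNorm 2 (conv β (conv δ α)) ≤ P ^ 2 * M ^ 2 * sqNorm 2 δ := by
    calc sqNorm 2 (conv β (conv δ α)) ≤ P * (M * (P * (sqNorm 2 δ * M))) := by
          refine (bd _ _).trans ?_
          gcongr
          refine (bd _ _).trans ?_
          gcongr
      _ = _ := by ring
  have e3 : sqNorm 2 (conv β (conv β δ)) ≤ P ^ 2 * M ^ 2 * sqNorm 2 δ := by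
    calc sqNorm 2 (conv β (conv β δ)) ≤ P * (M * (P * (M * sqNorm 2 δ))) := by
          refine (bd _ _).trans ?_
          gcongr
          refine (bd _ _).trans ?_
          gcongr
      _ = _ := by ring
  have hcube : sqNorm 2 (conv α (conv α α) - conv β (conv β β)) ≤
      10 * (P ^ 2 * M ^ 2) * sqNorm 2 δ := by
    rw [cube]
    calc _ ≤ 2 * (2 * (P ^ 2 * M ^ 2 * sqNorm 2 δ + P ^ 2 * M ^ 2 * sqNorm 2 δ) +
            P ^ 2 * M ^ 2 * sqNorm 2 δ) := by
          refine (sqNorm_add_le _ _ _).trans ?_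
          gcongr
          refine (sqNorm_add_le _ _ _).trans ?_
          gcongr
      _ = _ := by ring
  have hquad : sqNorm 2 (conv α α - conv β β) ≤ 4 * (P * M) * sqNorm 2 δ := by
    rw [quad]
    calc _ ≤ 2 * (P * (sqNorm 2 δ * M) + P * (M * sqNorm 2 δ)) := by
          refine (sqNorm_add_le _ _ _).trans ?_
          gcongr
          · refine (bd _ _).trans ?_
            gcongr
          · refine (bd _ _).trans ?_
            gcongr
      _ = _ := by ring
  have split : cubicSeq a b c α - cubicSeq a b c β =
      (a : ℂ) • (conv α (conv α α) - conv β (conv β β)) + (b : ℂ) • (conv α α - conv β β) +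
        (c : ℂ) • δ := by
    simp only [cubicSeq, hδ, smul_sub]
    abel
  rw [split]
  refine (sqNorm_combination_le _ _ _ _ _ _ _).trans ?_
  calc _ ≤ 2 * (2 * (‖(a : ℂ)‖ₑ ^ 2 * (10 * (P ^ 2 * M ^ 2) * sqNorm 2 δ) +
        ‖(b : ℂ)‖ₑ ^ 2 * (4 * (P * M) * sqNorm 2 δ)) + ‖(c : ℂ)‖ₑ ^ 2 * sqNorm 2 δ) := by
        gcongr
    _ = _ := by ring

/-- The tame estimate, iterated: in each monomial one factor carries the `H³` norm and the others
are absorbed into `M`. -/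
theorem exists_cubicSeq_tame (a b c : ℝ) {M : ℝ≥0∞} (hM : M ≠ ∞) :
    ∃ C : ℝ≥0∞, C ≠ ∞ ∧ ∀ α : Freq → ℂ, sqNorm 2 α ≤ M →
      sqNorm 3 (cubicSeq a b c α) ≤ C * sqNorm 3 α := by
  set P : ℝ≥0∞ := prodConst 2
  have hP : P ≠ ∞ := prodConst_ne_top 2
  set Q : ℝ≥0∞ := prodConst 3
  have hQ : Q ≠ ∞ := prodConst_ne_top 3
  refine ⟨2 * (2 * (‖(a : ℂ)‖ₑ ^ 2 * (Q * (M * (2 * (Q * M)) + 2 * P * (M * M))) +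
    ‖(b : ℂ)‖ₑ ^ 2 * (2 * (Q * M))) + ‖(c : ℂ)‖ₑ ^ 2), by finiteness, fun α hα => ?_⟩
  have h2 : sqNorm 3 (conv α α) ≤ 2 * (Q * M) * sqNorm 3 α := by
    calc _ ≤ Q * (M * sqNorm 3 α + sqNorm 3 α * M) := by
          refine (sqNorm_conv_le_tame (by norm_num) _ _).trans ?_
          gcongr
      _ = _ := by ring
  have h3 : sqNorm 3 (conv α (conv α α)) ≤
      Q * (M * (2 * (Q * M)) + 2 * P * (M * M)) * sqNorm 3 α := by
    calc _ ≤ Q * (M * (2 * (Q * M) * sqNorm 3 α) + sqNorm 3 α * (2 * P * (M * M))) := by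
          refine (sqNorm_conv_le_tame (by norm_num) _ _).trans ?_
          gcongr
          refine (sqNorm_two_conv_le _ _).trans ?_
          gcongr
      _ = _ := by ring
  refine (sqNorm_combination_le _ _ _ _ _ _ _).trans ?_
  calc _ ≤ 2 * (2 * (‖(a : ℂ)‖ₑ ^ 2 * (Q * (M * (2 * (Q * M)) + 2 * P * (M * M)) * sqNorm 3 α) +
        ‖(b : ℂ)‖ₑ ^ 2 * (2 * (Q * M) * sqNorm 3 α)) + ‖(c : ℂ)‖ₑ ^ 2 * sqNorm 3 α) := by
        gcongr
    _ = _ := by ring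

theorem cubicSeq_zero (a b c : ℝ) : cubicSeq a b c 0 = 0 := by
  ext k
  simp [cubicSeq, conv]

/-- The Lipschitz bound against `β = 0`. -/
theorem exists_cubicSeq_bound (a b c : ℝ) {M : ℝ≥0∞} (hM : M ≠ ∞) :
    ∃ B : ℝ≥0∞, B ≠ ∞ ∧ ∀ α : Freq → ℂ, sqNorm 2 α ≤ M → sqNorm 2 (cubicSeq a b c α) ≤ B := by
  obtain ⟨L, hL, h⟩ := exists_cubicSeq_lipschitz a b c hM
  refine ⟨L * M, ENNReal.mul_ne_top hL hM, fun α hα => ?_⟩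
  have := h α 0 hα (by simp [sqNorm_zero])
  rw [cubicSeq_zero, sub_zero, sub_zero] at this
  exact this.trans (by gcongr)

/-- An `H²` function is bounded, so `u²` and `u³` are in `L²` and each product is a convolution on
the Fourier side. -/
theorem mFourierCoeff_cubic (a b c : ℝ) {u : L2} (hu : sqNorm 2 (mFourierCoeff u) < ∞) :
    mFourierCoeff (fun x => (a : ℂ) * u x ^ 3 + (b : ℂ) * u x ^ 2 + (c : ℂ) * u x) =
      cubicSeq a b c (mFourierCoeff u) := by
  have h1 : MemLp u 2 volume := Lp.memLp u
  have hb := memLp_top_of_sqNorm_two_lt_top hu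
  have h2 : MemLp (fun x => u x * u x) 2 volume := h1.mul' hb
  have h3 : MemLp (fun x => u x * (u x * u x)) 2 volume := h2.mul' hb
  have i1 := h1.integrable (by norm_num)
  have i2 := h2.integrable (by norm_num)
  have i3 := h3.integrable (by norm_num)
  have e : (fun x => (a : ℂ) * u x ^ 3 + (b : ℂ) * u x ^ 2 + (c : ℂ) * u x) =
      fun x => ((a : ℂ) * (u x * (u x * u x)) + (b : ℂ) * (u x * u x)) + (c : ℂ) * u x := by
    ext x; ring
  have i32 : Integrable fun x => (a : ℂ) * (u x * (u x * u x)) + (b : ℂ) * (u x * u x) :=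
    (i3.const_mul _).add (i2.const_mul _)
  rw [e, mFourierCoeff_add i32 (i1.const_mul _),
    mFourierCoeff_add (i3.const_mul _) (i2.const_mul _), mFourierCoeff_const_mul,
    mFourierCoeff_const_mul, mFourierCoeff_const_mul, mFourierCoeff_mul h1 h2,
    mFourierCoeff_mul h1 h1]
  rfl

/-- The Fourier coefficients of `Δ (a u³ + b u² + c u)`. -/
def chemSeq (a b c : ℝ) (α : Freq → ℂ) (k : Freq) : ℂ := -(freqSq k) * cubicSeq a b c α k

theorem enorm_freqSq_sq_le (k : Freq) : ‖(freqSq k : ℂ)‖ₑ ^ 2 ≤ wt 2 k := by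
  rw [← ofReal_norm, Complex.norm_real, Real.norm_of_nonneg (freqSq_nonneg k),
    ← ENNReal.ofReal_pow (freqSq_nonneg k), wt, Real.rpow_ofNat]
  have := freqSq_nonneg k
  exact ENNReal.ofReal_le_ofReal (by gcongr; linarith)

theorem sqNorm_laplacian_le (s : ℝ) (γ : Freq → ℂ) :
    sqNorm s (fun k => -(freqSq k : ℂ) * γ k) ≤ sqNorm (s + 2) γ := by
  refine ENNReal.tsum_le_tsum fun k => ?_
  rw [enorm_mul, enorm_neg, mul_pow, wt_add, mul_assoc]
  gcongr
  exact enorm_freqSq_sq_le k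

theorem sqNorm_chemSeq_le (s : ℝ) (a b c : ℝ) (α : Freq → ℂ) :
    sqNorm s (chemSeq a b c α) ≤ sqNorm (s + 2) (cubicSeq a b c α) :=
  sqNorm_laplacian_le s _

theorem sqNorm_chemSeq_sub_le (a b c : ℝ) (α β : Freq → ℂ) :
    sqNorm 0 (chemSeq a b c α - chemSeq a b c β) ≤
      sqNorm 2 (cubicSeq a b c α - cubicSeq a b c β) := by
  have : chemSeq a b c α - chemSeq a b c β =
      fun k => -(freqSq k : ℂ) * (cubicSeq a b c α - cubicSeq a b c β) k := by
    ext k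
    simp only [chemSeq, Pi.sub_apply]
    ring
  rw [this]
  simpa using sqNorm_laplacian_le 0 (cubicSeq a b c α - cubicSeq a b c β)

/-- The algebra property puts the cubic expression in `H²`, so its Laplacian is a genuine `L²`
function and not the default value. -/
theorem mFourierCoeff_laplacian_cubic (a b c : ℝ) {u : L2}
    (hu : sqNorm 2 (mFourierCoeff u) < ∞) :
    mFourierCoeff
        (laplacian fun x => (a : ℂ) * u x ^ 3 + (b : ℂ) * u x ^ 2 + (c : ℂ) * u x) =
      chemSeq a b c (mFourierCoeff u) := by
  rw [laplacian, mFourierCoeff_cubic a b c hu]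
  refine mFourierCoeff_fourierInv (a := chemSeq a b c (mFourierCoeff u)) ?_
  obtain ⟨B, hB, h⟩ := exists_cubicSeq_bound a b c hu.ne
  refine (sqNorm_chemSeq_le 0 a b c _).trans_lt ?_
  rw [zero_add]
  exact (h _ le_rfl).trans_lt hB.lt_top

/-! ### Derivatives -/

/-- The Fourier coefficients of `∂ⱼ u` in terms of those of `u`. -/
def derivSeq (j : Fin 2) (α : Freq → ℂ) (k : Freq) : ℂ :=
  (2 * Real.pi * Complex.I * (k j : ℂ)) * α k

theorem derivSeq_sub (j : Fin 2) (α β : Freq → ℂ) :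
    derivSeq j (α - β) = derivSeq j α - derivSeq j β := by
  ext k
  simp [derivSeq, mul_sub]

theorem enorm_deriv_factor_sq (j : Fin 2) (k : Freq) :
    ‖(2 * Real.pi * Complex.I * (k j : ℂ))‖ₑ ^ 2 =
      ENNReal.ofReal ((2 * Real.pi * (k j : ℝ)) ^ 2) := by
  rw [← ofReal_norm, ← ENNReal.ofReal_pow (norm_nonneg _)]
  congr 1
  simp [mul_pow]

theorem wt_one_eq (k : Freq) :
    wt 1 k = 1 + ∑ j, ‖(2 * Real.pi * Complex.I * (k j : ℂ))‖ₑ ^ 2 := by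
  simp only [enorm_deriv_factor_sq]
  rw [wt, Real.rpow_one, ENNReal.ofReal_add zero_le_one (freqSq_nonneg k), ENNReal.ofReal_one,
    freqSq, ENNReal.ofReal_sum_of_nonneg fun _ _ => sq_nonneg _]

/-- An exact identity, as the weight is `1 + ∑ⱼ |2πi kⱼ|²`. It reduces `H¹` bounds for products with
Lipschitz functions to `L²` bounds. -/
theorem sqNorm_one_eq (α : Freq → ℂ) :
    sqNorm 1 α = sqNorm 0 α + ∑ j, sqNorm 0 (derivSeq j α) := by
  simp only [sqNorm, wt_zero, wt_one_eq, one_mul, derivSeq, enorm_mul, mul_pow, Fin.sum_univ_two,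
    ← ENNReal.tsum_add]
  refine tsum_congr fun k => ?_
  ring

theorem sqNorm_derivSeq_le (s : ℝ) (j : Fin 2) (α : Freq → ℂ) :
    sqNorm s (derivSeq j α) ≤ sqNorm (s + 1) α := by
  refine ENNReal.tsum_le_tsum fun k => ?_
  have hk : ‖(2 * Real.pi * Complex.I * (k j : ℂ))‖ₑ ^ 2 ≤ wt 1 k := by
    rw [wt_one_eq]
    exact (Finset.single_le_sum
      (f := fun j => ‖(2 * Real.pi * Complex.I * (k j : ℂ))‖ₑ ^ 2) (fun _ _ => zero_le)
      (Finset.mem_univ j)).trans le_add_self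
  calc wt s k * ‖derivSeq j α k‖ₑ ^ 2
      = wt s k * ‖(2 * Real.pi * Complex.I * (k j : ℂ))‖ₑ ^ 2 * ‖α k‖ₑ ^ 2 := by
        rw [derivSeq, enorm_mul, mul_pow]
        exact (mul_assoc _ _ _).symm
    _ ≤ _ := by
        rw [wt_add]
        gcongr

theorem mFourierCoeff_partialDeriv (j : Fin 2) {u : L2} (hu : sqNorm 2 (mFourierCoeff u) < ∞) :
    mFourierCoeff (partialDeriv j u) = derivSeq j (mFourierCoeff u) := by
  refine mFourierCoeff_fourierInv (a := derivSeq j (mFourierCoeff u)) ?_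
  exact (sqNorm_derivSeq_le 0 j _).trans_lt (sqNorm_lt_top_of_le (by norm_num) hu)

/-- The Leibniz rule, which on the Fourier side is `kⱼ = (k-l)ⱼ + lⱼ` under the sum. -/
theorem derivSeq_conv (j : Fin 2) {α β : Freq → ℂ} (hα : sqNorm 0 α < ∞)
    (hα' : sqNorm 0 (derivSeq j α) < ∞) (hβ : sqNorm 0 β < ∞)
    (hβ' : sqNorm 0 (derivSeq j β) < ∞) :
    derivSeq j (conv α β) = conv (derivSeq j α) β + conv α (derivSeq j β) := by
  ext k
  rw [Pi.add_apply, conv, conv,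
    ← (summable_conv hα' hβ k).tsum_add (summable_conv hα hβ' k), derivSeq, conv, ← tsum_mul_left]
  refine tsum_congr fun l => ?_
  simp only [derivSeq, Pi.sub_apply]
  push_cast
  ring

/-! ### Products with bounded functions -/

/-- Proved in physical space, by Hölder: the coefficients of a bounded function need not be
summable, so Young's inequality is unavailable. -/
theorem sqNorm_conv_bounded_le {q : Torus → ℂ} (hq : AEStronglyMeasurable q volume) {V : ℝ≥0∞}
    (hV : V ≠ ∞) (hqV : eLpNorm q ∞ volume ≤ V) {β : Freq → ℂ} (hβ : sqNorm 0 β < ∞) :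
    sqNorm 0 (conv (mFourierCoeff q) β) ≤ V ^ 2 * sqNorm 0 β := by
  have hq' : MemLp q ∞ volume := ⟨hq, hqV.trans_lt hV.lt_top⟩
  set g : L2 := fourierInv β
  have hg : MemLp g 2 volume := Lp.memLp g
  have e : β = mFourierCoeff g := (mFourierCoeff_fourierInv hβ).symm
  rw [e, ← mFourierCoeff_mul (hq'.mono_exponent le_top) hg,
    sqNorm_zero_mFourierCoeff_of_memLp (hg.mul' hq'), sqNorm_zero_mFourierCoeff, ← mul_pow]
  gcongr
  have := eLpNorm_smul_le_eLpNorm_top_mul_eLpNorm (p := 2) hg.1 q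
  refine this.trans ?_
  gcongr
  exact (Lp.enorm_def g).ge

/-! ### Weak derivatives -/

theorem mFourier_coe (n : Freq) (y : Fin 2 → ℝ) :
    mFourier n (fun j => (y j : UnitAddCircle)) =
      Complex.exp (2 * Real.pi * Complex.I * ∑ j, (n j : ℂ) * y j) := by
  simp only [mFourier, ContinuousMap.coe_mk, fourier_coe_apply, ← Complex.exp_sum]
  congr 1
  rw [Finset.mul_sum]
  refine Finset.sum_congr rfl fun j _ => ?_
  simp
  ring

theorem contDiff_mFourier (n : Freq) :
    ContDiff ℝ (⊤ : ℕ∞) fun y : Fin 2 → ℝ => mFourier n fun j => (y j : UnitAddCircle) := by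
  simp only [mFourier_coe]
  have : ContDiff ℝ (⊤ : ℕ∞) fun y : Fin 2 → ℝ =>
      2 * Real.pi * Complex.I * ∑ j, (n j : ℂ) * (y j : ℂ) := by
    refine contDiff_const.mul (ContDiff.sum fun j _ => contDiff_const.mul ?_)
    exact Complex.ofRealCLM.contDiff.comp (contDiff_apply ℝ ℝ j)
  exact this.cexp

theorem hasDerivAt_mFourier (n : Freq) (j : Fin 2) (x : Torus) :
    HasDerivAt (fun h : ℝ => mFourier n (x + Pi.single j (h : UnitAddCircle)))
      (2 * Real.pi * Complex.I * (n j : ℂ) * mFourier n x) 0 := by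
  have e : (fun h : ℝ => mFourier n (x + Pi.single j (h : UnitAddCircle))) =
      fun h : ℝ => mFourier n x * Complex.exp (2 * Real.pi * Complex.I * (n j : ℂ) * h) := by
    ext h
    have h1 : mFourier n (x + Pi.single j (h : UnitAddCircle)) =
        mFourier n x * mFourier n (Pi.single j (h : UnitAddCircle)) := by
      simp only [mFourier, ContinuousMap.coe_mk, ← Finset.prod_mul_distrib, Pi.add_apply]
      refine Finset.prod_congr rfl fun i _ => ?_
      simp [fourier_apply, smul_add, AddCircle.toCircle_add]
    have h2 : (Pi.single j (h : UnitAddCircle) : Torus) =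
        fun i => (((Pi.single j h : Fin 2 → ℝ) i : ℝ) : UnitAddCircle) := by
      ext i
      by_cases hi : i = j
      · subst hi; simp
      · simp [hi]
    rw [h1, h2, mFourier_coe]
    congr 2
    rw [Finset.sum_eq_single j (fun i _ hi => by simp [hi]) (by simp)]
    simp
    ring
  rw [e]
  have := ((Complex.ofRealCLM.hasDerivAt (x := 0)).const_mul
    (2 * Real.pi * Complex.I * (n j : ℂ))).cexp.const_mul (mFourier n x)
  simpa [mul_comm, mul_left_comm, mul_assoc] using this

/-- Test against the character `e_{-k}`. Test functions are real, so its real and imaginary parts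
are tested separately and recombined. -/
theorem mFourierCoeff_weakDeriv {j : Fin 2} {f g : Torus → ℝ} (h : IsWeakDeriv j f g) :
    mFourierCoeff (fun x => (g x : ℂ)) = derivSeq j (mFourierCoeff fun x => (f x : ℂ)) := by
  obtain ⟨hf, hg, hfg⟩ := h
  ext k
  have smooth_re : IsSmooth fun x => (mFourier (-k) x).re :=
    Complex.reCLM.contDiff.comp (contDiff_mFourier (-k))
  have smooth_im : IsSmooth fun x => (mFourier (-k) x).im :=
    Complex.imCLM.contDiff.comp (contDiff_mFourier (-k))
  set z : ℂ := 2 * Real.pi * Complex.I * ((-k) j : ℂ)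
  have deriv_re : ∀ x, classicalDeriv j (fun x => (mFourier (-k) x).re) x =
      (z * mFourier (-k) x).re := fun x =>
    (Complex.reCLM.hasFDerivAt.comp_hasDerivAt _ (hasDerivAt_mFourier (-k) j x)).deriv
  have deriv_im : ∀ x, classicalDeriv j (fun x => (mFourier (-k) x).im) x =
      (z * mFourier (-k) x).im := fun x =>
    (Complex.imCLM.hasFDerivAt.comp_hasDerivAt _ (hasDerivAt_mFourier (-k) j x)).deriv
  have hre := hfg _ smooth_re
  have him := hfg _ smooth_im
  simp only [deriv_re] at hre
  simp only [deriv_im] at him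
  have If : Integrable fun x => mFourier (-k) x * (f x : ℂ) :=
    integrable_mFourier_mul hf.ofReal _
  have Ig : Integrable fun x => mFourier (-k) x * (g x : ℂ) :=
    integrable_mFourier_mul hg.ofReal _
  have key : z * ∫ x, mFourier (-k) x * (f x : ℂ) = -∫ x, mFourier (-k) x * (g x : ℂ) := by
    rw [← integral_const_mul]
    apply Complex.ext
    · have h1 := integral_re (If.const_mul z)
      have h2 := integral_re Ig
      simp only [RCLike.re_eq_complex_re] at h1 h2
      rw [Complex.neg_re, ← h1, ← h2]
      convert! hre using 2
      · ext x
        rw [← mul_assoc, Complex.re_mul_ofReal, mul_comm]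
      · congr 1
        ext x
        rw [Complex.re_mul_ofReal, mul_comm]
    · have h1 := integral_im (If.const_mul z)
      have h2 := integral_im Ig
      simp only [RCLike.im_eq_complex_im] at h1 h2
      rw [Complex.neg_im, ← h1, ← h2]
      convert! him using 2
      · ext x
        rw [← mul_assoc, Complex.im_mul_ofReal, mul_comm]
      · congr 1
        ext x
        rw [Complex.im_mul_ofReal, mul_comm]
  have hz : 2 * Real.pi * Complex.I * (k j : ℂ) = -z := by
    simp only [z, Pi.neg_apply]
    push_cast
    ring
  rw [derivSeq, hz]
  simp only [mFourierCoeff, smul_eq_mul]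
  linear_combination key

/-! ### The biharmonic heat kernel on the Fourier side -/

/-- The symbol of `e^{-τεΔ²}`. -/
def heat (ε τ : ℝ) (k : Freq) : ℝ := Real.exp (-(τ * ε * freqSq k ^ 2))

/-- The symbol of `e^{-τεΔ²}` as an extended real. -/
def eheat (ε τ : ℝ) (k : Freq) : ℝ≥0∞ := ENNReal.ofReal (heat ε τ k)

theorem enorm_heat (ε τ : ℝ) (k : Freq) : ‖(heat ε τ k : ℂ)‖ₑ = eheat ε τ k := by
  rw [← ofReal_norm, Complex.norm_real, Real.norm_of_nonneg (show 0 ≤ heat ε τ k from (Real.exp_pos _).le),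
    eheat]

theorem continuous_heat (ε : ℝ) (k : Freq) : Continuous fun τ => heat ε τ k := by
  unfold heat
  fun_prop

theorem measurable_eheat (ε : ℝ) (k : Freq) : Measurable fun τ => eheat ε τ k :=
  (continuous_heat ε k).measurable.ennreal_ofReal

theorem eheat_le_one {ε τ : ℝ} (hε : 0 < ε) (hτ : 0 ≤ τ) (k : Freq) : eheat ε τ k ≤ 1 := by
  rw [eheat, ← ENNReal.ofReal_one]
  refine ENNReal.ofReal_le_ofReal (Real.exp_le_one_iff.mpr ?_)
  have : 0 ≤ τ * ε * freqSq k ^ 2 := by positivity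
  linarith

/-- The constant of the smoothing estimate for `e^{-τεΔ²}` with a gain of `2σ` derivatives. -/
def smoothConst (ε σ : ℝ) : ℝ≥0∞ := ENNReal.ofReal ((2 + 2 / ε) ^ (σ / 2))

/-- With `x = τεm²` and `τ ≤ 1`, `(1+m)²τ ≤ 2 + 2x/ε ≤ (2+2/ε)(1+x) ≤ (2+2/ε)eˣ`. Raise this to the
power `σ/2 ≤ 1`, which leaves at most one factor `eˣ` for the symbol to cancel. -/
theorem weight_rpow_mul_heat_le {ε τ σ : ℝ} (hε : 0 < ε) (hτ : 0 < τ) (hτ1 : τ ≤ 1) (hσ : 0 ≤ σ)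
    (hσ2 : σ ≤ 2) (k : Freq) :
    (1 + freqSq k) ^ σ * heat ε τ k ≤ (2 + 2 / ε) ^ (σ / 2) * τ ^ (-(σ / 2)) := by
  have hm := freqSq_nonneg k
  set m := freqSq k
  have hw : 0 < 1 + m := weight_pos k
  set x := τ * ε * m ^ 2 with hx
  have hx0 : 0 ≤ x := by positivity
  have h1 : (1 + m) ^ 2 ≤ (2 + 2 / ε) * τ⁻¹ * Real.exp x := by
    have h2 : (1 + m) ^ 2 * τ ≤ (2 + 2 / ε) * (x + 1) := by
      have h3 : (2 + 2 / ε) * (x + 1) = 2 + 2 / ε + 2 * x + 2 * (τ * m ^ 2) := by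
        rw [hx]; field_simp; ring
      rw [h3]
      have : 0 ≤ 2 / ε := by positivity
      nlinarith [mul_nonneg hτ.le (sq_nonneg (1 - m))]
    have h4 : (1 + m) ^ 2 * τ ≤ (2 + 2 / ε) * Real.exp x :=
      h2.trans (by gcongr; exact Real.add_one_le_exp x)
    calc (1 + m) ^ 2 = (1 + m) ^ 2 * τ * τ⁻¹ := by field_simp
      _ ≤ (2 + 2 / ε) * Real.exp x * τ⁻¹ := by gcongr
      _ = _ := by ring
  have h5 : (1 + m) ^ σ ≤ (2 + 2 / ε) ^ (σ / 2) * τ ^ (-(σ / 2)) * Real.exp x := by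
    calc (1 + m) ^ σ = ((1 + m) ^ 2) ^ (σ / 2) := by
          rw [← Real.rpow_natCast, ← Real.rpow_mul hw.le]; congr 1; push_cast; ring
      _ ≤ ((2 + 2 / ε) * τ⁻¹ * Real.exp x) ^ (σ / 2) :=
          Real.rpow_le_rpow (by positivity) h1 (by positivity)
      _ = (2 + 2 / ε) ^ (σ / 2) * τ ^ (-(σ / 2)) * Real.exp (x * (σ / 2)) := by
          rw [Real.mul_rpow (by positivity) (Real.exp_pos _).le,
            Real.mul_rpow (by positivity) (by positivity), Real.inv_rpow hτ.le,
            Real.rpow_neg hτ.le, ← Real.exp_mul]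
      _ ≤ _ := by
          gcongr
          nlinarith
  calc (1 + m) ^ σ * Real.exp (-x)
      ≤ (2 + 2 / ε) ^ (σ / 2) * τ ^ (-(σ / 2)) * Real.exp x * Real.exp (-x) := by gcongr
    _ = _ := by rw [mul_assoc, ← Real.exp_add, add_neg_cancel, Real.exp_zero, mul_one]

theorem wt_mul_eheat_le {ε τ σ : ℝ} (hε : 0 < ε) (hτ : 0 < τ) (hτ1 : τ ≤ 1) (hσ : 0 ≤ σ)
    (hσ2 : σ ≤ 2) (k : Freq) :
    wt σ k * eheat ε τ k ≤ smoothConst ε σ * ENNReal.ofReal (τ ^ (-(σ / 2))) := by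
  rw [wt, eheat, smoothConst, ← ENNReal.ofReal_mul (Real.rpow_nonneg (weight_pos k).le _),
    ← ENNReal.ofReal_mul (by positivity)]
  exact ENNReal.ofReal_le_ofReal (weight_rpow_mul_heat_le hε hτ hτ1 hσ hσ2 k)

/-- The Fourier coefficients of `e^{-τεΔ²} f` in terms of those of `f`. -/
def semiSeq (ε τ : ℝ) (α : Freq → ℂ) (k : Freq) : ℂ := heat ε τ k * α k

theorem sqNorm_semiSeq_smoothing {ε τ σ : ℝ} (hε : 0 < ε) (hτ : 0 < τ) (hτ1 : τ ≤ 1) (hσ : 0 ≤ σ)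
    (hσ2 : σ ≤ 2) (s : ℝ) (α : Freq → ℂ) :
    sqNorm (s + 2 * σ) (semiSeq ε τ α) ≤
      (smoothConst ε σ * ENNReal.ofReal (τ ^ (-(σ / 2)))) ^ 2 * sqNorm s α := by
  refine sqNorm_le_of_norm_le fun k => ?_
  calc wt (s + 2 * σ) k * ‖semiSeq ε τ α k‖ₑ ^ 2
      = (wt σ k * eheat ε τ k) ^ 2 * (wt s k * ‖α k‖ₑ ^ 2) := by
        rw [semiSeq, enorm_mul, enorm_heat, two_mul, wt_add, wt_add]
        ring
    _ ≤ _ := by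
        gcongr ?_ ^ 2 * _
        exact wt_mul_eheat_le hε hτ hτ1 hσ hσ2 k

theorem sqNorm_semiSeq_le {ε τ : ℝ} (hε : 0 < ε) (hτ : 0 ≤ τ) (s : ℝ) (α : Freq → ℂ) :
    sqNorm s (semiSeq ε τ α) ≤ sqNorm s α := by
  refine ENNReal.tsum_le_tsum fun k => ?_
  gcongr
  rw [semiSeq, enorm_mul, enorm_heat]
  exact mul_le_of_le_one_left zero_le (eheat_le_one hε hτ k)

/-- The kernel `τ ↦ e^{-τεΔ²}` cut off to the time interval `[0,1]`. -/
def cutHeat (ε : ℝ) (k : Freq) : ℝ → ℝ≥0∞ := (Set.Icc 0 1).indicator fun τ => eheat ε τ k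

theorem measurable_cutHeat (ε : ℝ) (k : Freq) : Measurable (cutHeat ε k) :=
  (measurable_eheat ε k).indicator measurableSet_Icc

theorem cutHeat_eq {ε τ : ℝ} (h : τ ∈ Set.Icc (0 : ℝ) 1) (k : Freq) :
    cutHeat ε k τ = eheat ε τ k :=
  Set.indicator_of_mem h _

/-- The mass of the kernel. -/
def heatMass (ε : ℝ) (k : Freq) : ℝ≥0∞ := ∫⁻ τ, cutHeat ε k τ

/-- The parabolic gain of four derivatives. The mass `I` satisfies `I ≤ 1`, thanks to the cut-off at
time 1 (at frequency zero the symbol does not decay), and `εm²I ≤ 1` by integrating the exponential.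
Hence `(1+m)²I ≤ 2I + 2m²I ≤ 2 + 2/ε`. -/
theorem wt_two_mul_heatMass_le {ε : ℝ} (hε : 0 < ε) (k : Freq) :
    wt 2 k * heatMass ε k ≤ smoothConst ε 2 := by
  have hcont := continuous_heat ε k
  have e1 : heatMass ε k = ENNReal.ofReal (∫ τ in (0 : ℝ)..1, heat ε τ k) := by
    rw [heatMass, cutHeat, lintegral_indicator measurableSet_Icc,
      intervalIntegral.integral_of_le zero_le_one, ← integral_Icc_eq_integral_Ioc]
    exact (ofReal_integral_eq_lintegral_ofReal (hcont.integrableOn_Icc)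
      (Eventually.of_forall fun τ => (Real.exp_pos _).le)).symm
  have hI1 : ∫ τ in (0 : ℝ)..1, heat ε τ k ≤ 1 := by
    have := intervalIntegral.integral_mono_on (zero_le_one' ℝ) (hcont.intervalIntegrable 0 1)
      (continuous_const.intervalIntegrable (μ := volume) 0 1) (g := fun _ => (1 : ℝ))
      (fun τ hτ => Real.exp_le_one_iff.mpr (by
        have : 0 ≤ τ * ε * freqSq k ^ 2 := mul_nonneg (mul_nonneg hτ.1 hε.le) (sq_nonneg _)
        linarith))
    simpa using this
  have hI2 : (ε * freqSq k ^ 2) * ∫ τ in (0 : ℝ)..1, heat ε τ k ≤ 1 := by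
    rw [← intervalIntegral.integral_const_mul]
    have hd : ∀ τ ∈ Set.uIcc (0 : ℝ) 1, HasDerivAt (fun τ => -heat ε τ k)
        (ε * freqSq k ^ 2 * heat ε τ k) τ := fun τ _ => by
      have h1 : HasDerivAt (fun τ : ℝ => -(τ * ε * freqSq k ^ 2)) (-(ε * freqSq k ^ 2)) τ := by
        have := (((hasDerivAt_id τ).mul_const ε).mul_const (freqSq k ^ 2)).neg
        rw [one_mul] at this
        exact this
      have := h1.exp.neg
      refine this.congr_deriv ?_
      rw [heat]; ring
    rw [intervalIntegral.integral_eq_sub_of_hasDerivAt hd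
      ((continuous_const.mul hcont).intervalIntegrable _ _)]
    have h0 : heat ε 0 k = 1 := by simp [heat]
    have h1 : 0 ≤ heat ε 1 k := (Real.exp_pos _).le
    rw [h0]
    linarith
  have hI0 : 0 ≤ ∫ τ in (0 : ℝ)..1, heat ε τ k :=
    intervalIntegral.integral_nonneg zero_le_one fun τ _ => (Real.exp_pos _).le
  rw [e1, wt, smoothConst, ← ENNReal.ofReal_mul (Real.rpow_nonneg (weight_pos k).le _)]
  refine ENNReal.ofReal_le_ofReal ?_
  rw [Real.rpow_ofNat, div_self two_ne_zero, Real.rpow_one]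
  set I := ∫ τ in (0 : ℝ)..1, heat ε τ k
  have hI3 : freqSq k ^ 2 * I ≤ 1 / ε := by
    rw [le_div_iff₀ hε]
    linarith
  have : 2 / ε = 2 * (1 / ε) := by ring
  rw [this]
  nlinarith [mul_nonneg (sq_nonneg (1 - freqSq k)) hI0]

/-! ### Duhamel integrals on the Fourier side -/

/-- The Fourier coefficients of `∫₀ᵗ e^{-(t-s)εΔ²} φ(s) ds`. -/
def duhamelSeq (ε : ℝ) (φ : ℝ → Freq → ℂ) (t : ℝ) (k : Freq) : ℂ :=
  ∫ s in Set.Ioc 0 t, (heat ε (t - s) k : ℂ) * φ s k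

theorem enorm_duhamelSeq_le (ε : ℝ) (φ : ℝ → Freq → ℂ) (t : ℝ) (k : Freq) :
    ‖duhamelSeq ε φ t k‖ₑ ≤ ∫⁻ s in Set.Ioc 0 t, eheat ε (t - s) k * ‖φ s k‖ₑ := by
  refine (enorm_integral_le_lintegral_enorm _).trans_eq ?_
  simp only [enorm_mul, enorm_heat]

section Bounds

variable {ε t T : ℝ} {φ : ℝ → Freq → ℂ}

theorem aestronglyMeasurable_mono_Ioc {E : Type*} [TopologicalSpace E] {f : ℝ → E}
    (h : AEStronglyMeasurable f (volume.restrict (Set.Ioc 0 T))) (ht : t ≤ T) :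
    AEStronglyMeasurable f (volume.restrict (Set.Ioc 0 t)) :=
  h.mono_measure (Measure.restrict_mono (Set.Ioc_subset_Ioc_right ht) le_rfl)

theorem lintegral_Ioc_eheat_le (k : Freq) (ht : t ≤ 1) :
    ∫⁻ s in Set.Ioc 0 t, eheat ε (t - s) k ≤ heatMass ε k := by
  calc ∫⁻ s in Set.Ioc 0 t, eheat ε (t - s) k = ∫⁻ s in Set.Ioc 0 t, cutHeat ε k (t - s) := by
        refine setLIntegral_congr_fun measurableSet_Ioc fun s hs => ?_
        exact (cutHeat_eq ⟨by linarith [hs.2], by linarith [hs.1]⟩ k).symm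
    _ ≤ ∫⁻ s, cutHeat ε k (t - s) := setLIntegral_le_lintegral _ _
    _ = _ := lintegral_sub_left_eq_self _ t

theorem sq_enorm_duhamelSeq_le (ht : t ≤ 1) (k : Freq)
    (hφ : AEStronglyMeasurable (fun s => φ s k) (volume.restrict (Set.Ioc 0 t))) :
    ‖duhamelSeq ε φ t k‖ₑ ^ 2 ≤
      heatMass ε k * ∫⁻ s in Set.Ioc 0 t, eheat ε (t - s) k * ‖φ s k‖ₑ ^ 2 := by
  have hm : AEMeasurable (fun s => eheat ε (t - s) k) (volume.restrict (Set.Ioc 0 t)) :=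
    ((measurable_eheat ε k).comp (measurable_const.sub measurable_id)).aemeasurable
  calc ‖duhamelSeq ε φ t k‖ₑ ^ 2
      ≤ (∫⁻ s in Set.Ioc 0 t, eheat ε (t - s) k * ‖φ s k‖ₑ) ^ 2 := by
        gcongr; exact enorm_duhamelSeq_le ε φ t k
    _ ≤ _ := sq_lintegral_weight_mul_le _ hm hφ.enorm
    _ ≤ _ := by gcongr; exact lintegral_Ioc_eheat_le k ht

/-- The kernel mass pays for the weight, and the kernel left under the integral is at most 1. The
bound is also the dominating term in the proof of continuity in time. -/
theorem wt_two_mul_sq_enorm_duhamelSeq_le (hε : 0 < ε) (ht : t ≤ 1) (k : Freq)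
    (hφ : AEStronglyMeasurable (fun s => φ s k) (volume.restrict (Set.Ioc 0 t))) :
    wt 2 k * ‖duhamelSeq ε φ t k‖ₑ ^ 2 ≤
      smoothConst ε 2 * ∫⁻ s in Set.Ioc 0 t, ‖φ s k‖ₑ ^ 2 := by
  calc wt 2 k * ‖duhamelSeq ε φ t k‖ₑ ^ 2
      ≤ wt 2 k * (heatMass ε k * ∫⁻ s in Set.Ioc 0 t, ‖φ s k‖ₑ ^ 2) := by
        refine mul_le_mul_right ((sq_enorm_duhamelSeq_le ht k hφ).trans ?_) _
        refine mul_le_mul_right (setLIntegral_mono' measurableSet_Ioc fun s hs => ?_) _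
        exact mul_le_of_le_one_left zero_le (eheat_le_one hε (by linarith [hs.2]) k)
    _ ≤ _ := by
        rw [← mul_assoc]
        gcongr
        exact wt_two_mul_heatMass_le hε k

/-- The energy estimate `L²(L²) → C(H²)` for the Duhamel integral. -/
theorem sqNorm_two_duhamelSeq_le (hε : 0 < ε) (ht : t ≤ 1)
    (hφ : ∀ k, AEStronglyMeasurable (fun s => φ s k) (volume.restrict (Set.Ioc 0 t))) :
    sqNorm 2 (duhamelSeq ε φ t) ≤ smoothConst ε 2 * ∫⁻ s in Set.Ioc 0 t, sqNorm 0 (φ s) := by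
  simp only [sqNorm_zero_eq]
  rw [lintegral_tsum fun k => (hφ k).enorm.pow_const 2, ← ENNReal.tsum_mul_left]
  exact ENNReal.tsum_le_tsum fun k => wt_two_mul_sq_enorm_duhamelSeq_le hε ht k (hφ k)

theorem integrableOn_of_sqNorm
    (hφ : ∀ k, AEStronglyMeasurable (fun s => φ s k) (volume.restrict (Set.Ioc 0 T)))
    (hφ2 : ∫⁻ s in Set.Ioc 0 T, sqNorm 0 (φ s) < ∞) (k : Freq) :
    IntegrableOn (fun s => φ s k) (Set.Ioc 0 T) := by
  refine ⟨hφ k, ?_⟩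
  have h := sq_lintegral_weight_mul_le (volume.restrict (Set.Ioc 0 T)) (κ := fun _ => 1)
    aemeasurable_const (hφ k).enorm
  simp only [one_mul, lintegral_const, Measure.restrict_apply MeasurableSet.univ, Set.univ_inter,
    Real.volume_Ioc] at h
  have h2 : ∫⁻ s in Set.Ioc 0 T, ‖φ s k‖ₑ ^ 2 < ∞ := by
    refine (lintegral_mono fun s => ?_).trans_lt hφ2
    rw [sqNorm_zero_eq]
    exact ENNReal.le_tsum k
  have := h.trans_lt (ENNReal.mul_lt_top ENNReal.ofReal_lt_top h2)
  simpa [lt_top_iff_ne_top, HasFiniteIntegral] using this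

/-- At a fixed frequency the backward factor is harmless, and continuity in `t` reduces to that of a
primitive. -/
theorem duhamelSeq_eq (ε : ℝ) (φ : ℝ → Freq → ℂ) (t : ℝ) (k : Freq) :
    duhamelSeq ε φ t k =
      (heat ε t k : ℂ) * ∫ s in Set.Ioc 0 t, (heat ε (-s) k : ℂ) * φ s k := by
  rw [duhamelSeq, ← integral_const_mul]
  congr 1
  ext s
  rw [← mul_assoc, ← Complex.ofReal_mul, heat, heat, heat, ← Real.exp_add]
  congr 4
  ring

theorem continuousOn_duhamelSeq
    (hφ : ∀ k, AEStronglyMeasurable (fun s => φ s k) (volume.restrict (Set.Ioc 0 T)))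
    (hφ2 : ∫⁻ s in Set.Ioc 0 T, sqNorm 0 (φ s) < ∞) (k : Freq) :
    ContinuousOn (fun t => duhamelSeq ε φ t k) (Set.Icc 0 T) := by
  simp only [duhamelSeq_eq]
  have hI : IntegrableOn (fun s => (heat ε (-s) k : ℂ) * φ s k) (Set.Icc 0 T) := by
    have h1 := (integrableOn_Icc_iff_integrableOn_Ioc).mpr (integrableOn_of_sqNorm hφ hφ2 k)
    exact IntegrableOn.continuousOn_mul
      (Complex.continuous_ofReal.comp ((continuous_heat ε k).comp continuous_neg)).continuousOn
      h1 isCompact_Icc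
  exact (Complex.continuous_ofReal.comp (continuous_heat ε k)).continuousOn.mul
    (intervalIntegral.continuousOn_primitive hI)

/-- Young's inequality `L¹ * L² → L²` in time: Cauchy–Schwarz releases one mass of the kernel and
Tonelli the other. -/
theorem lintegral_sq_enorm_duhamelSeq_le (hT : T ≤ 1) (k : Freq)
    (hφ : AEStronglyMeasurable (fun s => φ s k) (volume.restrict (Set.Ioc 0 T))) :
    ∫⁻ t in Set.Ioc 0 T, ‖duhamelSeq ε φ t k‖ₑ ^ 2 ≤
      heatMass ε k ^ 2 * ∫⁻ s in Set.Ioc 0 T, ‖φ s k‖ₑ ^ 2 := by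
  have hswap : AEMeasurable (Function.uncurry fun t s => cutHeat ε k (t - s) * ‖φ s k‖ₑ ^ 2)
      ((volume.restrict (Set.Ioc 0 T)).prod (volume.restrict (Set.Ioc 0 T))) := by
    refine AEMeasurable.mul
      ((measurable_cutHeat ε k).comp (measurable_fst.sub measurable_snd)).aemeasurable ?_
    exact (hφ.enorm.pow_const 2).comp_snd
  calc ∫⁻ t in Set.Ioc 0 T, ‖duhamelSeq ε φ t k‖ₑ ^ 2
      ≤ ∫⁻ t in Set.Ioc 0 T, heatMass ε k *
          ∫⁻ s in Set.Ioc 0 T, cutHeat ε k (t - s) * ‖φ s k‖ₑ ^ 2 := by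
        refine setLIntegral_mono' measurableSet_Ioc fun t ht => ?_
        refine (sq_enorm_duhamelSeq_le (ht.2.trans hT) k
          (aestronglyMeasurable_mono_Ioc hφ ht.2)).trans (mul_le_mul_right ?_ _)
        calc ∫⁻ s in Set.Ioc 0 t, eheat ε (t - s) k * ‖φ s k‖ₑ ^ 2
            = ∫⁻ s in Set.Ioc 0 t, cutHeat ε k (t - s) * ‖φ s k‖ₑ ^ 2 := by
              refine setLIntegral_congr_fun measurableSet_Ioc fun s hs => ?_
              rw [cutHeat_eq ⟨by linarith [hs.2], by linarith [hs.1, ht.2]⟩ k]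
          _ ≤ _ := lintegral_mono_set (Set.Ioc_subset_Ioc_right ht.2)
    _ = heatMass ε k * ∫⁻ t in Set.Ioc 0 T,
          ∫⁻ s in Set.Ioc 0 T, cutHeat ε k (t - s) * ‖φ s k‖ₑ ^ 2 :=
        lintegral_const_mul'' _ hswap.lintegral_prod_right'
    _ = heatMass ε k * ∫⁻ s in Set.Ioc 0 T,
          (∫⁻ t in Set.Ioc 0 T, cutHeat ε k (t - s)) * ‖φ s k‖ₑ ^ 2 := by
        rw [lintegral_lintegral_swap hswap]
        congr 2
        ext s
        exact lintegral_mul_const _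
          ((measurable_cutHeat ε k).comp (measurable_id.sub measurable_const))
    _ ≤ heatMass ε k * ∫⁻ s in Set.Ioc 0 T, heatMass ε k * ‖φ s k‖ₑ ^ 2 := by
        gcongr with s
        exact (setLIntegral_le_lintegral _ _).trans_eq (lintegral_sub_right_eq_self _ s)
    _ = _ := by
        rw [lintegral_const_mul'' _ (hφ.enorm.pow_const 2), ← mul_assoc, sq]

/-- Maximal regularity `L²(L²) → L²(H⁴)` for the Duhamel integral. -/
theorem lintegral_sqNorm_four_duhamelSeq_le (hε : 0 < ε) (hT : T ≤ 1)
    (hφ : ∀ k, AEStronglyMeasurable (fun s => φ s k) (volume.restrict (Set.Ioc 0 T)))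
    (hφ2 : ∫⁻ s in Set.Ioc 0 T, sqNorm 0 (φ s) < ∞) :
    ∫⁻ t in Set.Ioc 0 T, sqNorm 4 (duhamelSeq ε φ t) ≤
      smoothConst ε 2 ^ 2 * ∫⁻ s in Set.Ioc 0 T, sqNorm 0 (φ s) := by
  have hm : ∀ k, AEMeasurable (fun t => ‖duhamelSeq ε φ t k‖ₑ ^ 2)
      (volume.restrict (Set.Ioc 0 T)) := fun k =>
    ((((continuousOn_duhamelSeq hφ hφ2 k).mono Set.Ioc_subset_Icc_self).aestronglyMeasurable
      measurableSet_Ioc).enorm.pow_const 2)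
  simp only [sqNorm_zero_eq]
  rw [lintegral_tsum fun k => (hφ k).enorm.pow_const 2, ← ENNReal.tsum_mul_left]
  unfold sqNorm
  rw [lintegral_tsum fun k => (hm k).const_mul _]
  refine ENNReal.tsum_le_tsum fun k => ?_
  rw [lintegral_const_mul'' _ (hm k)]
  calc wt 4 k * ∫⁻ t in Set.Ioc 0 T, ‖duhamelSeq ε φ t k‖ₑ ^ 2
      ≤ wt 4 k * (heatMass ε k ^ 2 * ∫⁻ s in Set.Ioc 0 T, ‖φ s k‖ₑ ^ 2) := by
        gcongr
        exact lintegral_sq_enorm_duhamelSeq_le hT k (hφ k)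
    _ = (wt 2 k * heatMass ε k) ^ 2 * ∫⁻ s in Set.Ioc 0 T, ‖φ s k‖ₑ ^ 2 := by
        rw [show (4 : ℝ) = 2 + 2 by norm_num, wt_add]
        ring
    _ ≤ _ := by
        gcongr
        exact wt_two_mul_heatMass_le hε k

/-- The square of the symbol is at most the symbol, whose mass cancels two of the four powers of
`1+|2πk|²`. -/
theorem lintegral_sqNorm_four_semiSeq_le (hε : 0 < ε) (hT : T ≤ 1) (α : Freq → ℂ) :
    ∫⁻ t in Set.Ioc 0 T, sqNorm 4 (semiSeq ε t α) ≤ smoothConst ε 2 * sqNorm 2 α := by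
  unfold sqNorm
  have hm : ∀ k, Measurable fun t => ‖semiSeq ε t α k‖ₑ ^ 2 := fun k => by
    simp only [semiSeq, enorm_mul, enorm_heat]
    exact ((measurable_eheat ε k).mul_const _).pow_const 2
  rw [lintegral_tsum fun k => ((hm k).const_mul _).aemeasurable, ← ENNReal.tsum_mul_left]
  refine ENNReal.tsum_le_tsum fun k => ?_
  have h1 : ∫⁻ t in Set.Ioc 0 T, eheat ε t k ≤ heatMass ε k := by
    calc ∫⁻ t in Set.Ioc 0 T, eheat ε t k = ∫⁻ t in Set.Ioc 0 T, cutHeat ε k t := by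
          refine setLIntegral_congr_fun measurableSet_Ioc fun s hs => ?_
          exact (cutHeat_eq ⟨hs.1.le, hs.2.trans hT⟩ k).symm
      _ ≤ _ := setLIntegral_le_lintegral _ _
  calc ∫⁻ t in Set.Ioc 0 T, wt 4 k * ‖semiSeq ε t α k‖ₑ ^ 2
      ≤ ∫⁻ t in Set.Ioc 0 T, wt 4 k * ‖α k‖ₑ ^ 2 * eheat ε t k := by
        refine setLIntegral_mono' measurableSet_Ioc fun t ht => ?_
        have := eheat_le_one hε ht.1.le k
        rw [semiSeq, enorm_mul, enorm_heat, mul_pow, mul_assoc, mul_comm (‖α k‖ₑ ^ 2)]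
        gcongr
        rw [sq]
        exact mul_le_of_le_one_left zero_le this
    _ = wt 4 k * ‖α k‖ₑ ^ 2 * ∫⁻ t in Set.Ioc 0 T, eheat ε t k :=
        lintegral_const_mul _ (measurable_eheat ε k)
    _ ≤ wt 4 k * ‖α k‖ₑ ^ 2 * heatMass ε k := by gcongr
    _ = wt 2 k * heatMass ε k * (wt 2 k * ‖α k‖ₑ ^ 2) := by
        rw [show (4 : ℝ) = 2 + 2 by norm_num, wt_add]
        ring
    _ ≤ _ := by
        gcongr
        exact wt_two_mul_heatMass_le hε k

/-! ### Continuity in time -/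

/-- Dominated convergence for the counting measure on frequencies. -/
theorem tendsto_sqNorm_sub {ι : Type*} {l : Filter ι} [l.IsCountablyGenerated] {s : ℝ}
    {a : ι → Freq → ℂ} {a₀ : Freq → ℂ} {b : Freq → ℝ≥0∞} (hb : ∑' k, b k ≠ ∞)
    (h : ∀ᶠ i in l, ∀ k, wt s k * ‖a i k‖ₑ ^ 2 ≤ b k) (h₀ : ∀ k, wt s k * ‖a₀ k‖ₑ ^ 2 ≤ b k)
    (hlim : ∀ k, Tendsto (fun i => a i k) l (𝓝 (a₀ k))) :
    Tendsto (fun i => sqNorm s (a i - a₀)) l (𝓝 0) := by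
  let _ : MeasurableSpace Freq := ⊤
  have key := tendsto_lintegral_filter_of_dominated_convergence (μ := (Measure.count : Measure Freq))
    (l := l) (F := fun i k => wt s k * ‖(a i - a₀) k‖ₑ ^ 2) (f := fun _ => 0)
    (fun k => 4 * b k) (Eventually.of_forall fun i => measurable_from_top) ?_ ?_ ?_
  · simp only [lintegral_count, tsum_zero] at key
    exact key
  · filter_upwards [h] with i hi
    refine Eventually.of_forall fun k => ?_
    calc wt s k * ‖(a i - a₀) k‖ₑ ^ 2 ≤ wt s k * (‖a i k‖ₑ + ‖a₀ k‖ₑ) ^ 2 := by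
          gcongr
          exact enorm_sub_le
      _ ≤ wt s k * (2 * (‖a i k‖ₑ ^ 2 + ‖a₀ k‖ₑ ^ 2)) := by
          gcongr
          exact ennreal_add_sq_le _ _
      _ = 2 * (wt s k * ‖a i k‖ₑ ^ 2 + wt s k * ‖a₀ k‖ₑ ^ 2) := by ring
      _ ≤ 2 * (b k + b k) := by
          gcongr
          exacts [hi k, h₀ k]
      _ = _ := by ring
  · simp only [lintegral_count, ENNReal.tsum_mul_left]
    exact ENNReal.mul_ne_top (by norm_num) hb
  · refine Eventually.of_forall fun k => ?_
    have h1 : Tendsto (fun i => ‖(a i - a₀) k‖ₑ) l (𝓝 0) := by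
      have := ((hlim k).sub_const (a₀ k)).enorm
      simpa using this
    have h2 := ENNReal.Tendsto.const_mul (a := wt s k) (ENNReal.Tendsto.pow (n := 2) h1) (Or.inr (wt_ne_top s k))
    simpa using h2

/-- The Fourier coefficients of the right-hand side of the integral equation. -/
def mildSeq (ε : ℝ) (α : Freq → ℂ) (φ : ℝ → Freq → ℂ) (t : ℝ) : Freq → ℂ :=
  semiSeq ε t α + duhamelSeq ε φ t

/-- Each coefficient is continuous in time, and the energy bound at each frequency, with the time
integral extended to `[0,T]`, is a summable majorant independent of time. -/
theorem tendsto_sqNorm_mildSeq_sub (hε : 0 < ε) (hT : T ≤ 1) {α : Freq → ℂ}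
    (hα : sqNorm 2 α < ∞)
    (hφ : ∀ k, AEStronglyMeasurable (fun s => φ s k) (volume.restrict (Set.Ioc 0 T)))
    (hφ2 : ∫⁻ s in Set.Ioc 0 T, sqNorm 0 (φ s) < ∞) (ht : t ∈ Set.Icc 0 T) :
    Tendsto (fun s => sqNorm 2 (mildSeq ε α φ s - mildSeq ε α φ t)) (𝓝[Set.Icc 0 T] t) (𝓝 0) := by
  set b : Freq → ℝ≥0∞ := fun k => 2 * (wt 2 k * ‖α k‖ₑ ^ 2 +
    smoothConst ε 2 * ∫⁻ s in Set.Ioc 0 T, ‖φ s k‖ₑ ^ 2)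
  have hb : ∑' k, b k ≠ ∞ := by
    have h1 : ∑' k, ∫⁻ s in Set.Ioc 0 T, ‖φ s k‖ₑ ^ 2 < ∞ := by
      rw [← lintegral_tsum fun k => (hφ k).enorm.pow_const 2]
      simpa only [sqNorm_zero_eq] using hφ2
    simp only [b, ENNReal.tsum_mul_left, ENNReal.tsum_add]
    exact ENNReal.mul_ne_top (by norm_num) (ENNReal.add_ne_top.mpr
      ⟨hα.ne, ENNReal.mul_ne_top ENNReal.ofReal_ne_top h1.ne⟩)
  have hbound : ∀ s ∈ Set.Icc 0 T, ∀ k, wt 2 k * ‖mildSeq ε α φ s k‖ₑ ^ 2 ≤ b k := by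
    intro s hs k
    calc wt 2 k * ‖mildSeq ε α φ s k‖ₑ ^ 2
        ≤ wt 2 k * (‖semiSeq ε s α k‖ₑ + ‖duhamelSeq ε φ s k‖ₑ) ^ 2 := by
          gcongr
          exact enorm_add_le _ _
      _ ≤ wt 2 k * (2 * (‖semiSeq ε s α k‖ₑ ^ 2 + ‖duhamelSeq ε φ s k‖ₑ ^ 2)) := by
          gcongr
          exact ennreal_add_sq_le _ _
      _ = 2 * (wt 2 k * ‖semiSeq ε s α k‖ₑ ^ 2 + wt 2 k * ‖duhamelSeq ε φ s k‖ₑ ^ 2) := by ring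
      _ ≤ _ := by
          refine mul_le_mul_right (add_le_add ?_ ?_) _
          · gcongr
            rw [semiSeq, enorm_mul, enorm_heat]
            exact mul_le_of_le_one_left zero_le (eheat_le_one hε hs.1 k)
          · refine (wt_two_mul_sq_enorm_duhamelSeq_le hε (hs.2.trans hT) k
              (aestronglyMeasurable_mono_Ioc (hφ k) hs.2)).trans ?_
            gcongr
            exact hs.2
  refine tendsto_sqNorm_sub hb (eventually_mem_nhdsWithin.mono hbound) (hbound t ht) fun k => ?_
  refine ContinuousWithinAt.add ?_ ((continuousOn_duhamelSeq hφ hφ2 k) t ht)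
  exact ((Complex.continuous_ofReal.comp (continuous_heat ε k)).mul
    continuous_const).continuousWithinAt

/-! ### Smoothing by the Duhamel integral -/

theorem lintegral_rpow_Ioc {r : ℝ} (hr : -1 < r) (ht : 0 ≤ t) :
    ∫⁻ s in Set.Ioc 0 t, ENNReal.ofReal (s ^ r) = ENNReal.ofReal (t ^ (r + 1) / (r + 1)) := by
  have hi : IntegrableOn (fun s : ℝ => s ^ r) (Set.Ioc 0 t) :=
    (intervalIntegrable_iff_integrableOn_Ioc_of_le ht).mp
      (intervalIntegral.intervalIntegrable_rpow' hr)
  rw [← ofReal_integral_eq_lintegral_ofReal hi, ← intervalIntegral.integral_of_le ht,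
    integral_rpow (Or.inl hr), Real.zero_rpow (by linarith), sub_zero]
  filter_upwards [ae_restrict_mem measurableSet_Ioc] with s hs
  exact Real.rpow_nonneg hs.1.le _

theorem lintegral_sub_rpow_Ioc {r : ℝ} (hr : -1 < r) (ht : 0 ≤ t) :
    ∫⁻ s in Set.Ioc 0 t, ENNReal.ofReal ((t - s) ^ r) = ENNReal.ofReal (t ^ (r + 1) / (r + 1)) := by
  have hi : IntegrableOn (fun s : ℝ => (t - s) ^ r) (Set.Ioc 0 t) := by
    have := (intervalIntegral.intervalIntegrable_rpow' (a := t) (b := 0) hr).comp_sub_left t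
    simp only [sub_self, sub_zero] at this
    exact (intervalIntegrable_iff_integrableOn_Ioc_of_le ht).mp this
  rw [← ofReal_integral_eq_lintegral_ofReal hi, ← intervalIntegral.integral_of_le ht,
    intervalIntegral.integral_comp_sub_left (fun s => s ^ r) t, sub_self, sub_zero,
    integral_rpow (Or.inl hr), Real.zero_rpow (by linarith), sub_zero]
  filter_upwards [ae_restrict_mem measurableSet_Ioc] with s hs
  exact Real.rpow_nonneg (by linarith [hs.2]) _

/-- A bound for the beta integral `∫₀ᵗ (t-s)^{-3/4} s^{-1/4} ds`. -/
theorem lintegral_beta_le (ht : 0 < t) :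
    ∫⁻ s in Set.Ioc 0 t, ENNReal.ofReal ((t - s) ^ (-(3 / 4) : ℝ)) *
      ENNReal.ofReal (s ^ (-(1 / 4) : ℝ)) ≤ ENNReal.ofReal 16 := by
  have h2 : 0 < t / 2 := by positivity
  calc ∫⁻ s in Set.Ioc 0 t, ENNReal.ofReal ((t - s) ^ (-(3 / 4) : ℝ)) *
        ENNReal.ofReal (s ^ (-(1 / 4) : ℝ))
      ≤ ∫⁻ s in Set.Ioc 0 t,
          (ENNReal.ofReal ((t / 2) ^ (-(3 / 4) : ℝ)) * ENNReal.ofReal (s ^ (-(1 / 4) : ℝ)) +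
          ENNReal.ofReal ((t / 2) ^ (-(1 / 4) : ℝ)) *
            ENNReal.ofReal ((t - s) ^ (-(3 / 4) : ℝ))) := by
        refine setLIntegral_mono' measurableSet_Ioc fun s hs => ?_
        -- On each half of the interval, the factor away from its singularity is at most its value
        -- at distance `t/2`.
        rcases le_total s (t / 2) with h | h
        · refine le_add_right (mul_le_mul_left (ENNReal.ofReal_le_ofReal ?_) _)
          exact Real.rpow_le_rpow_of_nonpos h2 (by linarith) (by norm_num)
        · rw [mul_comm (ENNReal.ofReal ((t - s) ^ (-(3 / 4) : ℝ)))]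
          refine le_add_left (mul_le_mul_left (ENNReal.ofReal_le_ofReal ?_) _)
          exact Real.rpow_le_rpow_of_nonpos h2 h (by norm_num)
    _ = ENNReal.ofReal ((t / 2) ^ (-(3 / 4) : ℝ)) * ENNReal.ofReal (t ^ (3 / 4 : ℝ) / (3 / 4)) +
          ENNReal.ofReal ((t / 2) ^ (-(1 / 4) : ℝ)) *
            ENNReal.ofReal (t ^ (1 / 4 : ℝ) / (1 / 4)) := by
        rw [lintegral_add_left (by fun_prop), lintegral_const_mul _ (by fun_prop),
          lintegral_const_mul _ (by fun_prop), lintegral_rpow_Ioc (by norm_num) ht.le,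
          lintegral_sub_rpow_Ioc (by norm_num) ht.le]
        norm_num
    _ ≤ _ := by
        rw [← ENNReal.ofReal_mul (by positivity), ← ENNReal.ofReal_mul (by positivity),
          ← ENNReal.ofReal_add (by positivity) (by positivity)]
        refine ENNReal.ofReal_le_ofReal ?_
        -- Since `(t/2)^{-r} t^r = 2^r ≤ 2`, the two terms add up to at most `8/3 + 8`, which is
        -- below 16.
        have hp : ∀ r : ℝ, 0 ≤ r → r ≤ 1 → (t / 2) ^ (-r) * t ^ r ≤ 2 := fun r h0 h1 => by
          rw [Real.rpow_neg h2.le, Real.div_rpow ht.le (by norm_num), inv_div,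
            div_mul_cancel₀ _ (Real.rpow_pos_of_pos ht r).ne']
          calc (2 : ℝ) ^ r ≤ 2 ^ (1 : ℝ) := Real.rpow_le_rpow_of_exponent_le (by norm_num) h1
            _ = 2 := by norm_num
        have p1 := hp (3 / 4) (by norm_num) (by norm_num)
        have p2 := hp (1 / 4) (by norm_num) (by norm_num)
        linarith

/-- A gain of three derivatives in the Duhamel integral of a forcing with an integrable
singularity at the initial time. -/
theorem sqNorm_duhamelSeq_smoothing (hε : 0 < ε) (ht : 0 < t) (ht1 : t ≤ 1) (r : ℝ) {B : ℝ≥0∞}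
    (hφ : ∀ k, AEStronglyMeasurable (fun s => φ s k) (volume.restrict (Set.Ioc 0 t)))
    (hB : ∀ᵐ s ∂(volume.restrict (Set.Ioc 0 t)),
      sqNorm r (φ s) ≤ B * ENNReal.ofReal (s ^ (-(1 / 4) : ℝ)) ^ 2) :
    sqNorm (r + 3) (duhamelSeq ε φ t) ≤ (smoothConst ε (3 / 2) * ENNReal.ofReal 16) ^ 2 * B := by
  set C := smoothConst ε (3 / 2)
  set μ := volume.restrict (Set.Ioc 0 t)
  -- The singularity `s^{-1/4}` of the forcing is moved into the kernel. The new kernel `κ` has mass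
  -- bounded uniformly in `t`, and `φ/ρ` is bounded by `B` in squared norm.
  set ρ : ℝ → ℝ≥0∞ := fun s => ENNReal.ofReal (s ^ (-(1 / 4) : ℝ)) with hρ
  set κ : ℝ → ℝ≥0∞ := fun s => ENNReal.ofReal ((t - s) ^ (-(3 / 4) : ℝ)) * ρ s with hκ
  have hρm : Measurable ρ := by fun_prop
  have hκm : Measurable κ := by fun_prop
  have hρ0 : ∀ s ∈ Set.Ioc 0 t, ρ s ≠ 0 := fun s hs => by
    simpa [hρ] using Real.rpow_pos_of_pos hs.1 _
  have hρt : ∀ s, ρ s ≠ ∞ := fun s => ENNReal.ofReal_ne_top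
  have hne : ∀ᵐ s ∂μ, s ≠ t := by
    refine ae_restrict_of_ae ?_
    simp [ae_iff]
  have hmem : ∀ᵐ s ∂μ, s ∈ Set.Ioc 0 t := ae_restrict_mem measurableSet_Ioc
  have key : ∀ k, wt (r + 3) k * ‖duhamelSeq ε φ t k‖ₑ ^ 2 ≤
      C ^ 2 * ((∫⁻ s, κ s ∂μ) * ∫⁻ s, κ s * ((ρ s)⁻¹ ^ 2 * (wt r k * ‖φ s k‖ₑ ^ 2)) ∂μ) := by
    intro k
    have h1 : wt ((r + 3) / 2) k * ‖duhamelSeq ε φ t k‖ₑ ≤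
        C * ∫⁻ s, κ s * ((ρ s)⁻¹ * (wt (r / 2) k * ‖φ s k‖ₑ)) ∂μ := by
      calc _ ≤ wt ((r + 3) / 2) k * ∫⁻ s, eheat ε (t - s) k * ‖φ s k‖ₑ ∂μ := by
            gcongr; exact enorm_duhamelSeq_le ε φ t k
        _ = ∫⁻ s, wt ((r + 3) / 2) k * (eheat ε (t - s) k * ‖φ s k‖ₑ) ∂μ :=
            (lintegral_const_mul' _ _ (wt_ne_top _ _)).symm
        _ ≤ ∫⁻ s, C * (κ s * ((ρ s)⁻¹ * (wt (r / 2) k * ‖φ s k‖ₑ))) ∂μ := by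
            refine lintegral_mono_ae ?_
            filter_upwards [hne, hmem] with s hs hs'
            -- Three derivatives cost `(t-s)^{-3/4}`, which is integrable; four would cost
            -- `(t-s)^{-1}`. The bound needs `s < t`, hence the removal of the null set `s = t`.
            have h2 := wt_mul_eheat_le hε (τ := t - s) (sub_pos.mpr (lt_of_le_of_ne hs'.2 hs))
              (by linarith [hs'.1]) (σ := 3 / 2) (by norm_num) (by norm_num) k
            have h3 : -((3 / 2 : ℝ) / 2) = -(3 / 4) := by norm_num
            rw [h3] at h2
            calc wt ((r + 3) / 2) k * (eheat ε (t - s) k * ‖φ s k‖ₑ)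
                = (wt (3 / 2) k * eheat ε (t - s) k) * (wt (r / 2) k * ‖φ s k‖ₑ) := by
                  rw [add_div, wt_add]; ring
              _ ≤ C * ENNReal.ofReal ((t - s) ^ (-(3 / 4) : ℝ)) *
                    (wt (r / 2) k * ‖φ s k‖ₑ) := by gcongr
              _ = C * ENNReal.ofReal ((t - s) ^ (-(3 / 4) : ℝ)) * (ρ s * (ρ s)⁻¹) *
                    (wt (r / 2) k * ‖φ s k‖ₑ) := by
                  rw [ENNReal.mul_inv_cancel (hρ0 s hs') (hρt s), mul_one]
              _ = _ := by simp only [hκ]; ring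
        _ = _ := lintegral_const_mul' _ _ ENNReal.ofReal_ne_top
    calc _ = (wt ((r + 3) / 2) k * ‖duhamelSeq ε φ t k‖ₑ) ^ 2 := by rw [mul_pow, wt_half_sq]
      _ ≤ (C * ∫⁻ s, κ s * ((ρ s)⁻¹ * (wt (r / 2) k * ‖φ s k‖ₑ)) ∂μ) ^ 2 := by gcongr
      _ ≤ C ^ 2 * ((∫⁻ s, κ s ∂μ) *
            ∫⁻ s, κ s * ((ρ s)⁻¹ * (wt (r / 2) k * ‖φ s k‖ₑ)) ^ 2 ∂μ) := by
          rw [mul_pow]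
          gcongr
          exact sq_lintegral_weight_mul_le μ hκm.aemeasurable
            (hρm.inv.aemeasurable.mul ((hφ k).enorm.const_mul _))
      _ = _ := by simp only [mul_pow, wt_half_sq]
  have hκI : ∫⁻ s, κ s ∂μ ≤ ENNReal.ofReal 16 := lintegral_beta_le ht
  have hmeas : ∀ k, AEMeasurable (fun s => κ s * ((ρ s)⁻¹ ^ 2 * (wt r k * ‖φ s k‖ₑ ^ 2))) μ :=
    fun k => hκm.aemeasurable.mul ((hρm.inv.pow_const 2).aemeasurable.mul
      (((hφ k).enorm.pow_const 2).const_mul _))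
  calc sqNorm (r + 3) (duhamelSeq ε φ t)
      ≤ ∑' k, C ^ 2 * ((∫⁻ s, κ s ∂μ) *
          ∫⁻ s, κ s * ((ρ s)⁻¹ ^ 2 * (wt r k * ‖φ s k‖ₑ ^ 2)) ∂μ) := ENNReal.tsum_le_tsum key
    _ = C ^ 2 * ((∫⁻ s, κ s ∂μ) * ∫⁻ s, κ s * ((ρ s)⁻¹ ^ 2 * sqNorm r (φ s)) ∂μ) := by
        rw [ENNReal.tsum_mul_left, ENNReal.tsum_mul_left, ← lintegral_tsum hmeas]
        simp only [ENNReal.tsum_mul_left]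
        rfl
    _ ≤ C ^ 2 * ((∫⁻ s, κ s ∂μ) * ∫⁻ s, κ s * B ∂μ) := by
        refine mul_le_mul_right (mul_le_mul_right (lintegral_mono_ae ?_) _) _
        filter_upwards [hB, hmem] with s hs hs'
        gcongr
        calc (ρ s)⁻¹ ^ 2 * sqNorm r (φ s) ≤ (ρ s)⁻¹ ^ 2 * (B * ρ s ^ 2) := by gcongr
          _ = (ρ s * (ρ s)⁻¹) ^ 2 * B := by ring
          _ = B := by rw [ENNReal.mul_inv_cancel (hρ0 s hs') (hρt s), one_pow, one_mul]
    _ = C ^ 2 * ((∫⁻ s, κ s ∂μ) * ((∫⁻ s, κ s ∂μ) * B)) := by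
        rw [lintegral_mul_const _ hκm]
    _ ≤ C ^ 2 * (ENNReal.ofReal 16 * (ENNReal.ofReal 16 * B)) := by gcongr
    _ = _ := by ring

end Bounds

/-! ### The advection term -/

/-- A vector field on the torus whose components are bounded by `V` and have weak derivatives
bounded by `V + 1`. -/
structure IsBoundedField (V : ℝ≥0) (q : Torus → Fin 2 → ℝ) : Prop where
  aestronglyMeasurable : ∀ i, AEStronglyMeasurable (fun x => q x i) volume
  bound : ∀ i, eLpNorm (fun x => q x i) ∞ volume ≤ V
  weakDeriv : ∀ i j, ∃ g : Torus → ℝ, IsWeakDeriv j (fun x => q x i) g ∧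
    eLpNorm g ∞ volume ≤ V + 1

theorem isBoundedField_of_flowNorm_le {v : ℝ → Torus → Fin 2 → ℝ} (hv : IsDivFreeFlow v)
    {V : ℝ≥0} (hV : flowNorm v ≤ V) :
    ∀ᵐ t ∂(volume.restrict (Set.Ici (0 : ℝ))), IsBoundedField V (v t) := by
  filter_upwards [ENNReal.ae_le_essSup fun t : ℝ => ⨆ i : Fin 2, w1InfNorm fun x => v t x i,
    hv.aestronglyMeasurable.prodMk_left] with t ht hm
  have hle : ∀ i, w1InfNorm (fun x => v t x i) ≤ V := fun i =>
    (le_iSup (fun i : Fin 2 => w1InfNorm fun x => v t x i) i).trans (ht.trans hV)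
  refine ⟨fun i => (continuous_apply i).comp_aestronglyMeasurable hm,
    fun i => le_self_add.trans (hle i), fun i j => ?_⟩
  -- The infimum is bounded by `V`; the slack 1 makes the inequality strict and so produces an
  -- actual weak derivative.
  have h1 : (⨅ (g : Torus → ℝ) (_ : IsWeakDeriv j (fun x => v t x i) g),
      eLpNorm g ∞ volume) < V + 1 := by
    calc _ ≤ ∑ j : Fin 2, ⨅ (g : Torus → ℝ) (_ : IsWeakDeriv j (fun x => v t x i) g),
            eLpNorm g ∞ volume :=
          Finset.single_le_sum (f := fun j : Fin 2 => ⨅ (g : Torus → ℝ)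
            (_ : IsWeakDeriv j (fun x => v t x i) g), eLpNorm g ∞ volume)
            (fun _ _ => zero_le) (Finset.mem_univ j)
      _ ≤ w1InfNorm (fun x => v t x i) := le_add_self
      _ ≤ V := hle i
      _ < V + 1 := ENNReal.lt_add_right ENNReal.coe_ne_top one_ne_zero
  simp only [iInf_lt_iff] at h1
  obtain ⟨g, hg, hgV⟩ := h1
  exact ⟨g, hg, hgV.le⟩

theorem isBoundedField_ae_Ioc {v : ℝ → Torus → Fin 2 → ℝ} {V : ℝ≥0}
    (h : ∀ᵐ t ∂(volume.restrict (Set.Ici (0 : ℝ))), IsBoundedField V (v t)) (T : ℝ) :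
    ∀ᵐ t ∂(volume.restrict (Set.Ioc 0 T)), IsBoundedField V (v t) :=
  ae_restrict_of_ae_restrict_of_subset (fun _ hx => hx.1.le) h

/-- The Fourier coefficients of a component of a vector field. -/
def fieldSeq (q : Torus → Fin 2 → ℝ) (i : Fin 2) : Freq → ℂ :=
  mFourierCoeff fun x => (q x i : ℂ)

/-- The Fourier coefficients of `q·∇u` in terms of those of `u`. -/
def advSeq (q : Torus → Fin 2 → ℝ) (α : Freq → ℂ) : Freq → ℂ :=
  ∑ i, conv (fieldSeq q i) (derivSeq i α)

theorem eLpNorm_ofReal (f : Torus → ℝ) (p : ℝ≥0∞) :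
    eLpNorm (fun x => (f x : ℂ)) p volume = eLpNorm f p volume :=
  eLpNorm_congr_norm_ae (Eventually.of_forall fun x => Complex.norm_real (f x))

theorem IsBoundedField.memLp {V : ℝ≥0} {q : Torus → Fin 2 → ℝ} (hq : IsBoundedField V q)
    (i : Fin 2) : MemLp (fun x => (q x i : ℂ)) ∞ volume :=
  MemLp.ofReal ⟨hq.aestronglyMeasurable i, (hq.bound i).trans_lt ENNReal.coe_lt_top⟩

theorem IsBoundedField.sqNorm_fieldSeq_lt_top {V : ℝ≥0} {q : Torus → Fin 2 → ℝ}
    (hq : IsBoundedField V q) (i : Fin 2) : sqNorm 0 (fieldSeq q i) < ∞ :=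
  sqNorm_mFourierCoeff_lt_top_of_memLp ((hq.memLp i).mono_exponent le_top)

theorem sqNorm_derivSeq_lt_top (i : Fin 2) {α : Freq → ℂ} (hα : sqNorm 2 α < ∞) :
    sqNorm 0 (derivSeq i α) < ∞ :=
  (sqNorm_derivSeq_le 0 i α).trans_lt (sqNorm_lt_top_of_le (by norm_num) hα)

theorem IsBoundedField.mFourierCoeff_advection {V : ℝ≥0} {q : Torus → Fin 2 → ℝ}
    (hq : IsBoundedField V q) {u : L2} (hu : sqNorm 2 (mFourierCoeff u) < ∞) :
    mFourierCoeff (fun x => ∑ i : Fin 2, (q x i : ℂ) * partialDeriv i u x) =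
      advSeq q (mFourierCoeff u) := by
  have h2 : ∀ i, MemLp (fun x => (q x i : ℂ) * partialDeriv i u x) 2 volume := fun i =>
    (Lp.memLp (partialDeriv i u)).mul' (hq.memLp i)
  simp only [Fin.sum_univ_two, advSeq]
  rw [mFourierCoeff_add ((h2 0).integrable (by norm_num)) ((h2 1).integrable (by norm_num))]
  congr 1
  all_goals
    rw [mFourierCoeff_mul ((hq.memLp _).mono_exponent le_top) (Lp.memLp _),
      mFourierCoeff_partialDeriv _ hu]
    rfl

theorem IsBoundedField.sqNorm_conv_le {V : ℝ≥0} {q : Torus → Fin 2 → ℝ}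
    (hq : IsBoundedField V q) (i : Fin 2) {β : Freq → ℂ} (hβ : sqNorm 0 β < ∞) :
    sqNorm 0 (conv (fieldSeq q i) β) ≤ V ^ 2 * sqNorm 0 β :=
  sqNorm_conv_bounded_le (hq.memLp i).1 ENNReal.coe_ne_top
    ((eLpNorm_ofReal _ _).trans_le (hq.bound i)) hβ

theorem IsBoundedField.sqNorm_advSeq_le {V : ℝ≥0} {q : Torus → Fin 2 → ℝ}
    (hq : IsBoundedField V q) {α : Freq → ℂ} (hα : sqNorm 2 α < ∞) :
    sqNorm 0 (advSeq q α) ≤ 4 * V ^ 2 * sqNorm 2 α := by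
  have h : ∀ i, sqNorm 0 (conv (fieldSeq q i) (derivSeq i α)) ≤ V ^ 2 * sqNorm 2 α := fun i => by
    refine (hq.sqNorm_conv_le i (sqNorm_derivSeq_lt_top i hα)).trans ?_
    gcongr
    exact (sqNorm_derivSeq_le 0 i α).trans (sqNorm_mono (by norm_num) α)
  rw [advSeq, Fin.sum_univ_two]
  refine (sqNorm_add_le _ _ _).trans ?_
  calc _ ≤ 2 * ((V : ℝ≥0∞) ^ 2 * sqNorm 2 α + V ^ 2 * sqNorm 2 α) := by gcongr <;> exact h _
    _ = _ := by ring

theorem IsBoundedField.advSeq_sub {V : ℝ≥0} {q : Torus → Fin 2 → ℝ} (hq : IsBoundedField V q)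
    {α β : Freq → ℂ} (hα : sqNorm 2 α < ∞) (hβ : sqNorm 2 β < ∞) :
    advSeq q (α - β) = advSeq q α - advSeq q β := by
  rw [advSeq, advSeq, advSeq, ← Finset.sum_sub_distrib]
  refine Finset.sum_congr rfl fun i _ => ?_
  rw [derivSeq_sub, conv_sub_right (hq.sqNorm_fieldSeq_lt_top i) (sqNorm_derivSeq_lt_top i hα)
    (sqNorm_derivSeq_lt_top i hβ)]

/-- This is where the Lipschitz bound on the flow is used. By Leibniz the derivative falls on the
field, whose weak derivative is bounded, or on `β`. The constant is `9 = 1 + 4 + 4`: the function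
and its two derivatives. -/
theorem IsBoundedField.sqNorm_one_conv_le {V : ℝ≥0} {q : Torus → Fin 2 → ℝ}
    (hq : IsBoundedField V q) (i : Fin 2) {β : Freq → ℂ} (hβ : sqNorm 1 β < ∞) :
    sqNorm 1 (conv (fieldSeq q i) β) ≤ 9 * ((V : ℝ≥0∞) + 1) ^ 2 * sqNorm 1 β := by
  have hβ0 : sqNorm 0 β < ∞ := sqNorm_lt_top_of_le zero_le_one hβ
  have hβ' : ∀ j, sqNorm 0 (derivSeq j β) < ∞ := fun j =>
    (sqNorm_derivSeq_le 0 j β).trans_lt (by rwa [zero_add])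
  have hVV : (V : ℝ≥0∞) ≤ V + 1 := le_self_add
  have h0 : sqNorm 0 (conv (fieldSeq q i) β) ≤ ((V : ℝ≥0∞) + 1) ^ 2 * sqNorm 1 β := by
    refine (hq.sqNorm_conv_le i hβ0).trans ?_
    gcongr
    exact sqNorm_mono zero_le_one β
  have h1 : ∀ j, sqNorm 0 (derivSeq j (conv (fieldSeq q i) β)) ≤
      4 * (((V : ℝ≥0∞) + 1) ^ 2 * sqNorm 1 β) := fun j => by
    obtain ⟨g, hg, hgV⟩ := hq.weakDeriv i j
    have e : mFourierCoeff (fun x => (g x : ℂ)) = derivSeq j (fieldSeq q i) :=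
      mFourierCoeff_weakDeriv hg
    have hV1 : (V : ℝ≥0∞) + 1 ≠ ∞ := by finiteness
    have hgL : MemLp (fun x => (g x : ℂ)) ∞ volume :=
      MemLp.ofReal ⟨hg.2.1.1, hgV.trans_lt hV1.lt_top⟩
    have hd : sqNorm 0 (derivSeq j (fieldSeq q i)) < ∞ := by
      rw [← e]
      exact sqNorm_mFourierCoeff_lt_top_of_memLp (hgL.mono_exponent le_top)
    rw [derivSeq_conv j (hq.sqNorm_fieldSeq_lt_top i) hd hβ0 (hβ' j)]
    have b1 : sqNorm 0 (conv (derivSeq j (fieldSeq q i)) β) ≤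
        ((V : ℝ≥0∞) + 1) ^ 2 * sqNorm 1 β := by
      rw [← e]
      refine (sqNorm_conv_bounded_le hgL.1 hV1 ((eLpNorm_ofReal _ _).trans_le hgV) hβ0).trans ?_
      gcongr
      exact sqNorm_mono zero_le_one β
    have b2 : sqNorm 0 (conv (fieldSeq q i) (derivSeq j β)) ≤
        ((V : ℝ≥0∞) + 1) ^ 2 * sqNorm 1 β := by
      refine (hq.sqNorm_conv_le i (hβ' j)).trans ?_
      gcongr
      simpa using sqNorm_derivSeq_le 0 j β
    refine (sqNorm_add_le _ _ _).trans ?_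
    calc _ ≤ 2 * (((V : ℝ≥0∞) + 1) ^ 2 * sqNorm 1 β + ((V : ℝ≥0∞) + 1) ^ 2 * sqNorm 1 β) := by
          gcongr
      _ = _ := by ring
  rw [sqNorm_one_eq, Fin.sum_univ_two]
  calc _ ≤ ((V : ℝ≥0∞) + 1) ^ 2 * sqNorm 1 β + (4 * (((V : ℝ≥0∞) + 1) ^ 2 * sqNorm 1 β) +
        4 * (((V : ℝ≥0∞) + 1) ^ 2 * sqNorm 1 β)) := by
        gcongr <;> exact h1 _
    _ = _ := by ring

theorem IsBoundedField.sqNorm_one_advSeq_le {V : ℝ≥0} {q : Torus → Fin 2 → ℝ}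
    (hq : IsBoundedField V q) {α : Freq → ℂ} (hα : sqNorm 2 α < ∞) :
    sqNorm 1 (advSeq q α) ≤ 36 * ((V : ℝ≥0∞) + 1) ^ 2 * sqNorm 2 α := by
  have hd : ∀ i, sqNorm 1 (derivSeq i α) ≤ sqNorm 2 α := fun i => by
    have := sqNorm_derivSeq_le 1 i α
    norm_num at this
    exact this
  have h : ∀ i, sqNorm 1 (conv (fieldSeq q i) (derivSeq i α)) ≤
      9 * ((V : ℝ≥0∞) + 1) ^ 2 * sqNorm 2 α := fun i => by
    refine (hq.sqNorm_one_conv_le i ((hd i).trans_lt hα)).trans ?_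
    gcongr
    exact hd i
  rw [advSeq, Fin.sum_univ_two]
  refine (sqNorm_add_le _ _ _).trans ?_
  calc _ ≤ 2 * (9 * ((V : ℝ≥0∞) + 1) ^ 2 * sqNorm 2 α +
        9 * ((V : ℝ≥0∞) + 1) ^ 2 * sqNorm 2 α) := by gcongr <;> exact h _
    _ = _ := by ring

/-! ### The full forcing -/

/-- The Fourier coefficients of `Δ (a u³ + b u² + c u) - q·∇u` in terms of those of `u`. -/
def forceSeq (a b c : ℝ) (q : Torus → Fin 2 → ℝ) (α : Freq → ℂ) : Freq → ℂ :=
  chemSeq a b c α - advSeq q α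

theorem exists_forceSeq_lipschitz (a b c : ℝ) (V : ℝ≥0) {M : ℝ≥0∞} (hM : M ≠ ∞) :
    ∃ L : ℝ≥0∞, L ≠ ∞ ∧ ∀ q, IsBoundedField V q → ∀ α β : Freq → ℂ, sqNorm 2 α ≤ M →
      sqNorm 2 β ≤ M →
      sqNorm 0 (forceSeq a b c q α - forceSeq a b c q β) ≤ L * sqNorm 2 (α - β) := by
  obtain ⟨L, hL, h⟩ := exists_cubicSeq_lipschitz a b c hM
  refine ⟨2 * (L + 4 * (V : ℝ≥0∞) ^ 2), by finiteness, fun q hq α β hα hβ => ?_⟩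
  have fα : sqNorm 2 α < ∞ := hα.trans_lt hM.lt_top
  have fβ : sqNorm 2 β < ∞ := hβ.trans_lt hM.lt_top
  have fδ : sqNorm 2 (α - β) < ∞ := (sqNorm_sub_le 2 α β).trans_lt (by finiteness)
  have e : forceSeq a b c q α - forceSeq a b c q β =
      (chemSeq a b c α - chemSeq a b c β) - advSeq q (α - β) := by
    rw [hq.advSeq_sub fα fβ, forceSeq, forceSeq]
    abel
  rw [e]
  refine (sqNorm_sub_le _ _ _).trans ?_
  calc _ ≤ 2 * (L * sqNorm 2 (α - β) + 4 * (V : ℝ≥0∞) ^ 2 * sqNorm 2 (α - β)) := by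
        gcongr
        · exact (sqNorm_chemSeq_sub_le a b c α β).trans (h α β hα hβ)
        · exact hq.sqNorm_advSeq_le fδ
    _ = _ := by ring

/-- The two parts are also bounded separately, since the integral equation asks for the
integrability of each of its two integrals. -/
theorem exists_forceSeq_bound (a b c : ℝ) (V : ℝ≥0) {M : ℝ≥0∞} (hM : M ≠ ∞) :
    ∃ B : ℝ≥0∞, B ≠ ∞ ∧ ∀ q, IsBoundedField V q → ∀ α : Freq → ℂ, sqNorm 2 α ≤ M →
      sqNorm 0 (chemSeq a b c α) ≤ B ∧ sqNorm 0 (advSeq q α) ≤ B ∧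
        sqNorm 0 (forceSeq a b c q α) ≤ B := by
  obtain ⟨L, hL, h⟩ := exists_cubicSeq_bound a b c hM
  have hN : 4 * (V : ℝ≥0∞) ^ 2 * M ≠ ∞ := by finiteness
  refine ⟨2 * (L + 4 * (V : ℝ≥0∞) ^ 2 * M), by finiteness, fun q hq α hα => ?_⟩
  have h1 : sqNorm 0 (chemSeq a b c α) ≤ L := by
    refine (sqNorm_chemSeq_le 0 a b c α).trans ?_
    rw [zero_add]
    exact h α hα
  have h2 : sqNorm 0 (advSeq q α) ≤ 4 * (V : ℝ≥0∞) ^ 2 * M :=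
    (hq.sqNorm_advSeq_le (hα.trans_lt hM.lt_top)).trans (by gcongr)
  have h3 : ∀ x : ℝ≥0∞, x ≤ 2 * x := fun x => by rw [two_mul]; exact le_self_add
  exact ⟨h1.trans (le_self_add.trans (h3 _)), h2.trans (le_add_self.trans (h3 _)),
    (sqNorm_sub_le _ _ _).trans (by gcongr)⟩

/-- Linear in the `H³` norm, so the rate `t^{-1/4}` of `u` in `H³` passes unchanged to the forcing
in `H¹`. -/
theorem exists_forceSeq_tame (a b c : ℝ) (V : ℝ≥0) {M : ℝ≥0∞} (hM : M ≠ ∞) :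
    ∃ C : ℝ≥0∞, C ≠ ∞ ∧ ∀ q, IsBoundedField V q → ∀ α : Freq → ℂ, sqNorm 2 α ≤ M →
      sqNorm 1 (forceSeq a b c q α) ≤ C * sqNorm 3 α := by
  obtain ⟨L, hL, h⟩ := exists_cubicSeq_tame a b c hM
  refine ⟨2 * (L + 36 * ((V : ℝ≥0∞) + 1) ^ 2), by finiteness, fun q hq α hα => ?_⟩
  refine (sqNorm_sub_le _ _ _).trans ?_
  calc _ ≤ 2 * (L * sqNorm 3 α + 36 * ((V : ℝ≥0∞) + 1) ^ 2 * sqNorm 3 α) := by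
        gcongr
        · have h1 := sqNorm_chemSeq_le 1 a b c α
          rw [show (1 : ℝ) + 2 = 3 by norm_num] at h1
          exact h1.trans (h α hα)
        · refine (hq.sqNorm_one_advSeq_le (hα.trans_lt hM.lt_top)).trans ?_
          gcongr
          exact sqNorm_mono (by norm_num) α
    _ = _ := by ring

/-! ### Measurability of the forcing -/

section Measurability

variable {μ : Measure ℝ}

theorem aestronglyMeasurable_conv {a b : ℝ → Freq → ℂ}
    (ha : ∀ k, AEStronglyMeasurable (fun s => a s k) μ)
    (hb : ∀ k, AEStronglyMeasurable (fun s => b s k) μ) (ha0 : ∀ᵐ s ∂μ, sqNorm 0 (a s) < ∞)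
    (hb0 : ∀ᵐ s ∂μ, sqNorm 0 (b s) < ∞) (k : Freq) :
    AEStronglyMeasurable (fun s => conv (a s) (b s) k) μ := by
  refine aestronglyMeasurable_of_tendsto_ae (atTop : Filter (Finset Freq))
    (f := fun S s => ∑ l ∈ S, a s (k - l) * b s l)
    (fun S => Finset.aestronglyMeasurable_fun_sum S fun l _ => (ha _).mul (hb l)) ?_
  filter_upwards [ha0, hb0] with s h1 h2
  exact (summable_conv h1 h2 k).hasSum

theorem aestronglyMeasurable_chemSeq (a b c : ℝ) {α : ℝ → Freq → ℂ}
    (hα : ∀ k, AEStronglyMeasurable (fun s => α s k) μ) (hα2 : ∀ᵐ s ∂μ, sqNorm 2 (α s) < ∞)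
    (k : Freq) : AEStronglyMeasurable (fun s => chemSeq a b c (α s) k) μ := by
  have h0 : ∀ᵐ s ∂μ, sqNorm 0 (α s) < ∞ :=
    hα2.mono fun s hs => sqNorm_lt_top_of_le (by norm_num) hs
  have h1 : ∀ᵐ s ∂μ, sqNorm 0 (conv (α s) (α s)) < ∞ :=
    hα2.mono fun s hs => sqNorm_lt_top_of_le (by norm_num) (sqNorm_two_conv_lt_top hs hs)
  have m2 := fun k => aestronglyMeasurable_conv hα hα h0 h0 k
  have m3 := aestronglyMeasurable_conv (b := fun s => conv (α s) (α s)) hα m2 h0 h1 k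
  have e : ∀ s, chemSeq a b c (α s) k = -(freqSq k : ℂ) *
      ((a : ℂ) * conv (α s) (conv (α s) (α s)) k + (b : ℂ) * conv (α s) (α s) k +
        (c : ℂ) * α s k) := fun s => rfl
  simp only [e]
  exact (((m3.const_mul (a : ℂ)).add ((m2 k).const_mul (b : ℂ))).add
    ((hα k).const_mul (c : ℂ))).const_mul _

theorem aestronglyMeasurable_fieldSeq {v : ℝ → Torus → Fin 2 → ℝ} (hv : IsDivFreeFlow v) (T : ℝ)
    (i : Fin 2) (k : Freq) :
    AEStronglyMeasurable (fun s => fieldSeq (v s) i k) (volume.restrict (Set.Ioc 0 T)) := by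
  have h1 : AEStronglyMeasurable
      (fun p : ℝ × Torus => mFourier (-k) p.2 • (v p.1 p.2 i : ℂ))
      ((volume.restrict (Set.Ici 0)).prod volume) := by
    refine AEStronglyMeasurable.smul
      ((mFourier (-k)).continuous.comp continuous_snd).aestronglyMeasurable ?_
    exact (Complex.continuous_ofReal.comp (continuous_apply i)).comp_aestronglyMeasurable
      hv.aestronglyMeasurable
  -- A coefficient is an integral over the torus of a jointly measurable function of `(s, x)`.
  exact h1.integral_prod_right'.mono_measure
    (Measure.restrict_mono (fun _ hx => hx.1.le) le_rfl)

theorem aestronglyMeasurable_advSeq {v : ℝ → Torus → Fin 2 → ℝ} (hv : IsDivFreeFlow v) {V : ℝ≥0}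
    {T : ℝ} (hV : ∀ᵐ t ∂(volume.restrict (Set.Ioc 0 T)), IsBoundedField V (v t))
    {α : ℝ → Freq → ℂ}
    (hα : ∀ k, AEStronglyMeasurable (fun s => α s k) (volume.restrict (Set.Ioc 0 T)))
    (hα2 : ∀ᵐ s ∂(volume.restrict (Set.Ioc 0 T)), sqNorm 2 (α s) < ∞) (k : Freq) :
    AEStronglyMeasurable (fun s => advSeq (v s) (α s) k) (volume.restrict (Set.Ioc 0 T)) := by
  simp only [advSeq, Finset.sum_apply]
  refine Finset.aestronglyMeasurable_fun_sum _ fun i _ => ?_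
  exact aestronglyMeasurable_conv (aestronglyMeasurable_fieldSeq hv T i)
    (fun l => (hα l).const_mul _) (hV.mono fun s hs => hs.sqNorm_fieldSeq_lt_top i)
    (hα2.mono fun s hs => sqNorm_derivSeq_lt_top i hs) k

end Measurability

/-! ### The forcing of real-valued functions -/

theorem IsHermitianSeq.conv {a b : Freq → ℂ} (ha : IsHermitianSeq a) (hb : IsHermitianSeq b) :
    IsHermitianSeq (conv a b) := fun k => by
  rw [CahnHilliard.conv, CahnHilliard.conv, Complex.conj_tsum, ← (Equiv.neg Freq).tsum_eq]
  refine tsum_congr fun l => ?_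
  rw [map_mul, ← ha, ← hb, Equiv.neg_apply]
  congr 2
  abel

theorem IsHermitianSeq.add {a b : Freq → ℂ} (ha : IsHermitianSeq a) (hb : IsHermitianSeq b) :
    IsHermitianSeq (a + b) := fun k => by
  rw [Pi.add_apply, Pi.add_apply, map_add, ha, hb]

theorem IsHermitianSeq.sub {a b : Freq → ℂ} (ha : IsHermitianSeq a) (hb : IsHermitianSeq b) :
    IsHermitianSeq (a - b) := fun k => by
  rw [Pi.sub_apply, Pi.sub_apply, map_sub, ha, hb]

theorem IsHermitianSeq.real_smul {a : Freq → ℂ} (ha : IsHermitianSeq a) (r : ℝ) :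
    IsHermitianSeq ((r : ℂ) • a) := fun k => by
  rw [Pi.smul_apply, Pi.smul_apply, smul_eq_mul, smul_eq_mul, map_mul, ha, Complex.conj_ofReal]

/-- Multiplication by a real even symbol. -/
theorem IsHermitianSeq.mul_even {a : Freq → ℂ} (ha : IsHermitianSeq a) {m : Freq → ℝ}
    (hm : ∀ k, m (-k) = m k) : IsHermitianSeq fun k => (m k : ℂ) * a k := fun k => by
  beta_reduce
  rw [map_mul, ha, hm, Complex.conj_ofReal]

theorem IsHermitianSeq.derivSeq {a : Freq → ℂ} (ha : IsHermitianSeq a) (j : Fin 2) :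
    IsHermitianSeq (derivSeq j a) := fun k => by
  rw [CahnHilliard.derivSeq, CahnHilliard.derivSeq, map_mul, ha]
  congr 1
  simp only [map_mul, Complex.conj_ofReal, Complex.conj_I, Pi.neg_apply, Int.cast_neg, map_ofNat,
    map_intCast]
  ring

theorem IsHermitianSeq.forceSeq {α : Freq → ℂ} (hα : IsHermitianSeq α) (a b c : ℝ)
    (q : Torus → Fin 2 → ℝ) : IsHermitianSeq (forceSeq a b c q α) := by
  have h2 := hα.conv hα
  have h3 := hα.conv h2
  have hc : IsHermitianSeq (cubicSeq a b c α) :=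
    ((h3.real_smul a).add (h2.real_smul b)).add (hα.real_smul c)
  have h4 := hc.mul_even (m := fun k => -freqSq k) fun k => by rw [freqSq_neg]
  simp only [Complex.ofReal_neg] at h4
  refine IsHermitianSeq.sub h4 ?_
  rw [advSeq, Fin.sum_univ_two]
  have hf : ∀ i, IsHermitianSeq (fieldSeq q i) := fun i =>
    isHermitianSeq_of_real (Eventually.of_forall fun x => Complex.ofReal_im _)
  exact ((hf 0).conv (hα.derivSeq 0)).add ((hf 1).conv (hα.derivSeq 1))

theorem heat_neg (ε τ : ℝ) (k : Freq) : heat ε τ (-k) = heat ε τ k := by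
  rw [heat, heat, freqSq_neg]

theorem isHermitianSeq_mildSeq (ε : ℝ) {α : Freq → ℂ} {φ : ℝ → Freq → ℂ} {t : ℝ}
    (hα : IsHermitianSeq α) (hφ : ∀ s ∈ Set.Ioc 0 t, IsHermitianSeq (φ s)) :
    IsHermitianSeq (mildSeq ε α φ t) := by
  refine IsHermitianSeq.add (hα.mul_even (heat_neg ε t)) fun k => ?_
  rw [duhamelSeq, duhamelSeq, ← integral_conj]
  refine setIntegral_congr_fun measurableSet_Ioc fun s hs => ?_
  exact (hφ s hs).mul_even (heat_neg ε (t - s)) k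

/-! ### The isometry between `H²` and `L²` -/

/-- The function `(I - Δ) u`, for `u` with Fourier coefficients `α`. -/
def bessel (α : Freq → ℂ) : L2 := fourierInv fun k => ((1 + freqSq k : ℝ) : ℂ) * α k

/-- The Fourier coefficients of `(I - Δ)⁻¹ f`. -/
def resolventSeq (f : L2) (k : Freq) : ℂ := ((1 + freqSq k : ℝ) : ℂ)⁻¹ * mFourierCoeff f k

theorem enorm_weight_sq (k : Freq) : ‖((1 + freqSq k : ℝ) : ℂ)‖ₑ ^ 2 = wt 2 k := by
  rw [← ofReal_norm, Complex.norm_real, Real.norm_of_nonneg (weight_pos k).le,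
    ← ENNReal.ofReal_pow (weight_pos k).le, wt, Real.rpow_ofNat]

theorem weight_ne_zero (k : Freq) : ((1 + freqSq k : ℝ) : ℂ) ≠ 0 :=
  Complex.ofReal_ne_zero.mpr (weight_pos k).ne'

theorem sqNorm_zero_weight_mul (α : Freq → ℂ) :
    sqNorm 0 (fun k => ((1 + freqSq k : ℝ) : ℂ) * α k) = sqNorm 2 α := by
  rw [sqNorm_zero_eq]
  refine tsum_congr fun k => ?_
  rw [enorm_mul, mul_pow, enorm_weight_sq]

theorem mFourierCoeff_bessel {α : Freq → ℂ} (hα : sqNorm 2 α < ∞) :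
    mFourierCoeff (bessel α) = fun k => ((1 + freqSq k : ℝ) : ℂ) * α k :=
  mFourierCoeff_fourierInv ((sqNorm_zero_weight_mul α).trans_lt hα)

/-- The isometry through which continuity into `H²` becomes continuity into `L²`, so that
compactness and completeness can be used in spaces of continuous `L²`-valued paths. -/
theorem enorm_bessel_sq {α : Freq → ℂ} (hα : sqNorm 2 α < ∞) :
    ‖bessel α‖ₑ ^ 2 = sqNorm 2 α := by
  rw [← sqNorm_zero_mFourierCoeff, mFourierCoeff_bessel hα, sqNorm_zero_weight_mul]

theorem sqNorm_two_sub_lt_top {α β : Freq → ℂ} (hα : sqNorm 2 α < ∞) (hβ : sqNorm 2 β < ∞) :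
    sqNorm 2 (α - β) < ∞ :=
  (sqNorm_sub_le 2 α β).trans_lt (by finiteness)

theorem bessel_sub {α β : Freq → ℂ} (hα : sqNorm 2 α < ∞) (hβ : sqNorm 2 β < ∞) :
    bessel (α - β) = bessel α - bessel β := by
  apply L2_ext
  rw [mFourierCoeff_L2_sub, mFourierCoeff_bessel hα, mFourierCoeff_bessel hβ,
    mFourierCoeff_bessel (sqNorm_two_sub_lt_top hα hβ)]
  ext k
  simp only [Pi.sub_apply, mul_sub]

theorem bessel_add {α β : Freq → ℂ} (hα : sqNorm 2 α < ∞) (hβ : sqNorm 2 β < ∞) :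
    bessel (α + β) = bessel α + bessel β := by
  apply L2_ext
  rw [mFourierCoeff_L2_add, mFourierCoeff_bessel hα, mFourierCoeff_bessel hβ,
    mFourierCoeff_bessel ((sqNorm_add_le 2 α β).trans_lt (by finiteness))]
  ext k
  simp only [Pi.add_apply, mul_add]

theorem resolventSeq_bessel {α : Freq → ℂ} (hα : sqNorm 2 α < ∞) :
    resolventSeq (bessel α) = α := by
  ext k
  rw [resolventSeq, mFourierCoeff_bessel hα, inv_mul_cancel_left₀ (weight_ne_zero k)]

theorem sqNorm_resolventSeq (f : L2) : sqNorm 2 (resolventSeq f) = ‖f‖ₑ ^ 2 := by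
  rw [← sqNorm_zero_weight_mul, ← sqNorm_zero_mFourierCoeff]
  congr 1
  ext k
  rw [resolventSeq, mul_inv_cancel_left₀ (weight_ne_zero k)]

theorem resolventSeq_sub (f g : L2) :
    resolventSeq (f - g) = resolventSeq f - resolventSeq g := by
  ext k
  rw [resolventSeq, mFourierCoeff_L2_sub]
  simp only [Pi.sub_apply, mul_sub, resolventSeq]

theorem sqNorm_resolventSeq_lt_top (f : L2) : sqNorm 2 (resolventSeq f) < ∞ := by
  rw [sqNorm_resolventSeq]
  finiteness

theorem isHermitianSeq_resolventSeq {f : L2} (hf : IsRealValued f) :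
    IsHermitianSeq (resolventSeq f) := by
  have := (isRealValued_iff.mp hf).mul_even (m := fun k => (1 + freqSq k)⁻¹)
    fun k => by rw [freqSq_neg]
  simp only [Complex.ofReal_inv] at this
  exact this

theorem isRealValued_bessel {α : Freq → ℂ} (hα : sqNorm 2 α < ∞) (h : IsHermitianSeq α) :
    IsRealValued (bessel α) := by
  rw [isRealValued_iff, mFourierCoeff_bessel hα]
  exact h.mul_even (m := fun k => 1 + freqSq k) fun k => by rw [freqSq_neg]

/-! ### Continuity with values in `H²` -/

theorem InCH2.sqNorm_lt_top {T : ℝ} {u : ℝ → L2} (hu : InCH2 T u) {t : ℝ}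
    (ht : t ∈ Set.Icc 0 T) : sqNorm 2 (mFourierCoeff (u t)) < ∞ :=
  sobolevNorm_lt_top_iff.mp (hu t ht).2.1

theorem InCH2.continuousOn_bessel {T : ℝ} {u : ℝ → L2} (hu : InCH2 T u) :
    ContinuousOn (fun t => bessel (mFourierCoeff (u t))) (Set.Icc 0 T) := by
  intro t ht
  rw [ContinuousWithinAt, tendsto_iff_edist_tendsto_0]
  refine (hu t ht).2.2.congr' ?_
  filter_upwards [self_mem_nhdsWithin] with s hs
  rw [edist_eq_enorm_sub, ← bessel_sub (hu.sqNorm_lt_top hs) (hu.sqNorm_lt_top ht),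
    ← mFourierCoeff_L2_sub]
  have h : sqNorm 2 (mFourierCoeff (u s - u t : L2)) < ∞ := by
    rw [mFourierCoeff_L2_sub]
    exact sqNorm_two_sub_lt_top (hu.sqNorm_lt_top hs) (hu.sqNorm_lt_top ht)
  have := enorm_bessel_sq h
  rw [← sobolevNorm_sq] at this
  exact le_antisymm ((ENNReal.pow_le_pow_left_iff two_ne_zero).mp this.ge)
    ((ENNReal.pow_le_pow_left_iff two_ne_zero).mp this.le)

theorem InCH2.continuousOn {T : ℝ} {u : ℝ → L2} (hu : InCH2 T u) :
    ContinuousOn u (Set.Icc 0 T) := by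
  intro t ht
  rw [ContinuousWithinAt, tendsto_iff_edist_tendsto_0]
  refine tendsto_of_tendsto_of_tendsto_of_le_of_le tendsto_const_nhds (hu t ht).2.2
    (fun _ => zero_le) fun s => ?_
  rw [edist_eq_enorm_sub]
  exact enorm_le_sobolevNorm (by norm_num) _

theorem InCH2.exists_bound {T : ℝ} {u : ℝ → L2} (hu : InCH2 T u) :
    ∃ M : ℝ≥0∞, M ≠ ∞ ∧ ∀ t ∈ Set.Icc 0 T, sqNorm 2 (mFourierCoeff (u t)) ≤ M := by
  obtain ⟨C, hC⟩ := isCompact_Icc.exists_bound_of_continuousOn hu.continuousOn_bessel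
  refine ⟨ENNReal.ofReal C ^ 2, by finiteness, fun t ht => ?_⟩
  rw [← enorm_bessel_sq (hu.sqNorm_lt_top ht), ← ofReal_norm]
  gcongr
  exact hC t ht

theorem InCH2.aestronglyMeasurable {T : ℝ} {u : ℝ → L2} (hu : InCH2 T u) :
    AEStronglyMeasurable u (volume.restrict (Set.Ioc 0 T)) :=
  (hu.continuousOn.mono Set.Ioc_subset_Icc_self).aestronglyMeasurable measurableSet_Ioc

/-! ### The integral equation on the Fourier side -/

theorem mFourierCoeff_biLaplaceSemigroup {ε τ : ℝ} (hε : 0 < ε) (hτ : 0 ≤ τ) {f : Torus → ℂ}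
    (hf : sqNorm 0 (mFourierCoeff f) < ∞) :
    mFourierCoeff (biLaplaceSemigroup (τ * ε) f) = semiSeq ε τ (mFourierCoeff f) :=
  mFourierCoeff_fourierInv (a := semiSeq ε τ (mFourierCoeff f))
    ((sqNorm_semiSeq_le hε hτ 0 _).trans_lt hf)

/-- From a bounded forcing in `L²` the semigroup gains two derivatives at the integrable cost
`(t-s)^{-1/2}`, whence Bochner integrability in `H²`. Coefficients are continuous functionals and
commute with the integral. -/
theorem h2Integrable_of_mFourierCoeff {ε t : ℝ} (hε : 0 < ε) (ht : t ∈ Set.Icc (0 : ℝ) 1)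
    {G : ℝ → L2} {φ : ℝ → Freq → ℂ} {B : ℝ≥0∞} (hB : B ≠ ∞)
    (hφ : ∀ k, AEStronglyMeasurable (fun s => φ s k) (volume.restrict (Set.Ioc 0 t)))
    (hG : ∀ᵐ s ∂(volume.restrict (Set.Ioc 0 t)),
      mFourierCoeff (G s) = semiSeq ε (t - s) (φ s) ∧ sqNorm 0 (φ s) ≤ B) :
    H2Integrable t G ∧
      mFourierCoeff (∫ s in Set.Ioc 0 t, G s : L2) = duhamelSeq ε φ t := by
  have hH : H2Integrable t G := by
    refine ⟨aestronglyMeasurable_of_mFourierCoeff fun k => ?_, ?_⟩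
    · have h1 : AEStronglyMeasurable (fun s => (heat ε (t - s) k : ℂ) * φ s k)
          (volume.restrict (Set.Ioc 0 t)) := by
        refine AEStronglyMeasurable.mul ?_ (hφ k)
        exact (Complex.continuous_ofReal.comp ((continuous_heat ε k).comp
          (continuous_const.sub continuous_id))).aestronglyMeasurable
      refine h1.congr ?_
      filter_upwards [hG] with s hs
      rw [hs.1]
      rfl
    · set C := smoothConst ε 1
      have hle : ∀ᵐ s ∂(volume.restrict (Set.Ioc 0 t)), sobolevNorm 2 (G s) ≤
          C * B ^ (1 / 2 : ℝ) * ENNReal.ofReal ((t - s) ^ (-(1 / 2) : ℝ)) := by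
        have hne : ∀ᵐ s ∂(volume.restrict (Set.Ioc 0 t)), s ≠ t :=
          ae_restrict_of_ae (by simp [ae_iff])
        filter_upwards [hG, hne, ae_restrict_mem measurableSet_Ioc] with s hs hst hs'
        rw [sobolevNorm_le_iff, hs.1]
        have h1 := sqNorm_semiSeq_smoothing hε (τ := t - s)
          (sub_pos.mpr (lt_of_le_of_ne hs'.2 hst)) (by linarith [hs'.1, ht.2]) (σ := 1)
          (by norm_num) (by norm_num) 0 (φ s)
        rw [show (0 : ℝ) + 2 * 1 = 2 by norm_num] at h1
        have hsq : (B ^ (1 / 2 : ℝ)) ^ 2 = B := by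
          rw [← ENNReal.rpow_natCast, ← ENNReal.rpow_mul]
          norm_num
        calc _ ≤ (C * ENNReal.ofReal ((t - s) ^ (-(1 / 2) : ℝ))) ^ 2 * B :=
              h1.trans (mul_le_mul_right hs.2 _)
          _ = _ := by
              rw [mul_pow, mul_pow, mul_pow, hsq]
              ring
      refine (lintegral_mono_ae hle).trans_lt ?_
      rw [lintegral_const_mul _ (by fun_prop), lintegral_sub_rpow_Ioc (by norm_num) ht.1]
      have hC : C ≠ ∞ := ENNReal.ofReal_ne_top
      have hB' : B ^ (1 / 2 : ℝ) ≠ ∞ := ENNReal.rpow_ne_top_of_nonneg (by norm_num) hB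
      finiteness
  refine ⟨hH, ?_⟩
  ext k
  rw [mFourierCoeff_integral hH.integrable, duhamelSeq]
  refine integral_congr_ae ?_
  filter_upwards [hG] with s hs
  rw [hs.1]
  rfl

theorem integrable_heat_mul {ε t : ℝ} {φ : ℝ → Freq → ℂ}
    (hφ : ∀ k, AEStronglyMeasurable (fun s => φ s k) (volume.restrict (Set.Ioc 0 t)))
    (hφ2 : ∫⁻ s in Set.Ioc 0 t, sqNorm 0 (φ s) < ∞) (k : Freq) :
    IntegrableOn (fun s => (heat ε (t - s) k : ℂ) * φ s k) (Set.Ioc 0 t) := by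
  have h1 := (integrableOn_Icc_iff_integrableOn_Ioc).mpr (integrableOn_of_sqNorm hφ hφ2 k)
  refine (IntegrableOn.continuousOn_mul ?_ h1 isCompact_Icc).mono_set Set.Ioc_subset_Icc_self
  exact (Complex.continuous_ofReal.comp ((continuous_heat ε k).comp
    (continuous_const.sub continuous_id))).continuousOn

theorem lintegral_sqNorm_lt_top_of_bound {t : ℝ} {φ : ℝ → Freq → ℂ} {B : ℝ≥0∞} (hB : B ≠ ∞)
    (h : ∀ᵐ s ∂(volume.restrict (Set.Ioc 0 t)), sqNorm 0 (φ s) ≤ B) :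
    ∫⁻ s in Set.Ioc 0 t, sqNorm 0 (φ s) < ∞ := by
  refine (lintegral_mono_ae h).trans_lt ?_
  rw [lintegral_const]
  exact ENNReal.mul_lt_top hB.lt_top (by simp)

theorem duhamelSeq_sub {ε t : ℝ} {φ ψ : ℝ → Freq → ℂ}
    (hφ : ∀ k, AEStronglyMeasurable (fun s => φ s k) (volume.restrict (Set.Ioc 0 t)))
    (hψ : ∀ k, AEStronglyMeasurable (fun s => ψ s k) (volume.restrict (Set.Ioc 0 t)))
    (hφ2 : ∫⁻ s in Set.Ioc 0 t, sqNorm 0 (φ s) < ∞)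
    (hψ2 : ∫⁻ s in Set.Ioc 0 t, sqNorm 0 (ψ s) < ∞) :
    duhamelSeq ε (fun s => φ s - ψ s) t = duhamelSeq ε φ t - duhamelSeq ε ψ t := by
  ext k
  rw [Pi.sub_apply, duhamelSeq, duhamelSeq, duhamelSeq,
    ← integral_sub (integrable_heat_mul hφ hφ2 k) (integrable_heat_mul hψ hψ2 k)]
  simp only [Pi.sub_apply, mul_sub]

section Flow

variable {ε a b c T : ℝ} {v : ℝ → Torus → Fin 2 → ℝ} {V : ℝ≥0} {α : ℝ → Freq → ℂ}

theorem aestronglyMeasurable_forceSeq (hv : IsDivFreeFlow v)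
    (hV : ∀ᵐ t ∂(volume.restrict (Set.Ioc 0 T)), IsBoundedField V (v t))
    (hα : ∀ k, AEStronglyMeasurable (fun s => α s k) (volume.restrict (Set.Ioc 0 T)))
    (hα2 : ∀ s ∈ Set.Ioc 0 T, sqNorm 2 (α s) < ∞) (k : Freq) :
    AEStronglyMeasurable (fun s => forceSeq a b c (v s) (α s) k)
      (volume.restrict (Set.Ioc 0 T)) := by
  have h2 : ∀ᵐ s ∂(volume.restrict (Set.Ioc 0 T)), sqNorm 2 (α s) < ∞ :=
    (ae_restrict_mem measurableSet_Ioc).mono hα2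
  exact (aestronglyMeasurable_chemSeq a b c hα h2 k).sub
    (aestronglyMeasurable_advSeq hv hV hα h2 k)

/-- For functions in `C([0,T]; H²)`, the integral equation is an equation between Fourier
coefficients, and its integrability requirements hold automatically. -/
theorem InCH2.solvesDuhamel_iff {u : ℝ → L2} (hu : InCH2 T u) (hε : 0 < ε) (hT : T ≤ 1)
    (hv : IsDivFreeFlow v)
    (hV : ∀ᵐ t ∂(volume.restrict (Set.Ici (0 : ℝ))), IsBoundedField V (v t)) (u₀ : L2) :
    SolvesDuhamel ε a b c v u₀ T u ↔ ∀ t ∈ Set.Icc 0 T, mFourierCoeff (u t) =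
      mildSeq ε (mFourierCoeff u₀) (fun s => forceSeq a b c (v s) (mFourierCoeff (u s))) t := by
  obtain ⟨M, hM, huM⟩ := hu.exists_bound
  obtain ⟨B, hB, hFB⟩ := exists_forceSeq_bound a b c V hM
  have key : ∀ t ∈ Set.Icc 0 T, H2Integrable t (nonlinearIntegrand ε a b c u t) ∧
      H2Integrable t (advectionIntegrand ε v u t) ∧
      mFourierCoeff (biLaplaceSemigroup (t * ε) u₀
        + (∫ s in Set.Ioc 0 t, nonlinearIntegrand ε a b c u t s)
        - ∫ s in Set.Ioc 0 t, advectionIntegrand ε v u t s : L2) =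
      mildSeq ε (mFourierCoeff u₀)
        (fun s => forceSeq a b c (v s) (mFourierCoeff (u s))) t := by
    intro t ht
    have hVt := isBoundedField_ae_Ioc hV t
    have hmem : ∀ s ∈ Set.Ioc 0 t, s ∈ Set.Icc 0 T := fun s hs => ⟨hs.1.le, hs.2.trans ht.2⟩
    have hmeas : ∀ k, AEStronglyMeasurable (fun s => mFourierCoeff (u s) k)
        (volume.restrict (Set.Ioc 0 t)) := fun k =>
      aestronglyMeasurable_mono_Ioc (aestronglyMeasurable_mFourierCoeff hu.aestronglyMeasurable k)
        ht.2
    have h2 : ∀ᵐ s ∂(volume.restrict (Set.Ioc 0 t)), sqNorm 2 (mFourierCoeff (u s)) < ∞ :=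
      (ae_restrict_mem measurableSet_Ioc).mono fun s hs => hu.sqNorm_lt_top (hmem s hs)
    have mN := aestronglyMeasurable_chemSeq a b c hmeas h2
    have mA := aestronglyMeasurable_advSeq hv hVt hmeas h2
    have bN : ∀ᵐ s ∂(volume.restrict (Set.Ioc 0 t)),
        sqNorm 0 (chemSeq a b c (mFourierCoeff (u s))) ≤ B := by
      filter_upwards [hVt, ae_restrict_mem measurableSet_Ioc] with s hs hs'
      exact (hFB _ hs _ (huM s (hmem s hs'))).1
    have bA : ∀ᵐ s ∂(volume.restrict (Set.Ioc 0 t)),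
        sqNorm 0 (advSeq (v s) (mFourierCoeff (u s))) ≤ B := by
      filter_upwards [hVt, ae_restrict_mem measurableSet_Ioc] with s hs hs'
      exact (hFB _ hs _ (huM s (hmem s hs'))).2.1
    have ht1 : t ∈ Set.Icc (0 : ℝ) 1 := ⟨ht.1, ht.2.trans hT⟩
    obtain ⟨iN, eN⟩ := h2Integrable_of_mFourierCoeff hε ht1
      (G := nonlinearIntegrand ε a b c u t) hB mN (by
        filter_upwards [bN, ae_restrict_mem measurableSet_Ioc] with s hs hs'
        refine ⟨?_, hs⟩
        have h3 := mFourierCoeff_laplacian_cubic a b c (hu.sqNorm_lt_top (hmem s hs'))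
        rw [nonlinearIntegrand, mFourierCoeff_biLaplaceSemigroup hε (by linarith [hs'.2])
          (sqNorm_mFourierCoeff_lt_top _), h3])
    obtain ⟨iA, eA⟩ := h2Integrable_of_mFourierCoeff hε ht1
      (G := advectionIntegrand ε v u t) hB mA (by
        filter_upwards [bA, hVt, ae_restrict_mem measurableSet_Ioc] with s hs hq hs'
        refine ⟨?_, hs⟩
        have h3 := hq.mFourierCoeff_advection (hu.sqNorm_lt_top (hmem s hs'))
        rw [advectionIntegrand, mFourierCoeff_biLaplaceSemigroup hε (by linarith [hs'.2])
          (h3 ▸ hs.trans_lt hB.lt_top), h3])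
    refine ⟨iN, iA, ?_⟩
    rw [mFourierCoeff_L2_sub, mFourierCoeff_L2_add, eN, eA,
      mFourierCoeff_biLaplaceSemigroup hε ht.1 (sqNorm_mFourierCoeff_lt_top _), add_sub_assoc,
      ← duhamelSeq_sub mN mA (lintegral_sqNorm_lt_top_of_bound hB bN)
        (lintegral_sqNorm_lt_top_of_bound hB bA)]
    rfl
  constructor
  · intro h t ht
    rw [← (key t ht).2.2, ← (h t ht).2.2]
  · intro h t ht
    obtain ⟨h1, h2, h3⟩ := key t ht
    exact ⟨h1, h2, L2_ext ((h t ht).trans h3.symm)⟩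

/-! ### Uniqueness -/

/-- Gronwall for the primitive `f(t) = ∫₀ᵗ y`, which satisfies `f' = y ≤ K f` and `f(0) = 0`. -/
theorem eq_zero_of_le_integral {T K : ℝ} {y : ℝ → ℝ} (hy : ContinuousOn y (Set.Icc 0 T))
    (h0 : ∀ t ∈ Set.Icc 0 T, 0 ≤ y t)
    (h : ∀ t ∈ Set.Icc 0 T, y t ≤ K * ∫ s in (0 : ℝ)..t, y s) :
    ∀ t ∈ Set.Icc 0 T, y t = 0 := by
  intro t ht
  have hT : 0 ≤ T := ht.1.trans ht.2
  have hI : IntervalIntegrable y volume 0 T :=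
    (hy.mono (Set.uIcc_of_le hT).le).intervalIntegrable
  set f : ℝ → ℝ := fun t => ∫ s in (0 : ℝ)..t, y s
  have hcont : ContinuousOn f (Set.Icc 0 T) := by
    have := intervalIntegral.continuousOn_primitive_interval' hI (Set.left_mem_uIcc)
    rwa [Set.uIcc_of_le hT] at this
  have hd : ∀ x ∈ Set.Ico 0 T, HasDerivWithinAt f (y x) (Set.Ici x) x := by
    intro x hx
    have hxI : IntervalIntegrable y volume 0 x :=
      hI.mono_set (by rw [Set.uIcc_of_le hT, Set.uIcc_of_le hx.1]
                      exact Set.Icc_subset_Icc_right hx.2.le)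
    have hcw' : ContinuousWithinAt y (Set.Ioc x T) x :=
      (hy x ⟨hx.1, hx.2.le⟩).mono fun z hz => ⟨hx.1.trans hz.1.le, hz.2⟩
    have hcw : ContinuousWithinAt y (Set.Ioi x) x :=
      hcw'.mono_of_mem_nhdsWithin (Ioc_mem_nhdsGT hx.2)
    have hmeas : StronglyMeasurableAtFilter y (𝓝[Set.Ioi x] x) volume := by
      refine ⟨Set.Ioc x T, Ioc_mem_nhdsGT hx.2, ?_⟩
      exact (hy.mono fun z hz => ⟨hx.1.trans hz.1.le, hz.2⟩).aestronglyMeasurable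
        measurableSet_Ioc
    exact intervalIntegral.integral_hasDerivWithinAt_right hxI hmeas hcw
  have hf0 : ∀ x ∈ Set.Icc 0 T, 0 ≤ f x := fun x hx =>
    intervalIntegral.integral_nonneg hx.1 fun s hs => h0 s ⟨hs.1, hs.2.trans hx.2⟩
  have hg := norm_le_gronwallBound_of_norm_deriv_right_le (δ := 0) (K := K) (ε := 0) hcont hd
    (by simp [f]) (fun x hx => by
      have hx' : x ∈ Set.Icc 0 T := ⟨hx.1, hx.2.le⟩
      rw [Real.norm_of_nonneg (h0 x hx'), Real.norm_of_nonneg (hf0 x hx'), add_zero]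
      exact h x hx') t ht
  rw [gronwallBound_ε0_δ0, norm_le_zero_iff] at hg
  refine le_antisymm ((h t ht).trans_eq ?_) (h0 t ht)
  rw [show ∫ s in (0 : ℝ)..t, y s = 0 from hg, mul_zero]

/-- The data cancel in the difference of two solutions. The energy estimate together with the
Lipschitz bound, on a ball containing both, bounds its squared `H²` norm by a multiple of its time
integral. Continuity into `H²` is the only regularity required. -/
theorem solvesDuhamel_unique (hε : 0 < ε) (hT : T ≤ 1) (hv : IsDivFreeFlow v)
    (hV : ∀ᵐ t ∂(volume.restrict (Set.Ici (0 : ℝ))), IsBoundedField V (v t)) {u₀ : L2}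
    {u w : ℝ → L2} (hu : InCH2 T u) (hw : InCH2 T w) (hus : SolvesDuhamel ε a b c v u₀ T u)
    (hws : SolvesDuhamel ε a b c v u₀ T w) : ∀ t ∈ Set.Icc 0 T, w t = u t := by
  rw [hu.solvesDuhamel_iff hε hT hv hV] at hus
  rw [hw.solvesDuhamel_iff hε hT hv hV] at hws
  obtain ⟨M₁, hM₁, huM⟩ := hu.exists_bound
  obtain ⟨M₂, hM₂, hwM⟩ := hw.exists_bound
  set M := M₁ + M₂
  have hM : M ≠ ∞ := ENNReal.add_ne_top.mpr ⟨hM₁, hM₂⟩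
  replace huM : ∀ t ∈ Set.Icc 0 T, sqNorm 2 (mFourierCoeff (u t)) ≤ M := fun t ht =>
    (huM t ht).trans le_self_add
  replace hwM : ∀ t ∈ Set.Icc 0 T, sqNorm 2 (mFourierCoeff (w t)) ≤ M := fun t ht =>
    (hwM t ht).trans le_add_self
  obtain ⟨L, hL, hFL⟩ := exists_forceSeq_lipschitz a b c V hM
  obtain ⟨B, hB, hFB⟩ := exists_forceSeq_bound a b c V hM
  set y : ℝ → ℝ := fun t => ‖bessel (mFourierCoeff (w t)) - bessel (mFourierCoeff (u t))‖ ^ 2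
  have hy : ContinuousOn y (Set.Icc 0 T) :=
    ((hw.continuousOn_bessel.sub hu.continuousOn_bessel).norm).pow 2
  have hyN : ∀ t ∈ Set.Icc 0 T,
      ENNReal.ofReal (y t) = sqNorm 2 (mFourierCoeff (w t) - mFourierCoeff (u t)) := by
    intro t ht
    have h1 := hw.sqNorm_lt_top ht
    have h2 := hu.sqNorm_lt_top ht
    rw [← enorm_bessel_sq (sqNorm_two_sub_lt_top h1 h2), bessel_sub h1 h2,
      ENNReal.ofReal_pow (norm_nonneg _), ofReal_norm]
  have hy0 : ∀ t, 0 ≤ y t := fun t => sq_nonneg _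
  set K : ℝ≥0∞ := smoothConst ε 2 * L
  have hK : K ≠ ∞ := ENNReal.mul_ne_top ENNReal.ofReal_ne_top hL
  have hle : ∀ t ∈ Set.Icc 0 T, y t ≤ K.toReal * ∫ s in (0 : ℝ)..t, y s := by
    intro t ht
    have hVt := isBoundedField_ae_Ioc hV t
    have hmem : ∀ s ∈ Set.Ioc 0 t, s ∈ Set.Icc 0 T := fun s hs => ⟨hs.1.le, hs.2.trans ht.2⟩
    have meas : ∀ {z : ℝ → L2}, InCH2 T z → ∀ k, AEStronglyMeasurable
        (fun s => forceSeq a b c (v s) (mFourierCoeff (z s)) k)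
        (volume.restrict (Set.Ioc 0 t)) := fun {z} hz =>
      aestronglyMeasurable_forceSeq hv hVt
        (fun k => aestronglyMeasurable_mono_Ioc
          (aestronglyMeasurable_mFourierCoeff hz.aestronglyMeasurable k) ht.2)
        fun s hs => hz.sqNorm_lt_top (hmem s hs)
    have bd : ∀ {z : ℝ → L2}, (∀ t ∈ Set.Icc 0 T, sqNorm 2 (mFourierCoeff (z t)) ≤ M) →
        ∫⁻ s in Set.Ioc 0 t, sqNorm 0 (forceSeq a b c (v s) (mFourierCoeff (z s))) < ∞ :=
      fun {z} hz => lintegral_sqNorm_lt_top_of_bound hB (by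
        filter_upwards [hVt, ae_restrict_mem measurableSet_Ioc] with s hs hs'
        exact (hFB _ hs _ (hz s (hmem s hs'))).2.2)
    have e : mFourierCoeff (w t) - mFourierCoeff (u t) =
        duhamelSeq ε (fun s => forceSeq a b c (v s) (mFourierCoeff (w s)) -
          forceSeq a b c (v s) (mFourierCoeff (u s))) t := by
      rw [duhamelSeq_sub (meas hw) (meas hu) (bd hwM) (bd huM), hws t ht, hus t ht, mildSeq,
        mildSeq, add_sub_add_left_eq_sub]
    have hyt : ContinuousOn y (Set.Icc 0 t) := hy.mono (Set.Icc_subset_Icc_right ht.2)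
    have hint : ENNReal.ofReal (∫ s in (0 : ℝ)..t, y s) =
        ∫⁻ s in Set.Ioc 0 t, ENNReal.ofReal (y s) := by
      rw [intervalIntegral.integral_of_le ht.1]
      exact ofReal_integral_eq_lintegral_ofReal
        (hyt.integrableOn_Icc.mono_set Set.Ioc_subset_Icc_self) (Eventually.of_forall hy0)
    have h1 : ENNReal.ofReal (y t) ≤ K * ENNReal.ofReal (∫ s in (0 : ℝ)..t, y s) := by
      rw [hyN t ht, e, hint]
      refine (sqNorm_two_duhamelSeq_le hε (ht.2.trans hT)
        fun k => (meas hw k).sub (meas hu k)).trans ?_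
      rw [mul_assoc, ← lintegral_const_mul' _ _ hL]
      refine mul_le_mul_right (lintegral_mono_ae ?_) _
      filter_upwards [hVt, ae_restrict_mem measurableSet_Ioc] with s hs hs'
      rw [hyN s (hmem s hs')]
      exact hFL _ hs _ _ (hwM s (hmem s hs')) (huM s (hmem s hs'))
    rw [← ENNReal.ofReal_toReal hK, ← ENNReal.ofReal_mul ENNReal.toReal_nonneg] at h1
    exact (ENNReal.ofReal_le_ofReal_iff (mul_nonneg ENNReal.toReal_nonneg
      (intervalIntegral.integral_nonneg ht.1 fun s _ => hy0 s))).mp h1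
  intro t ht
  have h0 := eq_zero_of_le_integral hy (fun t _ => hy0 t) hle t ht
  have h1 := hyN t ht
  rw [h0, ENNReal.ofReal_zero] at h1
  exact L2_ext (sub_eq_zero.mp (eq_zero_of_sqNorm_eq_zero h1.symm))

end Flow

/-! ### Square roots, closedness of real-valuedness, and integrals of bounded functions. -/

theorem ennreal_sq_sqrt (x : ℝ≥0∞) : (x ^ (1 / 2 : ℝ)) ^ 2 = x := by
  rw [← ENNReal.rpow_natCast, ← ENNReal.rpow_mul]
  norm_num

theorem ennreal_sqrt_sq (x : ℝ≥0∞) : (x ^ 2) ^ (1 / 2 : ℝ) = x := by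
  rw [← ENNReal.rpow_natCast, ← ENNReal.rpow_mul]
  norm_num

theorem ennreal_sqrt_ne_top {x : ℝ≥0∞} (hx : x ≠ ∞) : x ^ (1 / 2 : ℝ) ≠ ∞ :=
  ENNReal.rpow_ne_top_of_nonneg (by norm_num) hx

theorem ennreal_tendsto_sqrt_zero {ι : Type*} {l : Filter ι} {f : ι → ℝ≥0∞}
    (h : Tendsto f l (𝓝 0)) : Tendsto (fun i => f i ^ (1 / 2 : ℝ)) l (𝓝 0) := by
  have := (ENNReal.continuous_rpow_const (y := (1 / 2 : ℝ))).tendsto 0 |>.comp h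
  simpa [Function.comp_def] using this

theorem continuousOn_bessel {S : Set ℝ} {γ : ℝ → Freq → ℂ} (hγ : ∀ t ∈ S, sqNorm 2 (γ t) < ∞)
    (h : ∀ t ∈ S, Tendsto (fun s => sqNorm 2 (γ s - γ t)) (𝓝[S] t) (𝓝 0)) :
    ContinuousOn (fun t => bessel (γ t)) S := by
  intro t ht
  rw [ContinuousWithinAt, tendsto_iff_edist_tendsto_0]
  refine (ennreal_tendsto_sqrt_zero (h t ht)).congr' ?_
  filter_upwards [self_mem_nhdsWithin] with s hs
  rw [edist_eq_enorm_sub, ← bessel_sub (hγ s hs) (hγ t ht),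
    ← enorm_bessel_sq (sqNorm_two_sub_lt_top (hγ s hs) (hγ t ht)), ennreal_sqrt_sq]

theorem isClosed_isRealValued : IsClosed {f : L2 | IsRealValued f} := by
  simp only [isRealValued_iff, IsHermitianSeq, Set.ofPred_forall]
  exact isClosed_iInter fun k => isClosed_eq (continuous_mFourierCoeff _)
    (Complex.continuous_conj.comp (continuous_mFourierCoeff _))

theorem lintegral_Ioc_le_of_bound {t T : ℝ} (ht : t ≤ T) {f : ℝ → ℝ≥0∞} {B : ℝ≥0∞}
    (h : ∀ᵐ s ∂(volume.restrict (Set.Ioc 0 t)), f s ≤ B) :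
    ∫⁻ s in Set.Ioc 0 t, f s ≤ B * ENNReal.ofReal T := by
  refine (lintegral_mono_ae h).trans ?_
  rw [lintegral_const, Measure.restrict_apply MeasurableSet.univ, Set.univ_inter, Real.volume_Ioc,
    sub_zero]
  gcongr

/-! ### Regularity of solutions -/

section Regularity

variable {ε a b c T : ℝ} {v : ℝ → Torus → Fin 2 → ℝ} {V : ℝ≥0} {u₀ : L2} {u : ℝ → L2}

theorem sqNorm_mildSeq_le (s ε : ℝ) (α : Freq → ℂ) (φ : ℝ → Freq → ℂ) (t : ℝ) :
    sqNorm s (mildSeq ε α φ t) ≤ 2 * (sqNorm s (semiSeq ε t α) + sqNorm s (duhamelSeq ε φ t)) :=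
  sqNorm_add_le _ _ _

theorem weight_mul_homSobolevNorm_le {t r s : ℝ} (ht : 0 < t) (hs : 0 ≤ s) {f : L2} {D : ℝ≥0∞}
    (h : sqNorm s (mFourierCoeff f) ≤ D * ENNReal.ofReal (t ^ (-r)) ^ 2) :
    ENNReal.ofReal (t ^ r) * homSobolevNorm s f ≤ D ^ (1 / 2 : ℝ) := by
  have h1 : sobolevNorm s f ≤ D ^ (1 / 2 : ℝ) * ENNReal.ofReal (t ^ (-r)) := by
    rw [sobolevNorm_le_iff, mul_pow, ennreal_sq_sqrt]
    exact h
  calc _ ≤ ENNReal.ofReal (t ^ r) * (D ^ (1 / 2 : ℝ) * ENNReal.ofReal (t ^ (-r))) := by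
        gcongr
        exact (homSobolevNorm_le hs f).trans h1
    _ = D ^ (1 / 2 : ℝ) * (ENNReal.ofReal (t ^ r) * ENNReal.ofReal (t ^ (-r))) := by ring
    _ = _ := by
        rw [← ENNReal.ofReal_mul (by positivity), ← Real.rpow_add ht, add_neg_cancel,
          Real.rpow_zero, ENNReal.ofReal_one, mul_one]

/-- On `(0,1]` a bounded quantity may be given any singular rate; the regular and singular
contributions then combine under one rate. -/
theorem one_le_ofReal_rpow_sq {t r : ℝ} (ht : 0 < t) (ht1 : t ≤ 1) (hr : 0 ≤ r) :
    1 ≤ ENNReal.ofReal (t ^ (-r)) ^ 2 := by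
  refine one_le_pow₀ ?_
  rw [← ENNReal.ofReal_one]
  exact ENNReal.ofReal_le_ofReal
    (Real.one_le_rpow_of_pos_of_le_one_of_nonpos ht ht1 (by linarith))

/-- Solutions in `C([0,T]; H²)` belong to `L²((0,T]; H⁴)` and to the weighted space `X_T`. -/
theorem InCH2.regularity (hu : InCH2 T u) (hε : 0 < ε) (hT : T ≤ 1) (hv : IsDivFreeFlow v)
    (hV : ∀ᵐ t ∂(volume.restrict (Set.Ici (0 : ℝ))), IsBoundedField V (v t))
    (hu₀ : sqNorm 2 (mFourierCoeff u₀) < ∞)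
    (hsol : ∀ t ∈ Set.Icc 0 T, mFourierCoeff (u t) =
      mildSeq ε (mFourierCoeff u₀) (fun s => forceSeq a b c (v s) (mFourierCoeff (u s))) t) :
    InL2H4 T u ∧ InXT T u := by
  obtain ⟨M, hM, huM⟩ := hu.exists_bound
  obtain ⟨B, hB, hFB⟩ := exists_forceSeq_bound a b c V hM
  obtain ⟨C, hC, hFC⟩ := exists_forceSeq_tame a b c V hM
  set α := mFourierCoeff u₀
  set φ : ℝ → Freq → ℂ := fun s => forceSeq a b c (v s) (mFourierCoeff (u s)) with hφdef
  have hVT := isBoundedField_ae_Ioc hV T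
  have hφ : ∀ k, AEStronglyMeasurable (fun s => φ s k) (volume.restrict (Set.Ioc 0 T)) :=
    aestronglyMeasurable_forceSeq hv hVT
      (aestronglyMeasurable_mFourierCoeff hu.aestronglyMeasurable)
      fun s hs => hu.sqNorm_lt_top ⟨hs.1.le, hs.2⟩
  have hφB : ∀ᵐ s ∂(volume.restrict (Set.Ioc 0 T)), sqNorm 0 (φ s) ≤ B := by
    filter_upwards [hVT, ae_restrict_mem measurableSet_Ioc] with s hs hs'
    exact (hFB _ hs _ (huM s ⟨hs'.1.le, hs'.2⟩)).2.2
  have hφ2 := lintegral_sqNorm_lt_top_of_bound hB hφB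
  have restr : ∀ {t} {p : ℝ → Prop}, t ≤ T → (∀ᵐ s ∂(volume.restrict (Set.Ioc 0 T)), p s) →
      ∀ᵐ s ∂(volume.restrict (Set.Ioc 0 t)), p s := fun ht h =>
    ae_restrict_of_ae_restrict_of_subset (Set.Ioc_subset_Ioc_right ht) h
  have hS : ∀ σ, smoothConst ε σ ≠ ∞ := fun σ => ENNReal.ofReal_ne_top
  set E : ℝ≥0∞ := (smoothConst ε (3 / 2) * ENNReal.ofReal 16) ^ 2
  have hE : E ≠ ∞ := by
    have := hS (3 / 2)
    finiteness
  refine ⟨⟨hu.aestronglyMeasurable, ?_⟩, hu, ?_⟩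
  · have h1 : ∫⁻ t in Set.Ioc 0 T, sobolevNorm 4 (u t) ^ 2 ≤ ∫⁻ t in Set.Ioc 0 T,
        2 * (sqNorm 4 (semiSeq ε t α) + sqNorm 4 (duhamelSeq ε φ t)) := by
      refine setLIntegral_mono' measurableSet_Ioc fun t ht => ?_
      rw [sobolevNorm_sq, hsol t ⟨ht.1.le, ht.2⟩]
      exact sqNorm_mildSeq_le _ _ _ _ _
    have hm : Measurable fun t => sqNorm 4 (semiSeq ε t α) := by
      refine Measurable.tsum fun k => ?_
      simp only [semiSeq, enorm_mul, enorm_heat]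
      exact (((measurable_eheat ε k).mul_const _).pow_const 2).const_mul _
    refine h1.trans_lt ?_
    rw [lintegral_const_mul' _ _ (by norm_num), lintegral_add_left hm]
    have h2 := lintegral_sqNorm_four_semiSeq_le hε hT α
    have h3 := lintegral_sqNorm_four_duhamelSeq_le hε hT hφ hφ2
    have h4 := h2.trans_lt (ENNReal.mul_lt_top (hS 2).lt_top hu₀)
    have h5 := h3.trans_lt (ENNReal.mul_lt_top (ENNReal.pow_lt_top (hS 2).lt_top) hφ2)
    finiteness
  · set D₃ : ℝ≥0∞ := 2 * (smoothConst ε (1 / 2) ^ 2 * sqNorm 2 α + E * B)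
    have hD₃ : D₃ ≠ ∞ := by
      have := hS (1 / 2)
      finiteness
    -- First round: one derivative from the free evolution of `u₀ ∈ H²`, at cost `t^{-1/4}`, and
    -- three from the Duhamel integral of a forcing bounded in `L²`.
    have h3 : ∀ t ∈ Set.Ioc 0 T, sqNorm 3 (mFourierCoeff (u t)) ≤
        D₃ * ENNReal.ofReal (t ^ (-(1 / 4) : ℝ)) ^ 2 := by
      intro t ht
      have ht1 := ht.2.trans hT
      rw [hsol t ⟨ht.1.le, ht.2⟩]
      have hs := sqNorm_semiSeq_smoothing hε ht.1 ht1 (σ := 1 / 2) (by norm_num) (by norm_num) 2 α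
      norm_num only at hs
      have hd := sqNorm_duhamelSeq_smoothing hε ht.1 ht1 0 (B := B)
        (fun k => aestronglyMeasurable_mono_Ioc (hφ k) ht.2) (by
          filter_upwards [restr ht.2 hφB, ae_restrict_mem measurableSet_Ioc] with s hs hs'
          exact hs.trans (le_mul_of_one_le_right zero_le
            (one_le_ofReal_rpow_sq hs'.1 (hs'.2.trans ht1) (by norm_num))))
      rw [zero_add] at hd
      have h1 := one_le_ofReal_rpow_sq (r := 1 / 4) ht.1 ht1 (by norm_num)
      refine (sqNorm_mildSeq_le _ _ _ _ _).trans ?_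
      calc _ ≤ 2 * ((smoothConst ε (1 / 2) * ENNReal.ofReal (t ^ (-(1 / 4) : ℝ))) ^ 2 *
              sqNorm 2 α + E * B * ENNReal.ofReal (t ^ (-(1 / 4) : ℝ)) ^ 2) := by
            gcongr
            exact hd.trans (le_mul_of_one_le_right zero_le h1)
        _ = _ := by ring
    set D₄ : ℝ≥0∞ := 2 * (smoothConst ε 1 ^ 2 * sqNorm 2 α + E * (C * D₃))
    have hD₄ : D₄ ≠ ∞ := by
      have := hS 1
      finiteness
    -- Second round: by `h3` and the tame bound the forcing is in `H¹` with rate `s^{-1/4}`, and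
    -- three more derivatives reach `H⁴`.
    have h4 : ∀ t ∈ Set.Ioc 0 T, sqNorm 4 (mFourierCoeff (u t)) ≤
        D₄ * ENNReal.ofReal (t ^ (-(1 / 2) : ℝ)) ^ 2 := by
      intro t ht
      have ht1 := ht.2.trans hT
      rw [hsol t ⟨ht.1.le, ht.2⟩]
      have hs := sqNorm_semiSeq_smoothing hε ht.1 ht1 (σ := 1) (by norm_num) (by norm_num) 2 α
      norm_num only at hs
      have hd := sqNorm_duhamelSeq_smoothing hε ht.1 ht1 1 (B := C * D₃)
        (fun k => aestronglyMeasurable_mono_Ioc (hφ k) ht.2) (by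
          filter_upwards [restr ht.2 hVT, ae_restrict_mem measurableSet_Ioc] with s hs hs'
          have hsT : s ≤ T := hs'.2.trans ht.2
          refine (hFC _ hs _ (huM s ⟨hs'.1.le, hsT⟩)).trans ?_
          rw [mul_assoc]
          gcongr
          exact h3 s ⟨hs'.1, hsT⟩)
      norm_num only at hd
      have h1 := one_le_ofReal_rpow_sq (r := 1 / 2) ht.1 ht1 (by norm_num)
      refine (sqNorm_mildSeq_le _ _ _ _ _).trans ?_
      calc _ ≤ 2 * ((smoothConst ε 1 * ENNReal.ofReal (t ^ (-(1 / 2) : ℝ))) ^ 2 *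
              sqNorm 2 α + E * (C * D₃) * ENNReal.ofReal (t ^ (-(1 / 2) : ℝ)) ^ 2) := by
            gcongr
            exact hd.trans (le_mul_of_one_le_right zero_le h1)
        _ = _ := by ring
    refine (iSup₂_le fun t ht => ?_).trans_lt (b := D₃ ^ (1 / 2 : ℝ) + D₄ ^ (1 / 2 : ℝ))
      (ENNReal.add_lt_top.mpr
        ⟨(ennreal_sqrt_ne_top hD₃).lt_top, (ennreal_sqrt_ne_top hD₄).lt_top⟩)
    exact add_le_add (weight_mul_homSobolevNorm_le ht.1 (by norm_num) (h3 t ht))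
      (weight_mul_homSobolevNorm_le ht.1 (by norm_num) (h4 t ht))

end Regularity

/-! ### Existence -/

section Existence

variable {ε a b c T : ℝ} {v : ℝ → Torus → Fin 2 → ℝ} {V : ℝ≥0}

/-- The Fourier coefficients at time `s` of the path `(I - Δ)⁻¹ g`, extended constantly in time. -/
def pathSeq (hT : 0 ≤ T) (g : C(Set.Icc 0 T, L2)) (s : ℝ) : Freq → ℂ :=
  resolventSeq (g (Set.projIcc 0 T hT s))

/-- The Fourier coefficients of the forcing along the path `(I - Δ)⁻¹ g`. -/
def pathForce (a b c : ℝ) (v : ℝ → Torus → Fin 2 → ℝ) (hT : 0 ≤ T) (g : C(Set.Icc 0 T, L2))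
    (s : ℝ) : Freq → ℂ :=
  forceSeq a b c (v s) (pathSeq hT g s)

theorem sqNorm_pathSeq_le (hT : 0 ≤ T) (g : C(Set.Icc 0 T, L2)) {ρ : ℝ}
    (hg : ∀ t, ‖g t‖ ≤ ρ) (s : ℝ) : sqNorm 2 (pathSeq hT g s) ≤ ENNReal.ofReal ρ ^ 2 := by
  rw [pathSeq, sqNorm_resolventSeq, ← ofReal_norm]
  gcongr
  exact hg _

theorem aestronglyMeasurable_pathForce (hv : IsDivFreeFlow v)
    (hV : ∀ᵐ t ∂(volume.restrict (Set.Ici (0 : ℝ))), IsBoundedField V (v t)) (hT : 0 ≤ T)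
    (g : C(Set.Icc 0 T, L2)) (k : Freq) :
    AEStronglyMeasurable (fun s => pathForce a b c v hT g s k) (volume.restrict (Set.Ioc 0 T)) := by
  refine aestronglyMeasurable_forceSeq hv (isBoundedField_ae_Ioc hV T) (fun l => ?_)
    (fun s _ => sqNorm_resolventSeq_lt_top _) k
  have : Continuous fun s => mFourierCoeff (g (Set.projIcc 0 T hT s)) l :=
    (continuous_mFourierCoeff l).comp (g.continuous.comp continuous_projIcc)
  exact (this.const_mul _).aestronglyMeasurable

theorem lintegral_pathForce_lt_top
    (hV : ∀ᵐ t ∂(volume.restrict (Set.Ici (0 : ℝ))), IsBoundedField V (v t)) (hT : 0 ≤ T)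
    (g : C(Set.Icc 0 T, L2)) (t : ℝ) :
    ∫⁻ s in Set.Ioc 0 t, sqNorm 0 (pathForce a b c v hT g s) < ∞ := by
  obtain ⟨B, hB, h⟩ := exists_forceSeq_bound a b c V (M := ENNReal.ofReal ‖g‖ ^ 2) (by finiteness)
  refine lintegral_sqNorm_lt_top_of_bound hB ?_
  filter_upwards [isBoundedField_ae_Ioc hV t] with s hs
  exact (h _ hs _ (sqNorm_pathSeq_le hT g g.norm_coe_le_norm s)).2.2

theorem sqNorm_two_mildSeq_pathForce_lt_top (hε : 0 < ε) (hT : 0 ≤ T) (hT1 : T ≤ 1)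
    (hv : IsDivFreeFlow v)
    (hV : ∀ᵐ t ∂(volume.restrict (Set.Ici (0 : ℝ))), IsBoundedField V (v t))
    {α : Freq → ℂ} (hα : sqNorm 2 α < ∞) (g : C(Set.Icc 0 T, L2)) {t : ℝ}
    (ht : t ∈ Set.Icc 0 T) :
    sqNorm 2 (semiSeq ε t α) < ∞ ∧ sqNorm 2 (duhamelSeq ε (pathForce a b c v hT g) t) < ∞ ∧
      sqNorm 2 (mildSeq ε α (pathForce a b c v hT g) t) < ∞ := by
  have h1 := (sqNorm_semiSeq_le hε ht.1 2 α).trans_lt hα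
  have h2 := (sqNorm_two_duhamelSeq_le hε (ht.2.trans hT1) fun k =>
    aestronglyMeasurable_mono_Ioc (aestronglyMeasurable_pathForce (a := a) (b := b) (c := c)
      hv hV hT g k) ht.2).trans_lt
    (ENNReal.mul_lt_top ENNReal.ofReal_lt_top (lintegral_pathForce_lt_top hV hT g t))
  exact ⟨h1, h2, (sqNorm_mildSeq_le _ _ _ _ _).trans_lt (by finiteness)⟩

/-- The map whose fixed points are the solutions, in terms of `g = (I - Δ) u`. -/
def mildMap (hε : 0 < ε) (hT : 0 ≤ T) (hT1 : T ≤ 1) (hv : IsDivFreeFlow v)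
    (hV : ∀ᵐ t ∂(volume.restrict (Set.Ici (0 : ℝ))), IsBoundedField V (v t))
    {α : Freq → ℂ} (hα : sqNorm 2 α < ∞) (a b c : ℝ) (g : C(Set.Icc 0 T, L2)) :
    C(Set.Icc 0 T, L2) where
  toFun t := bessel (mildSeq ε α (pathForce a b c v hT g) t)
  continuous_toFun := by
    have h := continuousOn_bessel (S := Set.Icc 0 T)
      (γ := mildSeq ε α (pathForce a b c v hT g))
      (fun t ht => (sqNorm_two_mildSeq_pathForce_lt_top hε hT hT1 hv hV hα g ht).2.2)
      (fun t ht => tendsto_sqNorm_mildSeq_sub hε hT1 hα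
        (aestronglyMeasurable_pathForce hv hV hT g) (lintegral_pathForce_lt_top hV hT g T) ht)
    exact continuousOn_iff_continuous_domRestrict.mp h

theorem exists_pos_time {X : ℝ≥0∞} (hX : X ≠ ∞) :
    ∃ T : ℝ, 0 < T ∧ T ≤ 1 ∧ X * ENNReal.ofReal T ≤ (1 / 2) ^ 2 := by
  have h0 : 0 ≤ X.toReal := ENNReal.toReal_nonneg
  -- The `+1` guarantees `T ≤ 1` and a positive denominator. The target `(1/2)²` is the squared
  -- contraction factor.
  refine ⟨1 / (4 * (X.toReal + 1)), by positivity, ?_, ?_⟩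
  · rw [div_le_one (by positivity)]
    linarith
  · rw [← ENNReal.ofReal_toReal hX, ← ENNReal.ofReal_mul h0, ENNReal.toReal_ofReal h0]
    have e : ((1 / 2 : ℝ≥0∞)) ^ 2 = ENNReal.ofReal ((1 / 2) ^ 2) := by
      rw [ENNReal.ofReal_pow (by norm_num), ENNReal.ofReal_div_of_pos (by norm_num)]
      norm_num
    rw [e]
    refine ENNReal.ofReal_le_ofReal ?_
    rw [mul_one_div, div_le_iff₀ (by positivity)]
    linarith

theorem exists_local_solution (ε a b c : ℝ) (hε : 0 < ε) (V R : ℝ≥0) :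
    ∃ T : ℝ, 0 < T ∧ T ≤ 1 ∧ ∀ v : ℝ → Torus → Fin 2 → ℝ, IsDivFreeFlow v →
      (∀ᵐ t ∂(volume.restrict (Set.Ici (0 : ℝ))), IsBoundedField V (v t)) →
      ∀ u₀ : L2, IsRealValued u₀ → sobolevNorm 2 u₀ ≤ R → ∃ u : ℝ → L2, InCH2 T u ∧
        ∀ t ∈ Set.Icc 0 T, mFourierCoeff (u t) = mildSeq ε (mFourierCoeff u₀)
          (fun s => forceSeq a b c (v s) (mFourierCoeff (u s))) t := by
  -- The ball leaves room for the free evolution, of norm at most `R`, and for a Duhamel term of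
  -- norm at most 1.
  set ρ : ℝ := R + 1
  have hM : ENNReal.ofReal ρ ^ 2 ≠ ∞ := by finiteness
  obtain ⟨L, hL, hFL⟩ := exists_forceSeq_lipschitz a b c V hM
  obtain ⟨B, hB, hFB⟩ := exists_forceSeq_bound a b c V hM
  -- The time is fixed before the flow and the data appear; `L` serves the contraction and `B` the
  -- stability of the ball.
  obtain ⟨T, hT0, hT1, hTX⟩ := exists_pos_time (X := smoothConst ε 2 * (L + B))
    (ENNReal.mul_ne_top ENNReal.ofReal_ne_top (by finiteness))
  have hTL : smoothConst ε 2 * (L * ENNReal.ofReal T) ≤ (1 / 2) ^ 2 := by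
    refine le_trans ?_ hTX
    rw [mul_assoc]
    gcongr
    exact le_self_add
  have hTB : smoothConst ε 2 * (B * ENNReal.ofReal T) ≤ 1 := by
    calc _ ≤ smoothConst ε 2 * (L + B) * ENNReal.ofReal T := by
          rw [mul_assoc]
          gcongr
          exact le_add_self
      _ ≤ (1 / 2) ^ 2 := hTX
      _ ≤ 1 := pow_le_one₀ zero_le (by norm_num)
  refine ⟨T, hT0, hT1, fun v hv hV u₀ hu₀r hu₀ => ?_⟩
  set α := mFourierCoeff u₀
  have hα : sqNorm 2 α < ∞ := sobolevNorm_lt_top_iff.mp (hu₀.trans_lt ENNReal.coe_lt_top)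
  have hαR : sqNorm 2 α ≤ (R : ℝ≥0∞) ^ 2 := sobolevNorm_le_iff.mp hu₀
  set Φ := mildMap hε hT0.le hT1 hv hV hα a b c
  have hΦ : ∀ g t, Φ g t = bessel (mildSeq ε α (pathForce a b c v hT0.le g) t) := fun _ _ => rfl
  have fin := fun g {t} (ht : t ∈ Set.Icc 0 T) =>
    sqNorm_two_mildSeq_pathForce_lt_top (a := a) (b := b) (c := c) hε hT0.le hT1 hv hV hα g ht
  have meas := fun (g : C(Set.Icc 0 T, L2)) {t} (ht : t ∈ Set.Icc 0 T) k =>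
    aestronglyMeasurable_mono_Ioc
      (aestronglyMeasurable_pathForce (a := a) (b := b) (c := c) hv hV hT0.le g k) ht.2
  -- Real-valuedness is built into the closed set, so the fixed point inherits it.
  set S : Set C(Set.Icc 0 T, L2) := {g | (∀ t, ‖g t‖ ≤ ρ) ∧ ∀ t, IsRealValued (g t)}
  have hSc : IsComplete S := by
    refine IsClosed.isComplete ?_
    simp only [S, Set.ofPred_and, Set.ofPred_forall]
    refine IsClosed.inter (isClosed_iInter fun t => ?_) (isClosed_iInter fun t => ?_)
    · exact isClosed_le (ContinuousEvalConst.continuous_eval_const t).norm continuous_const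
    · exact isClosed_isRealValued.preimage (ContinuousEvalConst.continuous_eval_const t)
  have hSmaps : Set.MapsTo Φ S S := by
    intro g hg
    refine ⟨fun t => ?_, fun t => ?_⟩
    · obtain ⟨f1, f2, -⟩ := fin g t.2
      have b1 : ‖bessel (semiSeq ε t α)‖ ≤ R := by
        have : ‖bessel (semiSeq ε t α)‖ₑ ^ 2 ≤ (R : ℝ≥0∞) ^ 2 := by
          rw [enorm_bessel_sq f1]
          exact (sqNorm_semiSeq_le hε t.2.1 2 α).trans hαR
        rw [ENNReal.pow_le_pow_left_iff two_ne_zero] at this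
        exact_mod_cast this
      have b2 : ‖bessel (duhamelSeq ε (pathForce a b c v hT0.le g) t)‖ ≤ 1 := by
        have : ‖bessel (duhamelSeq ε (pathForce a b c v hT0.le g) t)‖ₑ ^ 2 ≤ 1 ^ 2 := by
          rw [enorm_bessel_sq f2, one_pow]
          refine (sqNorm_two_duhamelSeq_le hε (t.2.2.trans hT1) (meas g t.2)).trans
            (le_trans (mul_le_mul_right ?_ _) hTB)
          refine lintegral_Ioc_le_of_bound t.2.2 ?_
          filter_upwards [isBoundedField_ae_Ioc hV t] with s hs
          exact (hFB _ hs _ (sqNorm_pathSeq_le hT0.le g hg.1 s)).2.2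
        rw [ENNReal.pow_le_pow_left_iff two_ne_zero] at this
        simpa using ENNReal.toReal_mono ENNReal.one_ne_top this
      rw [hΦ, mildSeq, bessel_add f1 f2]
      exact (norm_add_le _ _).trans (add_le_add b1 b2)
    · refine isRealValued_bessel (fin g t.2).2.2 (isHermitianSeq_mildSeq ε ?_ fun s _ => ?_)
      · exact isRealValued_iff.mp hu₀r
      · exact (isHermitianSeq_resolventSeq (hg.2 _)).forceSeq a b c (v s)
  -- The free evolutions cancel, leaving the Duhamel integral of a difference of forcings. In
  -- squared norms the factor is at most `smoothConst ε 2 * L * T ≤ (1/2)²`.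
  have hcontr : ContractingWith (1 / 2) (hSmaps.restrict Φ S S) := by
    refine ⟨by norm_num, LipschitzWith.of_dist_le_mul fun g h => ?_⟩
    change dist (Φ g.1) (Φ h.1) ≤ _ * dist g.1 h.1
    rw [ContinuousMap.dist_le (by positivity)]
    intro t
    rw [dist_eq_norm, dist_eq_norm]
    set G : C(Set.Icc 0 T, L2) := g.1
    set H : C(Set.Icc 0 T, L2) := h.1
    have hle : ‖Φ G t - Φ H t‖ₑ ^ 2 ≤ ((1 / 2) * ‖G - H‖ₑ) ^ 2 := by
      rw [hΦ, hΦ, ← bessel_sub (fin G t.2).2.2 (fin H t.2).2.2,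
        enorm_bessel_sq (sqNorm_two_sub_lt_top (fin G t.2).2.2 (fin H t.2).2.2), mildSeq, mildSeq,
        add_sub_add_left_eq_sub, ← duhamelSeq_sub (meas G t.2) (meas H t.2)
          (lintegral_pathForce_lt_top hV hT0.le G t) (lintegral_pathForce_lt_top hV hT0.le H t)]
      refine (sqNorm_two_duhamelSeq_le hε (t.2.2.trans hT1)
        fun k => (meas G t.2 k).sub (meas H t.2 k)).trans ?_
      calc _ ≤ smoothConst ε 2 * (L * ‖G - H‖ₑ ^ 2 * ENNReal.ofReal T) := by
            refine mul_le_mul_right (lintegral_Ioc_le_of_bound t.2.2 ?_) _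
            filter_upwards [isBoundedField_ae_Ioc hV t] with s hs
            refine (hFL _ hs _ _ (sqNorm_pathSeq_le hT0.le G g.2.1 s)
              (sqNorm_pathSeq_le hT0.le H h.2.1 s)).trans ?_
            rw [pathSeq, pathSeq, ← resolventSeq_sub, sqNorm_resolventSeq]
            gcongr
            rw [← ofReal_norm, ← ofReal_norm]
            exact ENNReal.ofReal_le_ofReal ((G - H).norm_coe_le_norm _)
        _ = smoothConst ε 2 * (L * ENNReal.ofReal T) * ‖G - H‖ₑ ^ 2 := by ring
        _ ≤ (1 / 2) ^ 2 * ‖G - H‖ₑ ^ 2 := by gcongr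
        _ = _ := (mul_pow _ _ _).symm
    rw [ENNReal.pow_le_pow_left_iff two_ne_zero] at hle
    have := ENNReal.toReal_mono (by finiteness) hle
    simpa using this
  obtain ⟨g, hgS, hgΦ, -⟩ := hcontr.exists_fixedPoint' hSc hSmaps (x := 0)
    ⟨fun t => by simpa [ρ] using (by positivity : (0 : ℝ) ≤ R + 1), fun t => by
      rw [isRealValued_iff, ContinuousMap.zero_apply, mFourierCoeff_L2_zero]
      exact fun k => (map_zero _).symm⟩ (edist_ne_top _ _)
  set u : ℝ → L2 := fun s => fourierInv (pathSeq hT0.le g s)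
  have hucoef : ∀ s, mFourierCoeff (u s) = pathSeq hT0.le g s := fun s =>
    mFourierCoeff_fourierInv (sqNorm_lt_top_of_le (by norm_num) (sqNorm_resolventSeq_lt_top _))
  have hsol : ∀ t ∈ Set.Icc 0 T, mFourierCoeff (u t) = mildSeq ε α
      (pathForce a b c v hT0.le g) t := by
    intro t ht
    rw [hucoef, pathSeq, Set.projIcc_of_mem hT0.le ht, ← hgΦ, hΦ,
      resolventSeq_bessel (fin _ ht).2.2]
    -- The backward rewrite also replaced `g` inside the forcing; this restores it.
    rw [hgΦ]
  refine ⟨u, fun t ht => ⟨?_, ?_, ?_⟩, fun t ht => ?_⟩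
  · rw [isRealValued_iff, hucoef]
    exact isHermitianSeq_resolventSeq (hgS.2 _)
  · rw [sobolevNorm_lt_top_iff, hucoef]
    exact sqNorm_resolventSeq_lt_top _
  · simp only [sobolevNorm_eq, mFourierCoeff_L2_sub]
    refine ennreal_tendsto_sqrt_zero ?_
    refine (tendsto_sqNorm_mildSeq_sub hε hT1 hα
      (aestronglyMeasurable_pathForce (a := a) (b := b) (c := c) hv hV hT0.le g)
      (lintegral_pathForce_lt_top hV hT0.le g T) ht).congr' ?_
    filter_upwards [self_mem_nhdsWithin] with s hs
    rw [hsol s hs, hsol t ht]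
  · rw [hsol t ht]
    simp only [hucoef]
    rfl

end Existence

end CahnHilliard

end

/-! ### Local well-posedness. -/

theorem theorem2p1 (ε a b c : ℝ) (hε : 0 < ε) (V R : ℝ≥0) :
    ∃ T : ℝ, 0 < T ∧ T ≤ 1 ∧
      ∀ v : ℝ → CahnHilliard.Torus → Fin 2 → ℝ,
        CahnHilliard.IsDivFreeFlow v → CahnHilliard.flowNorm v ≤ V →
      ∀ u₀ : CahnHilliard.L2,
        CahnHilliard.IsRealValued u₀ → CahnHilliard.sobolevNorm 2 u₀ ≤ R →
      ∃ u : ℝ → CahnHilliard.L2,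
        CahnHilliard.IsMildSolution ε a b c v u₀ T u ∧
        CahnHilliard.InXT T u ∧
        -- uniqueness among all mild solutions
        (∀ w : ℝ → CahnHilliard.L2, CahnHilliard.IsMildSolution ε a b c v u₀ T w →
          ∀ t ∈ Set.Icc 0 T, w t = u t) ∧
        -- uniqueness among all solutions of the integral equation in the weighted space
        (∀ w : ℝ → CahnHilliard.L2, CahnHilliard.InXT T w →
          CahnHilliard.SolvesDuhamel ε a b c v u₀ T w →
          ∀ t ∈ Set.Icc 0 T, w t = u t) := by
  obtain ⟨T, hT0, hT1, hex⟩ := CahnHilliard.exists_local_solution ε a b c hε V R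
  refine ⟨T, hT0, hT1, fun v hv hVn u₀ hu₀r hu₀ => ?_⟩
  have hV := CahnHilliard.isBoundedField_of_flowNorm_le hv hVn
  obtain ⟨u, hu, hsol⟩ := hex v hv hV u₀ hu₀r hu₀
  have hα := CahnHilliard.sobolevNorm_lt_top_iff.mp (hu₀.trans_lt ENNReal.coe_lt_top)
  obtain ⟨hL2H4, hXT⟩ := hu.regularity hε hT1 hv hV hα hsol
  have hduh := (hu.solvesDuhamel_iff hε hT1 hv hV u₀).mpr hsol
  exact ⟨u, ⟨hu, hL2H4, hduh⟩, hXT,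
    fun w hw => CahnHilliard.solvesDuhamel_unique hε hT1 hv hV hu hw.continuous_H2 hduh hw.duhamel,
    fun w hw hws => CahnHilliard.solvesDuhamel_unique hε hT1 hv hV hu hw.1 hduh hws⟩
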